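/- **Permutations.** A permutation $\pi$ of $\{1,\dots,n\}$ is written in line form $\pi(1),\dots,\pi(n)$. Its blocks are the consecutive segments obtained by cutting after the minimum of the whole line, then after the minimum of what remains, and so on; a block with one element is a singlet. A value $\pi(i)$ is an ascent value if $\pi(i-1)<\pi(i)$ (with $\pi(0)=0$) and a descent value otherwise. The color of a value is black (k) if it is a singlet, and otherwise red (r) for an ascent value and blue (b) for a descent value. The pattern of a sequence of distinct numbers is obtained by replacing each number by its rank. **Families, parenthesized form.** A family is a one-element sequence or a sequence $(a_1,\dots,a_k,b_l,\dots,b_1)$ with $k,l\ge1$ and $b_1<\dots<b_l<a_1<\dots<a_k$; the $a_i$ are red and the $b_i$ blue. The parenthesized form of $\pi$ is a parenthesization of its line form, defined by induction on $n$ from the parenthesized form of the permutation with $n$ removed. If $n$ is last in $\pi$, append $(n)$ as a new outermost parenthesis. Otherwise let $m$ follow $n$ in $\pi$, and let $F$ be the active family of the innermost parenthesis containing $m$, i.e. its content after removing the inner parentheses together with their contents. If inserting $n$ before $m$ in $F$ gives a family, insert $n$ immediately before $m$ inside this parenthesis; if not, replace $m$ by a new inner parenthesis $(n\ m)$. The node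 of a parenthesis with at least two elements is its content with each inner parenthesis replaced by the two smallest elements of the latter, in their order (a bud); the smallest one is the founder. **Primitive permutations.** Primitive permutations $\sigma$, with active family $\mathcal A$, buds and pairing pattern $\mathcal P$, are defined by induction. $(2,1)$ is primitive, with $\mathcal A=(2,1)$, no buds, $\mathcal P=(1,2)$. If $\sigma'$ of $\{1,\dots,n-1\}$ is primitive and $m\in\mathcal A'$, inserting $n$ before $m$ gives a primitive $\sigma$. If $\mathcal A'$ with $n$ inserted before $m$ is a family, that family is $\mathcal A$, the buds are unchanged, and $b+f$ is appended to $\mathcal P'$, where $b$ is the number of buds and $f=|\mathcal A|$. If it is not a family, $\mathcal A$ is $\mathcal A'$ with $m$ removed, $(n,m)$ becomes a bud, and $-\mathcal P'_m$ is appended to $\mathcal P'$. The colored pairing sequence of $\sigma$ is obtained from $\mathcal P$ by replacing each pair $p,-p$ by $p.1,\ p.2$, and each unpaired $p=\mathcal P_v$ by $p.c$, with $c$ the color of $v$ in the family $\mathcal A$. **Decimal code of a permutation.** Each value of $\pi$ gets a decimal number. The $i$-th outermost parenthesis has head $i$; the value in a singlet block gets $i.k$. In a parenthesis with head $h$ and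 at least two elements, list increasingly the members of its active family and the founders of its immediate inner parentheses. The member that is $p$-th in this list gets the decimal number $h.p.c$, with $c$ its color in the active family; the inner parenthesis whose founder is $p$-th gets the head $h.p$. The decimal code of $\pi$ is the sequence of the decimal numbers of the values $1,2,\dots,n$, in this order. **Axioms.** A decimal number is $i_1.i_2.\cdots.i_k.c$ with $k\ge1$, digits $i_j\in\{1,2,\dots\}$ and color $c\in\{r,b,k\}$; its heads are $i_1.\cdots.i_l$, $1\le l\le k$. A decimal code is a finite sequence $\delta$ of decimal numbers such that: 1. Each head $h$ of an entry is either always followed by a color, and then it is a head of only one entry, or always followed by a number (then $h$ is called a branch head). 2. For each branch head $h$, the node cut of $h$ is a colored pairing sequence. The node cut consists of the entries $h.n.c$, which give $n.c$, and $h.n.n'.1.\cdots.1.c$ with $n'\in\{1,2\}$ and $\ge0$ ones after $n'$, which give $n.n'$, in the order of $\delta$. A sequence of such pairs is a colored pairing sequence if: - the elements not of the form $n.2$ have first digits $1,2,3,\dots$, in this order; - each $n.2$ is preceded by $n.1$, and occurs at most once; - the colors that occur are, in order, at least one $b$ followed by at least one $r$, and no others; - if $n.2$ is replaced by $-1$ and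 the other elements by $+1$, then the sum of the first $k$ terms is $\ge2$ for every $k\ge2$ not exceeding the length. 3. The first digits of the entries form a set $\{1,\dots,m\}$ (the block labels). 4. For each block label $i$ exactly one entry $\alpha(i)$ is of the form $i.1.\cdots.1.c$ with $\ge0$ ones after $i$. Its color is black if there are no ones, and blue otherwise. The anchors $\alpha(1),\alpha(2),\dots$ appear in this order. **Theorem.** For every $n\ge0$, $\pi\mapsto$ (decimal code of $\pi$) is a bijection from the permutations of $\{1,\dots,n\}$ onto the decimal codes with $n$ entries. Moreover, let $\delta$ be the decimal code of $\pi$. (a) Removing the parentheses from the parenthesized form of $\pi$ gives $\pi$, and replacing there each value by the position of its decimal number in $\delta$ gives again the line form of $\pi$: the $v$-th entry of $\delta$ corresponds to the value $v$. (b) The color of the $v$-th entry is the color (ascent, descent, singlet) of the value $v$ in $\pi$. (c) The outermost parentheses are, in order, the blocks of $\pi$, and for every $i\ge 1$ the entries with head $i$ are those of the values in the $i$-th block (there are none if there is no $i$-th block). (d) There is a bijection $h\mapsto T_h$ from the branch heads of $\delta$ to the parentheses with at least two elements in the parenthesized form of $\pi$, such that: $T_i$ is the $i$-th outermost parenthesis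 for a branch head $i$ of length $1$; $T_{h.p}$ is an immediate inner parenthesis of $T_h$ whenever $h.p$ is a branch head and $h$ is nonempty; the entries with head $h$ are those of the values enclosed in $T_h$; and each entry $h.p.c$ (where $h$ is a branch head) is that of a member of the active family of $T_h$. (e) For every branch head $h$, the pattern of the node of $T_h$ is a primitive permutation, its active family is the active family of $T_h$ with each value replaced by its rank in the node, and its colored pairing sequence is the node cut of $h$. -/

import Mathlib

namespace PermTree

/-! ### Permutations in line notation, successive minima, blocks, colors -/

/-- The line form `π(1), …, π(n)` of a permutation of `{1, …, n}`
(`Fin n` is `{0, …, n - 1}`, hence the shift by one). -/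
def line {n : ℕ} (π : Equiv.Perm (Fin n)) : List ℕ :=
  List.ofFn fun i => (π i : ℕ) + 1

/-- The blocks of a sequence of distinct numbers: the first one ends at the minimum of the
sequence, the second one at the minimum of what remains after the first one, and so on. -/
def blocks (l : List ℕ) : List (List ℕ) :=
  match l with
  | [] => []
  | a :: l' =>
    let k := (a :: l').idxOf (l'.foldl min a) + 1
    (a :: l').take k :: blocks ((a :: l').drop k)
termination_by l.length
decreasing_by simp

inductive Color where
  | red
  | blue
  | black
  deriving DecidableEq

/-- Red for the ascent values of the sequence `0, l₁, l₂, …`, blue for its descent values. -/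
def ascentColor (l : List ℕ) (v : ℕ) : Color :=
  if (0 :: l).getD (l.idxOf v) 0 < v then .red else .blue

/-- The status of a value of a permutation: black for a singlet block, otherwise red for an
ascent value and blue for a descent value. -/
def valueColor (l : List ℕ) (v : ℕ) : Color :=
  if [v] ∈ blocks l then .black else ascentColor l v

/-- The position (starting from 1) of a member `x` of `l` when `l` is ordered increasingly. -/
def rank (l : List ℕ) (x : ℕ) : ℕ := l.countP (· ≤ x)

/-! ### Families and the parenthesized form -/

/-- A sequence family: a singlet, or an increasing nonempty sequence (the reds) followed by a
decreasing nonempty sequence (the blues), with every red larger than every blue. -/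
def IsFamily (l : List ℕ) : Prop :=
  l.length = 1 ∨ ∃ k ∈ Finset.Ioo 0 l.length,
    (l.take k).Pairwise (· < ·) ∧ (l.drop k).Pairwise (· > ·) ∧
      ∀ a ∈ l.take k, ∀ b ∈ l.drop k, b < a

instance (l : List ℕ) : Decidable (IsFamily l) := by
  unfold IsFamily; infer_instance

/-- Insert `n` immediately before `m`. -/
def insertBefore (n m : ℕ) : List ℕ → List ℕ
  | [] => []
  | a :: l => if a = m then n :: a :: l else a :: insertBefore n m l

/-- Sequences with nested parentheses: empty, or a number followed by such a sequence,
or a parenthesis (with content such a sequence) followed by such a sequence. -/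
inductive ParSeq where
  | nil : ParSeq
  | elem (v : ℕ) (rest : ParSeq) : ParSeq
  | paren (inner rest : ParSeq) : ParSeq

namespace ParSeq

/-- Remove all the parentheses, keeping their contents. -/
def flatten : ParSeq → List ℕ
  | nil => []
  | elem v r => v :: r.flatten
  | paren t r => t.flatten ++ r.flatten

/-- Remove all the parentheses together with their contents: the active family. -/
def active : ParSeq → List ℕ
  | nil => []
  | elem v r => v :: r.active
  | paren _ r => r.active

/-- The contents of the outermost parentheses, from left to right. -/
def children : ParSeq → List ParSeq
  | nil => []
  | elem _ r => r.children
  | paren t r => t :: r.children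

/-- The contents of all the parentheses, at all depths. -/
def parens : ParSeq → List ParSeq
  | nil => []
  | elem _ r => r.parens
  | paren t r => t :: (t.parens ++ r.parens)

/-- Append a parenthesis which contains only `v`. -/
def appendSinglet (v : ℕ) : ParSeq → ParSeq
  | nil => paren (elem v nil) nil
  | elem a r => elem a (appendSinglet v r)
  | paren t r => paren t (appendSinglet v r)

/-- Insert `n` immediately before its friend `m`.  Here `fam` is the active family of the
parenthesis whose content is being read.  If the family of `m`, with `n` inserted before `m`, is a
family, `n` joins it; otherwise `n` and `m` start a new parenthesis `(n m)` in the place of `m`. -/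
def insertFriend (n m : ℕ) (fam : List ℕ) : ParSeq → ParSeq
  | nil => nil
  | elem v r =>
    if v = m then
      if IsFamily (insertBefore n m fam) then elem n (elem v r)
      else paren (elem n (elem v nil)) r
    else elem v (insertFriend n m fam r)
  | paren t r => paren (insertFriend n m t.active t) (insertFriend n m fam r)

/-- The two smallest elements of a parenthesis, in the order in which they occur: the bud from
which the parenthesis developed. -/
def bud (t : ParSeq) : List ℕ :=
  t.flatten.filter fun x => rank t.flatten x ≤ 2

/-- The node of a parenthesis with content `s`: each inner parenthesis is replaced by its bud. -/
def node : ParSeq → List ℕ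
  | nil => []
  | elem v r => v :: r.node
  | paren t r => t.bud ++ r.node

/-- The smallest number in a sequence with parentheses. -/
def least (t : ParSeq) : ℕ := t.flatten.min?.getD 0

/-- The numbers of a sequence with parentheses which are outside its parentheses, and the
smallest number (the founder) of each of its outermost parentheses. -/
def founders : ParSeq → List ℕ
  | nil => []
  | elem v r => v :: r.founders
  | paren t r => t.least :: r.founders

end ParSeq

/-- The parenthesized form of a line permutation of `{1, …, n}`, by inserting the largest element
`n` into the parenthesized form of the permutation from which `n` was removed: at the end, as a
singlet block, if `n` is last, and otherwise before the element which follows `n`. -/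
def parForm : ℕ → List ℕ → ParSeq
  | 0, _ => .nil
  | n + 1, l =>
    match l[l.idxOf (n + 1) + 1]? with
    | none => (parForm n (l.erase (n + 1))).appendSinglet (n + 1)
    | some m => (parForm n (l.erase (n + 1))).insertFriend (n + 1) m []

/-! ### Decimal numbers and the decimal code of a permutation -/

/-- `i₁.i₂.⋯.iₖ.c`, with digits `i₁, …, iₖ` and color `c`. -/
structure DecimalNumber where
  digits : List ℕ
  color : Color
  deriving DecidableEq

/-- The values in a parenthesis with head `h`, each with its decimal number.  A member of the
active family gets the head `h.p` followed by its color in the active family `fam`, and an inner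
parenthesis gets the head `h.p`, where `p` is the rank of the member, respectively of the
founder of the inner parenthesis, among the list `fs` of members and founders of the node. -/
def numberNode (h fs fam : List ℕ) : ParSeq → List (ℕ × DecimalNumber)
  | .nil => []
  | .elem v r => (v, ⟨h ++ [rank fs v], ascentColor fam v⟩) :: numberNode h fs fam r
  | .paren t r =>
    numberNode (h ++ [rank fs t.least]) t.founders t.active t ++ numberNode h fs fam r

/-- The values in a parenthesized form, each with its decimal number: the content of the `i`-th
outermost parenthesis gets the head `i`; the value in a singlet block gets `i.black`. -/
def numberBlocks : ℕ → ParSeq → List (ℕ × DecimalNumber)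
  | _, .nil => []
  | i, .elem _ r => numberBlocks i r
  | i, .paren (.elem v .nil) r => (v, ⟨[i], .black⟩) :: numberBlocks (i + 1) r
  | i, .paren t r => numberNode [i] t.founders t.active t ++ numberBlocks (i + 1) r

/-- The parenthesized form of a permutation. -/
def parenthesized {n : ℕ} (π : Equiv.Perm (Fin n)) : ParSeq := parForm n (line π)

/-- The values of a permutation, in the order in which they occur in its line form, each with its
decimal number. -/
def numbered {n : ℕ} (π : Equiv.Perm (Fin n)) : List (ℕ × DecimalNumber) :=
  numberBlocks 1 (parenthesized π)

/-- The decimal code of a permutation: the decimal numbers of the values `1, 2, …, n`, in this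
order. -/
def decimalCode {n : ℕ} (π : Equiv.Perm (Fin n)) : List DecimalNumber :=
  (List.range' 1 n).filterMap fun v => (numbered π).lookup v

/-! ### The axioms of decimal codes -/

/-- `h` is a head of the decimal number `ν`. -/
def IsHead (h : List ℕ) (ν : DecimalNumber) : Prop := h ≠ [] ∧ h <+: ν.digits

instance (h : List ℕ) (ν : DecimalNumber) : Decidable (IsHead h ν) := by
  unfold IsHead; infer_instance

/-- In some entry of `δ`, the head `h` is immediately followed by a number. -/
def IsBranchHead (δ : List DecimalNumber) (h : List ℕ) : Prop :=
  ∃ ν ∈ δ, IsHead h ν ∧ ν.digits ≠ h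

/-- The second digit of an element of a colored pairing sequence: `1`, `2` or a color. -/
inductive Mark where
  | one
  | two
  | leaf (c : Color)
  deriving DecidableEq

def Mark.color? : Mark → Option Color
  | .leaf c => some c
  | _ => none

def Mark.sign : Mark → ℤ
  | .two => -1
  | _ => 1

/-- The two digits which follow the head `h` in `ν`, if `ν` is `h.k.c`, or `h.k.k'.1.⋯.1.c` with
`k' = 1` or `k' = 2` (and any number of 1's after `k'`, possibly none). -/
def cutEntry (h : List ℕ) (ν : DecimalNumber) : Option (ℕ × Mark) :=
  if IsHead h ν then
    match ν.digits.drop h.length with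
    | [] => none
    | [k] => some (k, .leaf ν.color)
    | k :: k' :: rest =>
      if ∀ x ∈ rest, x = 1 then
        if k' = 1 then some (k, .one) else if k' = 2 then some (k, .two) else none
      else none
  else none

/-- The node cut of `h`, with the head `h` cut off. -/
def nodeCut (δ : List DecimalNumber) (h : List ℕ) : List (ℕ × Mark) :=
  δ.filterMap (cutEntry h)

structure IsColoredPairing (s : List (ℕ × Mark)) : Prop where
  /-- the elements `k.1`, `k.b`, `k.r` appear in the natural order of `k`, one for each `k` -/
  positives : ∃ p, (s.filter fun x => x.2 ≠ .two).map Prod.fst = List.range' 1 p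
  /-- each `k.2` is paired with a previous `k.1` -/
  paired : ∀ (i k : ℕ), s[i]? = some (k, .two) → ∃ j < i, s[j]? = some (k, .one)
  /-- at most one pair for each `k` -/
  paired_once : ∀ k : ℕ, s.count (k, .two) ≤ 1
  /-- the colors are blues followed by reds, at least one of each -/
  colors : ∃ b r : ℕ, 1 ≤ b ∧ 1 ≤ r ∧
    s.filterMap (fun x => x.2.color?) = List.replicate b .blue ++ List.replicate r .red
  dyck : ∀ k, 2 ≤ k → k ≤ s.length → 2 ≤ ((s.take k).map fun x => x.2.sign).sum

/-- `ν` has the form `i.1.⋯.1.c`, with `j` 1's after `i`. -/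
def IsAnchorWith (i j : ℕ) (ν : DecimalNumber) : Prop :=
  ν.digits = i :: List.replicate j 1

def IsAnchor (i : ℕ) (ν : DecimalNumber) : Prop := ∃ j, IsAnchorWith i j ν

def IsBlockLabel (δ : List DecimalNumber) (i : ℕ) : Prop :=
  ∃ ν ∈ δ, ν.digits.head? = some i

structure IsDecimalCode (δ : List DecimalNumber) : Prop where
  digits_ne_nil : ∀ ν ∈ δ, ν.digits ≠ []
  digits_pos : ∀ ν ∈ δ, ∀ d ∈ ν.digits, 1 ≤ d
  /-- a head is either always followed by a color, and then it is a head of only one entry,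
  or always followed by a number -/
  leaf_or_branch : ∀ h, (∃ ν ∈ δ, IsHead h ν) →
    (δ.countP (fun ν => IsHead h ν) = 1 ∧ ∀ ν ∈ δ, IsHead h ν → ν.digits = h) ∨
      ∀ ν ∈ δ, IsHead h ν → ν.digits ≠ h
  nodeCut_pairing : ∀ h, IsBranchHead δ h → IsColoredPairing (nodeCut δ h)
  blockLabels : ∃ m, ∀ i, IsBlockLabel δ i ↔ 1 ≤ i ∧ i ≤ m
  /-- for each block label `i` there is exactly one block anchor -/
  anchor : ∀ i, IsBlockLabel δ i → ∃! k : Fin δ.length, IsAnchor i (δ.get k)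
  anchor_color : ∀ ν ∈ δ, ∀ i j, IsAnchorWith i j ν → ν.color = if j = 0 then .black else .blue
  anchor_order : δ.Pairwise fun ν μ => ∀ i j, IsAnchor i ν → IsAnchor j μ → i < j

/-- The positions (starting from 1) of the entries of `δ` with head `h`, in increasing order. -/
def positions (δ : List DecimalNumber) (h : List ℕ) : List ℕ :=
  (δ.zipIdx 1).filterMap fun x => if IsHead h x.1 then some x.2 else none

/-! ### Primitive permutations and their pairing sequences -/

/-- The pattern of a sequence of distinct numbers. -/
def pattern (l : List ℕ) : List ℕ := l.map (rank l)

/-- `IsPrimitive σ A B P`: the line permutation `σ` is primitive, with active family `A`, list of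
buds `B`, and pairing pattern `P`. -/
inductive IsPrimitive : List ℕ → List ℕ → List (ℕ × ℕ) → List ℤ → Prop where
  | base : IsPrimitive [2, 1] [2, 1] [] [1, 2]
  /-- the new largest element `n` joins the active family, before its friend `m` -/
  | grow {σ A : List ℕ} {B : List (ℕ × ℕ)} {P : List ℤ} (n m : ℕ)
      (hσ : IsPrimitive σ A B P) (hn : n = σ.length + 1) (hm : m ∈ A)
      (hfit : IsFamily (insertBefore n m A)) :
      IsPrimitive (insertBefore n m σ) (insertBefore n m A) B
        (P ++ [(B.length : ℤ) + ((insertBefore n m A).length : ℤ)])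
  /-- the new largest element `n` takes its friend `m` out of the active family -/
  | bud {σ A : List ℕ} {B : List (ℕ × ℕ)} {P : List ℤ} (n m : ℕ)
      (hσ : IsPrimitive σ A B P) (hn : n = σ.length + 1) (hm : m ∈ A)
      (hfit : ¬ IsFamily (insertBefore n m A)) :
      IsPrimitive (insertBefore n m σ) (A.erase m) ((n, m) :: B)
        (P ++ [-(P.getD (m - 1) 0)])

/-- The colored pairing sequence of a primitive permutation with active family `A` and pairing
pattern `P`: a pair `(p, -p)` becomes `(p.1, p.2)`, and an unpaired entry of `P`, on position `v`,
is followed by the color of `v` in the family `A`. -/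
def coloredPairing (A : List ℕ) (P : List ℤ) : List (ℕ × Mark) :=
  (P.zipIdx 1).map fun x =>
    (x.1.natAbs,
      if x.1 < 0 then .two else if -x.1 ∈ P then .one else .leaf (ascentColor A x.2))

end PermTree

open PermTree

/-!
The decimal code of a permutation is built up one value at a time, and the theorem is a comparison
of two ways of growing: permutations grow by the insertion of a new largest value, and decimal
codes grow by one entry. The insertion of `n + 1` changes the code of a permutation of `1, …, n` in
one of three ways (`CodeStep`):

* at the end of the line, it is a new singlet block, and the entry `(M + 1).k` is appended, where
  `M` is the number of blocks;
* before a friend with entry `D.c`, the family of which it cannot join, it forms a new parenthesis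
  with this friend: the entry of the friend becomes `D.1.b`, and `D.2.r` is appended;
* before a friend with entry `h.p.c`, the family of which it can join, the entry of the friend
  becomes `h.p.b`, and `h.(K + 1).r` is appended, where `K` is the number of digits in use after `h`.

No other entry changes, because the new value is larger than all the others: it does not disturb
the ranks from which the digits are made. A new value can join a family exactly before its last
blue, or before its only red (`isFamily_insertBefore_iff_color`); this condition can be read off
from the code (`Fit`, `Coded.fit_iff`), so that the step on the code is determined by the digits of
the friend (`CodeStep.unique`).

On the side of the codes, the conditions amount to prefix-freeness together with conditions on the
node cuts and the anchors (`isDecimalCode_iff_validCode`). A step changes at most two node cuts: it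
creates the node cut `1.b, 2.r`, and it adds one element to another one, either a last red or the
second of a new pair. Hence steps lead from codes to codes (`ValidCode.step`), every nonempty code
arises by a step (`exists_codeStep`), and the code after a step determines the code before it and
the digits of the friend (`codeStep_injective`). The point of the last two facts is that the former
color of the friend can be recovered: before a join, the friend was red if no other red precedes
the new one, and blue otherwise; before the formation of a pair, it was blue if another blue follows
it, and red otherwise. The condition on the partial sums ensures that there always remain a blue
and a red. By induction on `n`, different permutations have different codes
(`listCode_injective`), and every code is the code of a permutation (`exists_listCode_eq`).

The other clauses are invariants of the growth, collected in `Coded`: the blocks are the outermost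
parentheses, the colors of the entries are those of the values, and each node with at least two
elements is a primitive permutation (`PrimitiveNode`) in whose pairing pattern the absolute values
are the digits of the node cut, and the signs distinguish the two elements of a pair. The latter
gives `Coded.nodeCut_eq`. The heads of the entries are related to the parentheses by `Located`: the
branch heads are the heads of the parentheses with at least two elements, and the entries with such
a head are those of the values inside.
-/

namespace PermTree

/-! ### Colored pairing sequences -/

/-- The colors that occur in a sequence of marked digits, in order. -/
def cutColors (s : List (ℕ × Mark)) : List Color := s.filterMap fun x => x.2.color?

/-- The sum of the signs of a sequence of marked digits. -/
def signSum (s : List (ℕ × Mark)) : ℤ := (s.map fun x => x.2.sign).sum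

/-- The digits of the elements of a sequence of marked digits which are not second in a pair. -/
def positiveDigits (s : List (ℕ × Mark)) : List ℕ :=
  (s.filter fun x => x.2 ≠ .two).map Prod.fst

/-- A list of colors consists of blues followed by reds, at least one of each. -/
structure BlueThenRed (l : List Color) : Prop where
  sorted : l.Pairwise fun x y => x = .red → y = .red
  not_black : Color.black ∉ l
  blue_mem : Color.blue ∈ l
  red_mem : Color.red ∈ l

theorem blueThenRed_iff (l : List Color) :
    BlueThenRed l ↔ ∃ b r : ℕ, 1 ≤ b ∧ 1 ≤ r ∧
      l = List.replicate b .blue ++ List.replicate r .red := by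
  constructor
  · rintro ⟨hs, hk, hb, hr⟩
    have key : ∀ l : List Color, l.Pairwise (fun x y => x = .red → y = .red) →
        Color.black ∉ l → ∃ b r, l = List.replicate b .blue ++ List.replicate r .red := by
      intro l
      induction l with
      | nil => exact fun _ _ => ⟨0, 0, rfl⟩
      | cons a l ih =>
        intro hs hk
        rw [List.pairwise_cons] at hs
        obtain ⟨b, r, h⟩ := ih hs.2 (fun h => hk (List.mem_cons_of_mem _ h))
        cases a with
        | black => simp at hk
        | blue => exact ⟨b + 1, r, by rw [h, List.replicate_succ, List.cons_append]⟩
        | red =>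
          refine ⟨0, l.length + 1, ?_⟩
          rw [List.replicate_succ, List.replicate_zero, List.nil_append]
          congr 1
          exact List.eq_replicate_iff.2 ⟨rfl, fun x hx => hs.1 x hx rfl⟩
    obtain ⟨b, r, rfl⟩ := key l hs hk
    refine ⟨b, r, ?_, ?_, rfl⟩
    · simp [List.mem_replicate] at hb; omega
    · simp [List.mem_replicate] at hr; omega
  · rintro ⟨b, r, hb, hr, rfl⟩
    refine ⟨?_, ?_, ?_, ?_⟩
    · rw [List.pairwise_append]
      refine ⟨?_, ?_, ?_⟩
      · exact List.pairwise_replicate.2 (Or.inr (by simp))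
      · exact List.pairwise_replicate.2 (Or.inr (by simp))
      · intro x _ y hy _
        exact (List.mem_replicate.1 hy).2
    · simp [List.mem_replicate]
    · simp [List.mem_replicate]; omega
    · simp [List.mem_replicate]; omega

theorem blueThenRed_two_le {l : List Color} (hb : BlueThenRed l) : 2 ≤ l.length := by
  have hb1 := hb.blue_mem
  have hr1 := hb.red_mem
  match hl : l with
  | [] => simp at hb1
  | [a] => simp at hb1 hr1; rw [← hb1] at hr1; simp at hr1
  | a :: b :: l => simp

theorem signSum_append (s t : List (ℕ × Mark)) : signSum (s ++ t) = signSum s + signSum t := by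
  simp [signSum]

theorem cutColors_append (s t : List (ℕ × Mark)) :
    cutColors (s ++ t) = cutColors s ++ cutColors t := by
  simp [cutColors]

theorem positiveDigits_append (s t : List (ℕ × Mark)) :
    positiveDigits (s ++ t) = positiveDigits s ++ positiveDigits t := by
  simp [positiveDigits]

theorem mem_positiveDigits {s : List (ℕ × Mark)} {k : ℕ} :
    k ∈ positiveDigits s ↔ ∃ m, (k, m) ∈ s ∧ m ≠ .two := by
  simp [positiveDigits]

theorem mem_cutColors {s : List (ℕ × Mark)} {c : Color} :
    c ∈ cutColors s ↔ ∃ k, (k, Mark.leaf c) ∈ s := by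
  simp only [cutColors, List.mem_filterMap]
  constructor
  · rintro ⟨⟨k, m⟩, h, hc⟩
    cases m <;> simp [Mark.color?] at hc
    subst hc; exact ⟨k, h⟩
  · rintro ⟨k, h⟩
    exact ⟨_, h, rfl⟩

/-- In a sequence whose positive elements have the digits `1, 2, 3, …`, an element which is not
second in a pair is determined by its digit. -/
theorem eq_of_positives {s : List (ℕ × Mark)} {p : ℕ} (h : positiveDigits s = List.range' 1 p)
    {k : ℕ} {m m' : Mark} (hm : (k, m) ∈ s) (hm' : (k, m') ∈ s) (h2 : m ≠ .two) (h2' : m' ≠ .two) :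
    m = m' := by
  have hn : (positiveDigits s).Nodup := by rw [h]; exact List.nodup_range'
  have := List.inj_on_of_nodup_map hn (List.mem_filter.2 ⟨hm, by simpa using h2⟩)
    (List.mem_filter.2 ⟨hm', by simpa using h2'⟩) rfl
  exact (Prod.mk.inj this).2

theorem mem_of_paired {s : List (ℕ × Mark)} (h : IsColoredPairing s) {k : ℕ}
    (hk : (k, Mark.two) ∈ s) : (k, Mark.one) ∈ s := by
  obtain ⟨i, hi⟩ := List.mem_iff_getElem?.1 hk
  obtain ⟨j, _, hj⟩ := h.paired i k hi
  exact List.mem_of_getElem? hj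

/-- The digit of a leaf occurs only once in a colored pairing sequence. -/
theorem IsColoredPairing.eq_leaf {s : List (ℕ × Mark)} (h : IsColoredPairing s) {k : ℕ} {c : Color}
    (hk : (k, Mark.leaf c) ∈ s) {m : Mark} (hm : (k, m) ∈ s) : m = .leaf c := by
  obtain ⟨p, hp⟩ := h.positives
  have h1 : ∀ m', (k, m') ∈ s → m' ≠ .two → m' = .leaf c := fun m' hm' h2 =>
    eq_of_positives hp hm' hk h2 (by simp)
  by_cases h2 : m = .two
  · subst h2
    have := h1 _ (mem_of_paired h hm) (by simp)
    simp at this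
  · exact h1 m hm h2

/-- A positive element occurs at most once, since the positive digits are distinct. -/
theorem count_one_le {s : List (ℕ × Mark)} {p : ℕ} (h : positiveDigits s = List.range' 1 p)
    (k : ℕ) (m : Mark) (hm : m ≠ .two) : s.count (k, m) ≤ 1 := by
  have hn : (positiveDigits s).Nodup := by rw [h]; exact List.nodup_range'
  have hn' := hn.of_map
  rw [List.nodup_iff_count_le_one] at hn'
  have := hn' (k, m)
  rwa [List.count_filter (by simpa using hm)] at this

/-- The firsts and seconds of pairs have the signs `+1` and `-1`, and every colored element has
the sign `+1`. -/
theorem signSum_eq (s : List (ℕ × Mark)) :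
    signSum s = (cutColors s).length + ((s.filter fun x => x.2 = .one).map Prod.fst).length
      - ((s.filter fun x => x.2 = .two).map Prod.fst).length := by
  induction s with
  | nil => simp [signSum, cutColors]
  | cons a s ih =>
    obtain ⟨k, m⟩ := a
    have h1 : signSum ((k, m) :: s) = m.sign + signSum s := by simp [signSum]
    rw [h1, ih]
    cases m <;> simp [cutColors, Mark.sign, Mark.color?] <;> ring

theorem nodup_digits_of_mark {s : List (ℕ × Mark)} {m : Mark}
    (h : ∀ k, s.count (k, m) ≤ 1) : ((s.filter fun x => x.2 = m).map Prod.fst).Nodup := by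
  apply List.Nodup.map_on
  · rintro ⟨k, m1⟩ h1 ⟨k', m2⟩ h2 e
    simp at h1 h2 e
    simp [h1, h2, e]
  · rw [List.nodup_iff_count_le_one]
    rintro ⟨k, m1⟩
    by_cases hm : m1 = m
    · subst hm
      rw [List.count_filter (by simp)]
      exact h k
    · rw [List.count_eq_zero_of_not_mem]
      · simp
      · simp [hm]

/-- The sum of the signs is at least the number of colored elements, since the seconds of pairs
are paired with different firsts. -/
theorem length_cutColors_le {s : List (ℕ × Mark)} (h2 : ∀ k, s.count (k, .two) ≤ 1)
    (h : ∀ k, (k, Mark.two) ∈ s → (k, Mark.one) ∈ s) :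
    ((cutColors s).length : ℤ) ≤ signSum s := by
  rw [signSum_eq]
  have : ((s.filter fun x => x.2 = .two).map Prod.fst).length ≤
      ((s.filter fun x => x.2 = .one).map Prod.fst).length := by
    apply List.Subperm.length_le
    apply (nodup_digits_of_mark h2).subperm
    intro k hk
    simp at hk ⊢
    exact h k hk
  omega

/-- If every first element of a pair has a second, the sum of signs is at most the number of
colored elements. -/
theorem le_length_cutColors {s : List (ℕ × Mark)} {p : ℕ}
    (hp : positiveDigits s = List.range' 1 p)
    (h : ∀ k, (k, Mark.one) ∈ s → (k, Mark.two) ∈ s) :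
    signSum s ≤ ((cutColors s).length : ℤ) := by
  rw [signSum_eq]
  have : ((s.filter fun x => x.2 = .one).map Prod.fst).length ≤
      ((s.filter fun x => x.2 = .two).map Prod.fst).length := by
    apply List.Subperm.length_le
    apply (nodup_digits_of_mark fun k => count_one_le hp k .one (by simp)).subperm
    intro k hk
    simp at hk ⊢
    exact h k hk
  omega

/-- Give the mark `m` to all the elements with digit `p`. -/
def remark (p : ℕ) (m : Mark) (s : List (ℕ × Mark)) : List (ℕ × Mark) :=
  s.map fun x => if x.1 = p then (p, m) else x

theorem remark_eq_self {p : ℕ} {m : Mark} {s : List (ℕ × Mark)}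
    (h : ∀ m', (p, m') ∈ s → m' = m) : remark p m s = s := by
  unfold remark
  conv_rhs => rw [← List.map_id s]
  apply List.map_congr_left
  rintro ⟨k, m'⟩ hx
  by_cases hk : k = p
  · subst hk; simp [h m' hx]
  · simp [hk]

theorem length_remark (p : ℕ) (m : Mark) (s : List (ℕ × Mark)) :
    (remark p m s).length = s.length := by simp [remark]

theorem take_remark (p : ℕ) (m : Mark) (s : List (ℕ × Mark)) (k : ℕ) :
    (remark p m s).take k = remark p m (s.take k) := by simp [remark, List.map_take]

theorem mem_remark_of_ne {p : ℕ} {m : Mark} {s : List (ℕ × Mark)} {k : ℕ} {m' : Mark}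
    (h : k ≠ p) : (k, m') ∈ remark p m s ↔ (k, m') ∈ s := by
  simp only [remark, List.mem_map]
  constructor
  · rintro ⟨⟨a, b⟩, hab, e⟩
    by_cases ha : a = p
    · simp [ha] at e; omega
    · simp [ha] at e; simpa [e] using hab
  · intro hm; exact ⟨_, hm, by simp [h]⟩

theorem mem_remark_self {p : ℕ} {m : Mark} {s : List (ℕ × Mark)} {m' : Mark} :
    (p, m') ∈ remark p m s ↔ m' = m ∧ ∃ m'', (p, m'') ∈ s := by
  simp only [remark, List.mem_map]
  constructor
  · rintro ⟨⟨a, b⟩, hab, e⟩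
    by_cases ha : a = p
    · simp [ha] at e; subst ha; exact ⟨e.symm, b, hab⟩
    · simp [ha] at e
  · rintro ⟨rfl, m'', h⟩; exact ⟨_, h, by simp⟩

theorem getElem?_remark (p : ℕ) (m : Mark) (s : List (ℕ × Mark)) (i : ℕ) :
    (remark p m s)[i]? = (s[i]?).map fun x => if x.1 = p then (p, m) else x := by
  simp [remark]

theorem getElem?_remark_of_ne {p : ℕ} {m : Mark} {s : List (ℕ × Mark)} {i k : ℕ} {m' : Mark}
    (h : k ≠ p) : (remark p m s)[i]? = some (k, m') ↔ s[i]? = some (k, m') := by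
  rw [getElem?_remark, Option.map_eq_some_iff]
  constructor
  · rintro ⟨⟨a, b⟩, hab, e⟩
    by_cases ha : a = p
    · simp [ha] at e; omega
    · simp [ha] at e; simpa [e] using hab
  · intro hm; exact ⟨_, hm, by simp [h]⟩

theorem positiveDigits_remark {p : ℕ} {m : Mark} {s : List (ℕ × Mark)} (hm : m ≠ .two)
    (h : (p, Mark.two) ∉ s) : positiveDigits (remark p m s) = positiveDigits s := by
  induction s with
  | nil => rfl
  | cons a s ih =>
    obtain ⟨k, m'⟩ := a
    simp at h
    have ih := ih h.2
    simp only [positiveDigits, remark] at ih ⊢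
    by_cases hk : k = p
    · subst hk
      have : m' ≠ .two := fun e => h.1 rfl e.symm
      simp [hm, this] at ih ⊢
      exact ih
    · by_cases h2 : m' = .two
      · simp [hk, h2] at ih ⊢; exact ih
      · simp [hk, h2] at ih ⊢; exact ih

theorem signSum_remark {p : ℕ} {m : Mark} {s : List (ℕ × Mark)} (hm : m ≠ .two)
    (h : (p, Mark.two) ∉ s) : signSum (remark p m s) = signSum s := by
  induction s with
  | nil => rfl
  | cons a s ih =>
    obtain ⟨k, m'⟩ := a
    simp at h
    have ih := ih h.2
    simp only [signSum, remark] at ih ⊢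
    by_cases hk : k = p
    · subst hk
      have : m' ≠ .two := fun e => h.1 rfl e.symm
      simp only [List.map_cons, List.sum_cons, ih]
      cases m <;> cases m' <;> simp_all [Mark.sign]
    · simp only [List.map_cons, List.sum_cons, ih, hk, if_false]

theorem remark_of_not_mem {p : ℕ} {m : Mark} {s : List (ℕ × Mark)}
    (h : ∀ m', (p, m') ∉ s) : remark p m s = s :=
  remark_eq_self fun m' hm' => absurd hm' (h m')

theorem remark_append (p : ℕ) (m : Mark) (s t : List (ℕ × Mark)) :
    remark p m (s ++ t) = remark p m s ++ remark p m t := by simp [remark]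

/-- A digit that occurs once splits the sequence in two parts without it. -/
theorem exists_split_of_unique {s : List (ℕ × Mark)} {p : ℕ} {m : Mark} {q : ℕ}
    (hq : positiveDigits s = List.range' 1 q) (hm : m ≠ .two)
    (h : (p, m) ∈ s) (h2 : (p, Mark.two) ∉ s) :
    ∃ s₁ s₂, s = s₁ ++ (p, m) :: s₂ ∧ (∀ m', (p, m') ∉ s₁) ∧ ∀ m', (p, m') ∉ s₂ := by
  obtain ⟨s₁, s₂, rfl⟩ := List.append_of_mem h
  have hn : (positiveDigits (s₁ ++ (p, m) :: s₂)).Nodup := by rw [hq]; exact List.nodup_range'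
  have e : positiveDigits (s₁ ++ (p, m) :: s₂) =
      positiveDigits s₁ ++ p :: positiveDigits s₂ := by
    simp [positiveDigits, hm]
  rw [e, List.nodup_middle, List.nodup_cons, List.mem_append] at hn
  simp only [List.mem_append, List.mem_cons] at h2
  push Not at h2 hn
  refine ⟨s₁, s₂, rfl, fun m' hm' => ?_, fun m' hm' => ?_⟩
  · exact hn.1.1 (mem_positiveDigits.2 ⟨m', hm', fun e => h2.1 (e ▸ hm')⟩)
  · exact hn.1.2 (mem_positiveDigits.2 ⟨m', hm', fun e => h2.2.2 (e ▸ hm')⟩)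

theorem IsColoredPairing.blueThenRed {s : List (ℕ × Mark)} (h : IsColoredPairing s) :
    BlueThenRed (cutColors s) := (blueThenRed_iff _).2 h.colors

/-! ### Growing a colored pairing sequence by one element -/

/-- In the colored pairing sequence `s`, the leaf `p.c` is the last blue, or the only red. This is
the condition under which a new red can join the family. -/
def CutFit (s : List (ℕ × Mark)) (p : ℕ) (c : Color) : Prop :=
  (c = .blue ∧ ∀ q, (q, Mark.leaf .blue) ∈ s → q ≤ p) ∨
    (c = .red ∧ ∀ q, (q, Mark.leaf .red) ∈ s → q = p)

theorem IsColoredPairing.two_not_mem {s : List (ℕ × Mark)} (h : IsColoredPairing s) {p : ℕ}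
    {c : Color} (hp : (p, Mark.leaf c) ∈ s) : (p, Mark.two) ∉ s := fun h2 => by
  have := h.eq_leaf hp h2
  simp at this

/-- If `p` is the only red, giving it the color blue turns all the reds of the color sequence into
blues. -/
theorem map_color_eq {s : List (ℕ × Mark)} {p : ℕ} (hp : ∀ m, (p, m) ∈ s → m = .leaf .red)
    (hu : ∀ q, (q, Mark.leaf .red) ∈ s → q = p) :
    cutColors (remark p (.leaf .blue) s) =
      (cutColors s).map fun c => if c = .red then .blue else c := by
  induction s with
  | nil => rfl
  | cons a s ih =>
    obtain ⟨k, m⟩ := a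
    have ih := ih (fun m hm => hp m (List.mem_cons_of_mem _ hm))
      (fun q hq => hu q (List.mem_cons_of_mem _ hq))
    have e : ∀ (a : ℕ × Mark) s, cutColors (a :: s) = a.2.color?.toList ++ cutColors s := by
      rintro ⟨k, m⟩ s; cases m <;> simp [cutColors, Mark.color?]
    have er : remark p (.leaf .blue) ((k, m) :: s) =
      (if k = p then (p, .leaf .blue) else (k, m)) :: remark p (.leaf .blue) s := rfl
    rw [er, e, e, ih, List.map_append]
    congr 1
    by_cases hk : k = p
    · subst hk
      have := hp m (by simp)
      subst this
      simp [Mark.color?]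
    · cases m with
      | one => simp [hk, Mark.color?]
      | two => simp [hk, Mark.color?]
      | leaf c =>
        have : c ≠ .red := by
          rintro rfl
          exact hk (hu k (by simp))
        simp [hk, Mark.color?, this]

/-- A last red can be added to a pairing sequence if its friend `p.c` is the last blue, or the
only red; in the latter case the friend becomes blue. -/
theorem IsColoredPairing.join {s : List (ℕ × Mark)} (h : IsColoredPairing s) {p K : ℕ} {c : Color}
    (hp : (p, Mark.leaf c) ∈ s) (hfit : CutFit s p c) (hK : positiveDigits s = List.range' 1 K) :
    IsColoredPairing (remark p (.leaf .blue) s ++ [(K + 1, .leaf .red)]) := by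
  have h2 := h.two_not_mem hp
  have hb := IsColoredPairing.blueThenRed h
  refine ⟨⟨K + 1, ?_⟩, ?_, ?_, ?_, ?_⟩
  · -- the positive digits: `K + 1` is added to `1, …, K`
    change positiveDigits _ = _
    rw [positiveDigits_append, positiveDigits_remark (by simp) h2, hK, List.range'_concat]
    simp [positiveDigits]; omega
  · -- every second of a pair is an old one, and has its first before it
    intro i k hi
    rw [List.getElem?_append] at hi
    split_ifs at hi with hlt
    · have hkp : k ≠ p := by
        rintro rfl
        exact absurd (mem_remark_self.1 (List.mem_of_getElem? hi)).1 (by simp)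
      rw [getElem?_remark_of_ne hkp] at hi
      obtain ⟨j, hj, hj'⟩ := h.paired i k hi
      refine ⟨j, hj, ?_⟩
      rw [List.getElem?_append_left (by omega), getElem?_remark_of_ne hkp, hj']
    · rw [List.getElem?_singleton] at hi
      split_ifs at hi
      simp at hi
  · -- the seconds of pairs occur once, as before
    intro k
    rw [List.count_append]
    have : List.count (k, Mark.two) [(K + 1, Mark.leaf Color.red)] = 0 :=
      List.count_eq_zero_of_not_mem (by simp)
    rw [this]
    by_cases hk : k = p
    · subst hk
      rw [List.count_eq_zero_of_not_mem]
      · simp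
      · intro hm; exact absurd (mem_remark_self.1 hm).1 (by simp)
    · refine le_trans (le_of_eq ?_) (h.paired_once k)
      rw [add_zero]
      clear hK hfit hp h2 hb h this
      induction s with
      | nil => rfl
      | cons a s ih =>
        obtain ⟨x, m⟩ := a
        simp only [remark, List.map_cons, List.count_cons] at ih ⊢
        rw [ih]
        by_cases hx : x = p
        · subst hx
          have hk' : ¬ x = k := fun e => hk e.symm
          simp [hk']
        · simp [hx]
  · -- the colors
    rw [← blueThenRed_iff]
    change BlueThenRed (cutColors _)
    rw [cutColors_append]
    have e1 : cutColors [(K + 1, Mark.leaf Color.red)] = [.red] := rfl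
    rw [e1]
    rcases hfit with ⟨rfl, hf⟩ | ⟨rfl, hf⟩
    · rw [remark_eq_self fun m' hm' => h.eq_leaf hp hm']
      refine ⟨?_, ?_, ?_, ?_⟩
      · rw [List.pairwise_append]
        exact ⟨hb.sorted, by simp, by simp⟩
      · simpa using hb.not_black
      · simpa using hb.blue_mem
      · simp
    · -- the friend was the only red: all the former colors become blue
      rw [map_color_eq (fun m hm => h.eq_leaf hp hm) hf]
      have hnr : ∀ x ∈ (cutColors s).map (fun c => if c = .red then .blue else c),
          x = Color.blue := by
        intro x hx
        obtain ⟨c, hc, rfl⟩ := List.mem_map.1 hx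
        cases c with
        | red => rfl
        | blue => rfl
        | black => exact absurd hc hb.not_black
      refine ⟨?_, ?_, ?_, ?_⟩
      · rw [List.pairwise_append]
        refine ⟨?_, by simp, by simp⟩
        apply List.Pairwise.imp_of_mem (R := fun _ _ => True) _ (List.pairwise_of_forall (by simp))
        intro a b ha _ _ e
        rw [hnr a ha] at e; simp at e
      · intro hx
        rcases List.mem_append.1 hx with hx | hx
        · exact absurd (hnr _ hx) (by simp)
        · simp at hx
      · rw [List.mem_append]; left
        exact List.mem_map.2 ⟨.blue, hb.blue_mem, by simp⟩
      · simp
  · -- the partial sums: only the one of full length is new, and it is larger than the number of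
    -- former colors
    intro k hk hk'
    rw [List.length_append, length_remark, List.length_singleton] at hk'
    change 2 ≤ signSum _
    rcases Nat.lt_or_ge s.length k with hlt | hle
    · have hke : k = s.length + 1 := by omega
      rw [List.take_of_length_le (by simp [length_remark, hke]), signSum_append,
        signSum_remark (by simp) h2]
      have h1 : ((cutColors s).length : ℤ) ≤ signSum s :=
        length_cutColors_le h.paired_once fun k hk => mem_of_paired h hk
      have h3 := blueThenRed_two_le hb
      have : signSum [(K + 1, Mark.leaf Color.red)] = 1 := rfl
      rw [this]; omega
    · rw [List.take_append_of_le_length (by rw [length_remark]; exact hle), take_remark,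
        signSum_remark (by simp) fun hm => h2 (List.mem_of_mem_take hm)]
      exact h.dyck k hk hle

/-- Pairing a colored element `p.c` of a pairing sequence, which is neither its last blue nor its
only red, with a new last element. -/
theorem IsColoredPairing.pair {s : List (ℕ × Mark)} (h : IsColoredPairing s) {p : ℕ} {c : Color}
    (hp : (p, Mark.leaf c) ∈ s) (hfit : ¬ CutFit s p c) :
    IsColoredPairing (remark p .one s ++ [(p, .two)]) := by
  have h2 := h.two_not_mem hp
  have hb := IsColoredPairing.blueThenRed h
  obtain ⟨K, hK⟩ := h.positives
  obtain ⟨s₁, s₂, rfl, hs1, hs2⟩ := exists_split_of_unique hK (by simp) hp h2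
  have er : remark p .one (s₁ ++ (p, Mark.leaf c) :: s₂) = s₁ ++ (p, .one) :: s₂ := by
    rw [remark_append, remark_of_not_mem hs1]
    congr 1
    change _ :: remark p .one s₂ = _
    rw [remark_of_not_mem hs2]; simp
  have ec : cutColors (s₁ ++ (p, Mark.leaf c) :: s₂) = cutColors s₁ ++ c :: cutColors s₂ := by
    simp [cutColors, Mark.color?]
  -- since `p` does not fit, its color occurs a second time
  have hexists : ∃ q, q ≠ p ∧ (q, Mark.leaf c) ∈ s₁ ++ (p, Mark.leaf c) :: s₂ := by
    by_contra hcon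
    push Not at hcon
    apply hfit
    have hcm : c ∈ cutColors (s₁ ++ (p, Mark.leaf c) :: s₂) := by simp [ec]
    cases c with
    | black => exact absurd hcm hb.not_black
    | blue =>
      left
      refine ⟨rfl, fun q hq => ?_⟩
      by_contra hlt
      exact hcon q (by omega) hq
    | red =>
      right
      refine ⟨rfl, fun q hq => ?_⟩
      by_contra hlt
      exact hcon q hlt hq
  obtain ⟨q, hqp, hq⟩ := hexists
  have hcc : c ∈ cutColors s₁ ++ cutColors s₂ := by
    simp only [List.mem_append, List.mem_cons, Prod.mk.injEq, hqp, false_and, false_or] at hq ⊢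
    exact hq.imp (fun h => mem_cutColors.2 ⟨q, h⟩) (fun h => mem_cutColors.2 ⟨q, h⟩)
  have ec' : cutColors (s₁ ++ (p, Mark.one) :: s₂ ++ [(p, .two)]) =
      cutColors s₁ ++ cutColors s₂ := by
    simp [cutColors, Mark.color?]
  have hsub : (cutColors s₁ ++ cutColors s₂).Sublist (cutColors s₁ ++ c :: cutColors s₂) :=
    (List.Sublist.refl _).append (List.sublist_cons_self _ _)
  rw [ec] at hb
  have hb' : BlueThenRed (cutColors s₁ ++ cutColors s₂) := by
    have hmem : ∀ x ∈ cutColors s₁ ++ c :: cutColors s₂, x ∈ cutColors s₁ ++ cutColors s₂ := by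
      intro x hx
      by_cases hxc : x = c
      · rwa [hxc]
      · simpa [hxc] using hx
    exact ⟨hb.sorted.sublist hsub, fun hx => hb.not_black (hsub.subset hx), hmem _ hb.blue_mem,
      hmem _ hb.red_mem⟩
  -- the conditions: positive digits, seconds after their firsts, seconds only once, colors, and
  -- partial sums
  refine ⟨⟨K, ?_⟩, ?_, ?_, ?_, ?_⟩
  · change positiveDigits _ = _
    rw [positiveDigits_append, positiveDigits_remark (by simp) h2]
    change positiveDigits _ = _ at hK
    rw [hK]; simp [positiveDigits]
  · intro i k hi
    rw [List.getElem?_append] at hi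
    split_ifs at hi with hlt
    · have hkp : k ≠ p := by
        rintro rfl
        exact absurd (mem_remark_self.1 (List.mem_of_getElem? hi)).1 (by simp)
      rw [getElem?_remark_of_ne hkp] at hi
      obtain ⟨j, hj, hj'⟩ := h.paired i k hi
      refine ⟨j, hj, ?_⟩
      rw [List.getElem?_append_left (by omega), getElem?_remark_of_ne hkp, hj']
    · rw [List.getElem?_singleton] at hi
      split_ifs at hi
      simp at hi
      subst hi
      refine ⟨s₁.length, ?_, ?_⟩
      · rw [er] at hlt; simp at hlt; omega
      · rw [er]; simp
  · intro k
    rw [er]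
    have h1 := h.paired_once k
    simp only [List.count_append, List.count_cons, List.count_nil] at h1 ⊢
    by_cases hk : k = p
    · subst hk
      rw [List.count_eq_zero_of_not_mem (hs1 _), List.count_eq_zero_of_not_mem (hs2 _)]
      simp
    · have hk' : ¬ p = k := fun e => hk e.symm
      simp [hk'] at h1 ⊢
      exact h1
  · rw [← blueThenRed_iff]
    change BlueThenRed (cutColors _)
    rw [er, ec']
    exact hb'
  · intro k hk hk'
    rw [List.length_append, length_remark, List.length_singleton] at hk'
    change 2 ≤ signSum _
    rcases Nat.lt_or_ge (s₁ ++ (p, Mark.leaf c) :: s₂).length k with hlt | hle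
    · -- the sum of full length is at least the number of the remaining colors, which contain a
      -- blue and a red
      rw [List.take_of_length_le (by rw [List.length_append, length_remark]; exact hlt),
        signSum_append, signSum_remark (by simp) h2]
      have h1 := length_cutColors_le h.paired_once fun k hk => mem_of_paired h hk
      rw [ec] at h1
      have h3 := blueThenRed_two_le hb'
      have : signSum [(p, Mark.two)] = -1 := rfl
      rw [this]
      simp at h1 h3 ⊢; omega
    · rw [List.take_append_of_le_length (by rw [length_remark]; exact hle), take_remark,
        signSum_remark (by simp) fun hm => h2 (List.mem_of_mem_take hm)]
      exact h.dyck k hk hle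

/-! ### Removing the last element of a colored pairing sequence -/

/-- A pairing sequence with last element a leaf `q.c`, in which all the pairs are complete, arises
from a shorter pairing sequence by `IsColoredPairing.join`. The friend of the last element is the
last blue before it; it was red before the step if no red remains without the last element, and
blue otherwise. -/
theorem IsColoredPairing.exists_join {s₀ : List (ℕ × Mark)} {q : ℕ} {c : Color}
    (h : IsColoredPairing (s₀ ++ [(q, .leaf c)]))
    (hpair : ∀ k, (k, Mark.one) ∈ s₀ → (k, Mark.two) ∈ s₀) (hlen : 2 ≤ s₀.length) :
    ∃ p c', (p, Mark.leaf .blue) ∈ s₀ ∧ (p = 1 → c' = .blue) ∧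
      IsColoredPairing (remark p (.leaf c') s₀) ∧ CutFit (remark p (.leaf c') s₀) p c' := by
  have hb := IsColoredPairing.blueThenRed h
  have ec : cutColors (s₀ ++ [(q, Mark.leaf c)]) = cutColors s₀ ++ [c] := by
    rw [cutColors_append]; rfl
  rw [ec] at hb
  obtain ⟨K, hK⟩ := h.positives
  change positiveDigits _ = _ at hK
  have hK0 : ∃ K0, positiveDigits s₀ = List.range' 1 K0 ∧ K = K0 + 1 := by
    rw [positiveDigits_append] at hK
    have e : positiveDigits [(q, Mark.leaf c)] = [q] := rfl
    rw [e] at hK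
    match K with
    | 0 => simp at hK
    | K + 1 =>
      rw [List.range'_concat] at hK
      exact ⟨K, (List.append_inj' hK rfl).1, rfl⟩
  obtain ⟨K0, hK0, rfl⟩ := hK0
  have hdyck : ∀ k, 2 ≤ k → k ≤ s₀.length → 2 ≤ signSum (s₀.take k) := by
    intro k hk hk'
    have := h.dyck k hk (by simp; omega)
    rwa [List.take_append_of_le_length hk'] at this
  have hpr0 : ∀ (i k : ℕ), s₀[i]? = some (k, .two) → ∃ j < i, s₀[j]? = some (k, .one) := by
    intro i k hi
    have hil : i < s₀.length := (List.getElem?_eq_some_iff.1 hi).1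
    obtain ⟨j, hj, hj'⟩ := h.paired i k (by rw [List.getElem?_append_left hil, hi])
    rw [List.getElem?_append_left (by omega)] at hj'
    exact ⟨j, hj, hj'⟩
  have hpo0 : ∀ k, s₀.count (k, .two) ≤ 1 := by
    intro k
    have := h.paired_once k
    rw [List.count_append] at this
    omega
  -- the sum of the signs is at least 2, and the complete pairs do not contribute to it
  have hcc : 2 ≤ (cutColors s₀).length := by
    have h1 := le_length_cutColors hK0 hpair
    have h2 := hdyck s₀.length hlen le_rfl
    rw [List.take_length] at h2
    omega
  -- at least two colors remain, so that the first of them is blue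
  have hblue : Color.blue ∈ cutColors s₀ := by
    by_contra hcon
    match hl : cutColors s₀ with
    | [] => rw [hl] at hcc; simp at hcc
    | a :: l =>
      have ha : a = .red := by
        cases a with
        | red => rfl
        | blue => rw [hl] at hcon; simp at hcon
        | black => exact absurd (by rw [hl]; simp) hb.not_black
      have hs := hb.sorted
      rw [hl, List.cons_append, List.pairwise_cons] at hs
      have := hb.blue_mem
      rw [hl, List.cons_append, List.mem_cons] at this
      rcases this with e | e
      · rw [ha] at e; simp at e
      · have := hs.1 _ e ha; simp at this
  -- the last color is red
  have hred : c = .red := by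
    cases c with
    | red => rfl
    | black => exact absurd (by simp) hb.not_black
    | blue =>
      have hr := hb.red_mem
      simp at hr
      have := (List.pairwise_append.1 hb.sorted).2.2 _ hr .blue (by simp) rfl
      simp at this
  subst hred
  have hs0 : (cutColors s₀).Pairwise fun x y => x = .red → y = .red :=
    (List.pairwise_append.1 hb.sorted).1
  have hk0 : Color.black ∉ cutColors s₀ := fun hx => hb.not_black (by simp [hx])
  -- the friend is the last blue
  obtain ⟨p, hp, hpmax⟩ : ∃ p, (p, Mark.leaf .blue) ∈ s₀ ∧
      ∀ q, (q, Mark.leaf .blue) ∈ s₀ → q ≤ p := by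
    have hbd : ∀ q, (q, Mark.leaf .blue) ∈ s₀ → q ≤ K0 := by
      intro q hq
      have : q ∈ positiveDigits s₀ := mem_positiveDigits.2 ⟨_, hq, by simp⟩
      rw [hK0, List.mem_range'_1] at this
      omega
    classical
    obtain ⟨p0, hp0⟩ := mem_cutColors.1 hblue
    refine ⟨Nat.findGreatest (fun q => (q, Mark.leaf .blue) ∈ s₀) K0, ?_, ?_⟩
    · exact Nat.findGreatest_spec (P := fun q => (q, Mark.leaf Color.blue) ∈ s₀) (hbd _ hp0) hp0
    · intro q hq
      exact Nat.le_findGreatest (hbd q hq) hq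
  have h2p : (p, Mark.two) ∉ s₀ := fun hm =>
    h.two_not_mem (List.mem_append_left _ hp) (List.mem_append_left _ hm)
  have huniq : ∀ m, (p, m) ∈ s₀ → m = .leaf .blue := fun m hm =>
    h.eq_leaf (List.mem_append_left _ hp) (List.mem_append_left _ hm)
  by_cases hr : Color.red ∈ cutColors s₀
  · -- a red remains, so that the friend was blue
    refine ⟨p, .blue, hp, fun _ => rfl, ?_, ?_⟩
    · rw [remark_eq_self huniq]
      exact ⟨⟨K0, hK0⟩, hpr0, hpo0, (blueThenRed_iff _).1 ⟨hs0, hk0, hblue, hr⟩, hdyck⟩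
    · rw [remark_eq_self huniq]
      exact Or.inl ⟨rfl, hpmax⟩
  · -- all the remaining colors are blue, and there are at least two of them; the friend was red,
    -- and a blue remains before it
    have hallblue : ∀ x ∈ cutColors s₀, x = .blue := by
      intro x hx
      cases x with
      | blue => rfl
      | red => exact absurd hx hr
      | black => exact absurd hx hk0
    obtain ⟨s₁, s₂, rfl, hs1, hs2⟩ := exists_split_of_unique hK0 (by simp) hp h2p
    have er : remark p (.leaf .red) (s₁ ++ (p, Mark.leaf .blue) :: s₂) =
        s₁ ++ (p, .leaf .red) :: s₂ := by
      rw [remark_append, remark_of_not_mem hs1]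
      congr 1
      change _ :: remark p _ s₂ = _
      rw [remark_of_not_mem hs2]; simp
    have ec1 : ∀ c, cutColors (s₁ ++ (p, Mark.leaf c) :: s₂) =
        cutColors s₁ ++ c :: cutColors s₂ := by
      intro c; simp [cutColors, Mark.color?]
    have hsp : positiveDigits s₁ ++ p :: positiveDigits s₂ = List.range' 1 K0 := by
      rw [← hK0]; simp [positiveDigits]
    have hsort : (positiveDigits s₁ ++ p :: positiveDigits s₂).Pairwise (· < ·) := by
      rw [hsp]; exact List.pairwise_lt_range'
    have hc2 : cutColors s₂ = [] := by
      rw [List.eq_nil_iff_forall_not_mem]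
      intro x hx
      have hxb : x = .blue := hallblue x (by rw [ec1]; simp [hx])
      subst hxb
      obtain ⟨q', hq'⟩ := mem_cutColors.1 hx
      have h1 := hpmax q' (by simp [hq'])
      have h3 := (List.pairwise_cons.1 (List.pairwise_append.1 hsort).2.1).1 q'
        (mem_positiveDigits.2 ⟨_, hq', by simp⟩)
      omega
    have hc1 : cutColors s₁ ≠ [] := by
      intro e
      rw [ec1, hc2, e] at hcc
      simp at hcc
    have hp1 : p ≠ 1 := by
      obtain ⟨x, hx⟩ := List.exists_mem_of_ne_nil _ hc1
      obtain ⟨q', hq'⟩ := mem_cutColors.1 hx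
      have hq1 : q' ∈ positiveDigits s₁ := mem_positiveDigits.2 ⟨_, hq', by simp⟩
      have h3 := (List.pairwise_append.1 hsort).2.2 q' hq1 p (by simp)
      have : q' ∈ List.range' 1 K0 := by rw [← hsp]; simp [hq1]
      rw [List.mem_range'_1] at this
      omega
    refine ⟨p, .red, hp, fun e => absurd e hp1, ?_, ?_⟩
    · refine ⟨⟨K0, ?_⟩, ?_, ?_, ?_, ?_⟩
      · change positiveDigits _ = _
        rw [positiveDigits_remark (by simp) h2p, hK0]
      · intro i k hi
        have hkp : k ≠ p := by
          rintro rfl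
          exact absurd (mem_remark_self.1 (List.mem_of_getElem? hi)).1 (by simp)
        rw [getElem?_remark_of_ne hkp] at hi
        obtain ⟨j, hj, hj'⟩ := hpr0 i k hi
        exact ⟨j, hj, by rw [getElem?_remark_of_ne hkp, hj']⟩
      · intro k
        have h1 := hpo0 k
        rw [er]
        simp only [List.count_append, List.count_cons] at h1 ⊢
        simpa using h1
      · rw [← blueThenRed_iff]
        change BlueThenRed (cutColors _)
        rw [er, ec1, hc2]
        have hall1 : ∀ x ∈ cutColors s₁, x = .blue := fun x hx => hallblue x (by
          rw [ec1]; simp [hx])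
        refine ⟨?_, ?_, ?_, by simp⟩
        · rw [List.pairwise_append]
          refine ⟨hs0.sublist (by rw [ec1]; exact List.sublist_append_left _ _), by simp, by simp⟩
        · intro hx
          rcases List.mem_append.1 hx with hx | hx
          · exact absurd (hall1 _ hx) (by simp)
          · simp at hx
        · obtain ⟨x, hx⟩ := List.exists_mem_of_ne_nil _ hc1
          rw [List.mem_append]; left
          rwa [hall1 x hx] at hx
      · intro k hk hk'
        rw [length_remark] at hk'
        change 2 ≤ signSum _
        rw [take_remark, signSum_remark (by simp) fun hm => h2p (List.mem_of_mem_take hm)]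
        exact hdyck k hk hk'
    · right
      refine ⟨rfl, fun q' hq' => ?_⟩
      by_contra hne
      rw [mem_remark_of_ne hne] at hq'
      exact hr (mem_cutColors.2 ⟨q', hq'⟩)

/-- A pairing sequence with last element `p.2` arises from a shorter pairing sequence by
`IsColoredPairing.pair`. Before the step, `p` was blue if a blue follows it, and red otherwise. -/
theorem IsColoredPairing.exists_pair {s₀ : List (ℕ × Mark)} {p : ℕ}
    (h : IsColoredPairing (s₀ ++ [(p, .two)])) :
    ∃ c, (p = 1 → c = .blue) ∧ c ≠ .black ∧ (p, Mark.one) ∈ s₀ ∧ (p, Mark.two) ∉ s₀ ∧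
      IsColoredPairing (remark p (.leaf c) s₀) ∧ ¬ CutFit (remark p (.leaf c) s₀) p c := by
  have hb := IsColoredPairing.blueThenRed h
  have ec : cutColors (s₀ ++ [(p, Mark.two)]) = cutColors s₀ := by
    rw [cutColors_append]; simp [cutColors, Mark.color?]
  rw [ec] at hb
  obtain ⟨K, hK⟩ := h.positives
  change positiveDigits _ = _ at hK
  have hK0 : positiveDigits s₀ = List.range' 1 K := by
    rw [← hK, positiveDigits_append]; simp [positiveDigits]
  have h2p : (p, Mark.two) ∉ s₀ := by
    intro hm
    have := h.paired_once p
    rw [List.count_append] at this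
    have h1 := List.count_pos_iff.2 hm
    simp at this
    omega
  have h1p : (p, Mark.one) ∈ s₀ := by
    have := mem_of_paired h (k := p) (by simp)
    simpa using this
  obtain ⟨s₁, s₂, rfl, hs1, hs2⟩ := exists_split_of_unique hK0 (by simp) h1p h2p
  have er : ∀ c, remark p (.leaf c) (s₁ ++ (p, Mark.one) :: s₂) =
      s₁ ++ (p, .leaf c) :: s₂ := by
    intro c
    rw [remark_append, remark_of_not_mem hs1]
    congr 1
    change _ :: remark p _ s₂ = _
    rw [remark_of_not_mem hs2]; simp
  have ec1 : ∀ c, cutColors (s₁ ++ (p, Mark.leaf c) :: s₂) =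
      cutColors s₁ ++ c :: cutColors s₂ := by
    intro c; simp [cutColors, Mark.color?]
  have ec0 : cutColors (s₁ ++ (p, Mark.one) :: s₂) = cutColors s₁ ++ cutColors s₂ := by
    simp [cutColors, Mark.color?]
  rw [ec0] at hb
  have hsp : positiveDigits s₁ ++ p :: positiveDigits s₂ = List.range' 1 K := by
    rw [← hK0]; simp [positiveDigits]
  have hsort : (positiveDigits s₁ ++ p :: positiveDigits s₂).Pairwise (· < ·) := by
    rw [hsp]; exact List.pairwise_lt_range'
  -- everything but the colors does not depend on the color given to `p`
  have main : ∀ c, BlueThenRed (cutColors s₁ ++ c :: cutColors s₂) →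
      IsColoredPairing (remark p (.leaf c) (s₁ ++ (p, Mark.one) :: s₂)) := by
    intro c hc
    refine ⟨⟨K, ?_⟩, ?_, ?_, ?_, ?_⟩
    · change positiveDigits _ = _
      rw [positiveDigits_remark (by simp) h2p, hK0]
    · intro i k hi
      have hkp : k ≠ p := by
        rintro rfl
        exact absurd (mem_remark_self.1 (List.mem_of_getElem? hi)).1 (by simp)
      rw [getElem?_remark_of_ne hkp] at hi
      have hil : i < (s₁ ++ (p, Mark.one) :: s₂).length := (List.getElem?_eq_some_iff.1 hi).1
      obtain ⟨j, hj, hj'⟩ := h.paired i k (by rw [List.getElem?_append_left hil, hi])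
      rw [List.getElem?_append_left (by omega)] at hj'
      exact ⟨j, hj, by rw [getElem?_remark_of_ne hkp, hj']⟩
    · intro k
      have h1 := h.paired_once k
      rw [er]
      simp only [List.count_append, List.count_cons] at h1 ⊢
      simp at h1 ⊢
      omega
    · rw [← blueThenRed_iff]
      change BlueThenRed (cutColors _)
      rw [er, ec1]
      exact hc
    · intro k hk hk'
      rw [length_remark] at hk'
      change 2 ≤ signSum _
      rw [take_remark, signSum_remark (by simp) fun hm => h2p (List.mem_of_mem_take hm)]
      have := h.dyck k hk (by simp at hk' ⊢; omega)
      rwa [List.take_append_of_le_length hk'] at this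
  have hne : ∀ c q, (q, Mark.leaf c) ∈ s₁ ∨ (q, Mark.leaf c) ∈ s₂ → q ≠ p := by
    rintro c q (hq | hq) rfl
    · exact hs1 _ hq
    · exact hs2 _ hq
  have hsorted := List.pairwise_append.1 hb.sorted
  -- a blue after `p` forces `p` to be blue, and then it is not the last blue; if there is none,
  -- `p` is red, and not the only red
  by_cases hbl : Color.blue ∈ cutColors s₂
  · refine ⟨.blue, fun _ => rfl, by simp, h1p, h2p, main .blue ?_, ?_⟩
    · refine ⟨?_, ?_, by simp, ?_⟩
      · rw [List.pairwise_append, List.pairwise_cons]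
        refine ⟨hsorted.1, ⟨by simp, hsorted.2.1⟩, ?_⟩
        intro x hx y _ e
        have := hsorted.2.2 x hx _ hbl e
        simp at this
      · have := hb.not_black
        simpa using this
      · have := hb.red_mem
        simpa using this
    · rintro (⟨_, hf⟩ | ⟨hf, _⟩)
      · obtain ⟨q, hq⟩ := mem_cutColors.1 hbl
        have h1 := hf q (by
          rw [mem_remark_of_ne (hne _ _ (Or.inr hq))]; simp [hq])
        have h3 := (List.pairwise_cons.1 (List.pairwise_append.1 hsort).2.1).1 q
          (mem_positiveDigits.2 ⟨_, hq, by simp⟩)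
        omega
      · simp at hf
  · have hb1 : Color.blue ∈ cutColors s₁ := by
      have := hb.blue_mem
      simp [hbl] at this
      exact this
    have hr2 : ∀ x ∈ cutColors s₂, x = .red := by
      intro x hx
      cases x with
      | red => rfl
      | blue => exact absurd hx hbl
      | black => exact absurd (by simp [hx]) hb.not_black
    refine ⟨.red, ?_, by simp, h1p, h2p, main .red ?_, ?_⟩
    · intro e
      obtain ⟨q', hq'⟩ := mem_cutColors.1 hb1
      have hq1 : q' ∈ positiveDigits s₁ := mem_positiveDigits.2 ⟨_, hq', by simp⟩
      have h3 := (List.pairwise_append.1 hsort).2.2 q' hq1 p (by simp)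
      have : q' ∈ List.range' 1 K := by rw [← hsp]; simp [hq1]
      rw [List.mem_range'_1] at this
      omega
    · refine ⟨?_, ?_, ?_, by simp⟩
      · rw [List.pairwise_append, List.pairwise_cons]
        refine ⟨hsorted.1, ⟨fun x hx _ => hr2 x hx, hsorted.2.1⟩, ?_⟩
        intro x hx y hy e
        rcases List.mem_cons.1 hy with rfl | hy
        · rfl
        · exact hr2 y hy
      · have := hb.not_black
        simpa using this
      · simp [hb1]
    · rintro (⟨hf, _⟩ | ⟨_, hf⟩)
      · simp at hf
      · obtain ⟨q, hq'⟩ : ∃ q, (q, Mark.leaf .red) ∈ s₁ ∨ (q, Mark.leaf .red) ∈ s₂ := by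
          rcases List.mem_append.1 hb.red_mem with hr | hr <;>
            obtain ⟨q, hq⟩ := mem_cutColors.1 hr
          · exact ⟨q, Or.inl hq⟩
          · exact ⟨q, Or.inr hq⟩
        exact hne _ _ hq' (hf q (by rw [mem_remark_of_ne (hne _ _ hq')]; simp; tauto))

/-! ### Node cuts -/

/-- The definition of the node cut for the digits `g` followed by `t`. -/
theorem cutEntry_append {g t : List ℕ} (hg : g ≠ []) (c : Color) :
    cutEntry g ⟨g ++ t, c⟩ = match t with
      | [] => none
      | [k] => some (k, .leaf c)
      | k :: k' :: rest =>
        if ∀ x ∈ rest, x = 1 then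
          if k' = 1 then some (k, .one) else if k' = 2 then some (k, .two) else none
        else none := by
  rcases t with _ | ⟨a, _ | ⟨b, t⟩⟩ <;> simp [cutEntry, IsHead, hg]

/-- The three kinds of entries which a node cut sees: the leaves `h.k.c`, the founders
`h.k.1.⋯.1.c`, and the second elements `h.k.2.1.⋯.1.c`. -/
theorem cutEntry_eq_some {h : List ℕ} {ν : DecimalNumber} {k : ℕ} {m : Mark} :
    cutEntry h ν = some (k, m) ↔ h ≠ [] ∧
      ((∃ c, m = .leaf c ∧ ν = ⟨h ++ [k], c⟩) ∨
        (∃ j, m = .one ∧ ν.digits = h ++ k :: 1 :: List.replicate j 1) ∨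
        ∃ j, m = .two ∧ ν.digits = h ++ k :: 2 :: List.replicate j 1) := by
  obtain ⟨D, c⟩ := ν
  by_cases hh : IsHead h ⟨D, c⟩
  · obtain ⟨hne, t, rfl⟩ := hh
    have hh : IsHead h ⟨h ++ t, c⟩ := ⟨hne, t, rfl⟩
    simp only [cutEntry_append hne, ne_eq, hne, not_false_eq_true, true_and,
      DecimalNumber.mk.injEq, List.append_cancel_left_eq]
    match t with
    | [] => simp
    | [k'] =>
      simp only [Option.some.injEq, Prod.mk.injEq, List.cons.injEq, and_true]
      constructor
      · rintro ⟨rfl, rfl⟩; exact Or.inl ⟨c, rfl, rfl, rfl⟩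
      · rintro (⟨c', rfl, rfl, rfl⟩ | ⟨j, _, _, h⟩ | ⟨j, _, _, h⟩)
        · exact ⟨rfl, rfl⟩
        · simp at h
        · simp at h
    | a :: b :: r =>
      have key : (∀ x ∈ r, x = 1) ↔ ∃ j, r = List.replicate j 1 := by
        constructor
        · intro hx; exact ⟨r.length, List.eq_replicate_iff.2 ⟨rfl, hx⟩⟩
        · rintro ⟨j, rfl⟩ x hx; exact (List.mem_replicate.1 hx).2
      simp only []
      split_ifs with h1 h2 h3
      · obtain ⟨j, rfl⟩ := key.1 h1
        subst h2
        simp only [Option.some.injEq, Prod.mk.injEq, List.cons.injEq]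
        constructor
        · rintro ⟨rfl, rfl⟩; exact Or.inr (Or.inl ⟨j, by simp⟩)
        · rintro (⟨c', _, ⟨_, h⟩, _⟩ | ⟨j, rfl, rfl, _⟩ | ⟨j, _, _, h, _⟩)
          · simp at h
          · exact ⟨rfl, rfl⟩
          · simp at h
      · obtain ⟨j, rfl⟩ := key.1 h1
        subst h3
        simp only [Option.some.injEq, Prod.mk.injEq, List.cons.injEq]
        constructor
        · rintro ⟨rfl, rfl⟩; exact Or.inr (Or.inr ⟨j, by simp⟩)
        · rintro (⟨c', _, ⟨_, h⟩, _⟩ | ⟨j, _, _, h, _⟩ | ⟨j, rfl, rfl, _⟩)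
          · simp at h
          · simp at h
          · exact ⟨rfl, rfl⟩
      · simp only [List.cons.injEq]
        constructor
        · rintro ⟨⟩
        · rintro (⟨c', _, ⟨_, h⟩, _⟩ | ⟨j, _, _, h, _⟩ | ⟨j, _, _, h, _⟩)
          · simp at h
          · exact absurd h h2
          · exact absurd h h3
      · simp only [List.cons.injEq]
        constructor
        · rintro ⟨⟩
        · rintro (⟨c', _, ⟨_, h⟩, _⟩ | ⟨j, _, _, _, h⟩ | ⟨j, _, _, _, h⟩)
          · simp at h
          · exact absurd (key.2 ⟨j, h⟩) h1
          · exact absurd (key.2 ⟨j, h⟩) h1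
  · simp only [cutEntry, hh, if_false]
    constructor
    · rintro ⟨⟩
    · rintro ⟨hne, (⟨c', _, h⟩ | ⟨j, _, h⟩ | ⟨j, _, h⟩)⟩
      · injection h with h _
        exact absurd ⟨hne, _, h.symm⟩ hh
      · exact absurd ⟨hne, _, h.symm⟩ hh
      · exact absurd ⟨hne, _, h.symm⟩ hh

theorem cutEntry_of_not_isHead {h : List ℕ} {ν : DecimalNumber} (hh : ¬ IsHead h ν) :
    cutEntry h ν = none := by simp [cutEntry, hh]

theorem cutEntry_self (D : List ℕ) (c : Color) : cutEntry D ⟨D, c⟩ = none := by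
  unfold cutEntry
  split_ifs
  · simp
  · rfl

theorem cutEntry_append_singleton {h : List ℕ} (hh : h ≠ []) (k : ℕ) (c : Color) :
    cutEntry h ⟨h ++ [k], c⟩ = some (k, .leaf c) :=
  cutEntry_eq_some.2 ⟨hh, Or.inl ⟨c, rfl, rfl⟩⟩

theorem cutEntry_append_pair_one {h : List ℕ} (hh : h ≠ []) (k : ℕ) (c : Color) :
    cutEntry h ⟨h ++ [k] ++ [1], c⟩ = some (k, .one) :=
  cutEntry_eq_some.2 ⟨hh, Or.inr (Or.inl ⟨0, rfl, by simp⟩)⟩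

theorem cutEntry_append_pair_two {h : List ℕ} (hh : h ≠ []) (k : ℕ) (c : Color) :
    cutEntry h ⟨h ++ [k] ++ [2], c⟩ = some (k, .two) :=
  cutEntry_eq_some.2 ⟨hh, Or.inr (Or.inr ⟨0, rfl, by simp⟩)⟩

/-- The node cut of `g` sees only the colors of the entries `g.k.c`. -/
theorem cutEntry_color {g D : List ℕ} (hg : ∀ k, D ≠ g ++ [k]) (c c' : Color) :
    cutEntry g ⟨D, c⟩ = cutEntry g ⟨D, c'⟩ := by
  by_cases hh : IsHead g ⟨D, c⟩
  · obtain ⟨hne, t, rfl⟩ := id hh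
    rw [cutEntry_append hne, cutEntry_append hne]
    match t with
    | [] => rfl
    | [k] => exact absurd rfl (hg k)
    | a :: b :: r => rfl
  · rw [cutEntry_of_not_isHead hh, cutEntry_of_not_isHead (ν := ⟨D, c'⟩) (fun h => hh h)]

/-- If an entry has at least two digits after the head `g`, or does not have this head, a further
digit `1` at its end does not change the node cut of `g`. -/
theorem cutEntry_append_one {g D : List ℕ} (hD : g ≠ D) (hg : ∀ k, D ≠ g ++ [k]) (c c' : Color) :
    cutEntry g ⟨D ++ [1], c⟩ = cutEntry g ⟨D, c'⟩ := by
  by_cases hh : IsHead g ⟨D, c'⟩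
  · obtain ⟨hne, t, rfl⟩ := id hh
    rw [List.append_assoc, cutEntry_append hne, cutEntry_append hne]
    match t with
    | [] => simp at hD
    | [k] => exact absurd rfl (hg k)
    | a :: b :: r =>
      simp only [List.cons_append, List.mem_append, List.mem_singleton, or_imp, forall_and,
        forall_eq, and_true]
  · rw [cutEntry_of_not_isHead hh]
    by_cases hh' : IsHead g ⟨D ++ [1], c⟩
    · obtain ⟨hne, hp⟩ := hh'
      rcases List.prefix_concat_iff.1 hp with rfl | hp
      · exact cutEntry_self _ _
      · exact absurd ⟨hne, hp⟩ hh
    · exact cutEntry_of_not_isHead hh'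

/-- An entry which ends with a digit `2` is visible only in the node cuts of the heads one and two
digits shorter. -/
theorem cutEntry_append_two {g D : List ℕ} (hD : g ≠ D) (hg : ∀ k, D ≠ g ++ [k]) (c : Color) :
    cutEntry g ⟨D ++ [2], c⟩ = none := by
  by_cases hh' : IsHead g ⟨D ++ [2], c⟩
  · obtain ⟨hne, hp⟩ := id hh'
    rcases List.prefix_concat_iff.1 hp with rfl | ⟨t, rfl⟩
    · exact cutEntry_self _ _
    · rw [List.append_assoc, cutEntry_append hne]
      match t with
      | [] => simp at hD
      | [k] => exact absurd rfl (hg k)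
      | a :: b :: r =>
        simp only [List.cons_append]
        rw [if_neg]
        intro h
        have := h 2 (by simp)
        omega
  · exact cutEntry_of_not_isHead hh'

/-- An entry which ends with a digit larger than `2` is visible only in the node cut of the head
one digit shorter. -/
theorem cutEntry_append_large {g h : List ℕ} (hg : g ≠ h) {q : ℕ} (hq : 3 ≤ q) (c : Color) :
    cutEntry g ⟨h ++ [q], c⟩ = none := by
  by_cases hh' : IsHead g ⟨h ++ [q], c⟩
  · obtain ⟨hne, hp⟩ := id hh'
    rcases List.prefix_concat_iff.1 hp with rfl | ⟨t, rfl⟩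
    · exact cutEntry_self _ _
    · rw [List.append_assoc, cutEntry_append hne]
      match t with
      | [] => simp at hg
      | [k] =>
        have h1 : q ≠ 1 := by omega
        have h2 : q ≠ 2 := by omega
        simp [h1, h2]
      | a :: b :: r =>
        simp only [List.cons_append]
        rw [if_neg]
        intro h
        have := h q (by simp)
        omega
  · exact cutEntry_of_not_isHead hh'

theorem mem_nodeCut {δ : List DecimalNumber} {h : List ℕ} {x : ℕ × Mark} :
    x ∈ nodeCut δ h ↔ ∃ ν ∈ δ, cutEntry h ν = some x := List.mem_filterMap

theorem leaf_mem_nodeCut {δ : List DecimalNumber} {h : List ℕ} (hh : h ≠ []) {k : ℕ} {c : Color} :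
    (k, Mark.leaf c) ∈ nodeCut δ h ↔ ⟨h ++ [k], c⟩ ∈ δ := by
  rw [mem_nodeCut]
  constructor
  · rintro ⟨ν, hν, e⟩
    obtain ⟨_, (⟨c', e1, rfl⟩ | ⟨j, e1, _⟩ | ⟨j, e1, _⟩)⟩ := cutEntry_eq_some.1 e
    · injection e1 with e1; rwa [e1]
    · simp at e1
    · simp at e1
  · intro hν; exact ⟨_, hν, cutEntry_append_singleton hh k c⟩

theorem nodeCut_append (δ δ' : List DecimalNumber) (h : List ℕ) :
    nodeCut (δ ++ δ') h = nodeCut δ h ++ nodeCut δ' h := by simp [nodeCut]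

theorem nodeCut_singleton (ν : DecimalNumber) (h : List ℕ) :
    nodeCut [ν] h = (cutEntry h ν).toList := by
  cases e : cutEntry h ν <;> simp [nodeCut, e]

/-- An element of the node cut of `h` with digit `k` comes from an entry with head `h.k`. -/
theorem prefix_of_cutEntry {h : List ℕ} {ν : DecimalNumber} {x : ℕ × Mark}
    (e : cutEntry h ν = some x) : h ++ [x.1] <+: ν.digits := by
  obtain ⟨k, m⟩ := x
  obtain ⟨_, (⟨c', e1, rfl⟩ | ⟨j, e1, e2⟩ | ⟨j, e1, e2⟩)⟩ := cutEntry_eq_some.1 e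
  · exact List.prefix_rfl
  · rw [e2]; exact ⟨1 :: List.replicate j 1, by simp⟩
  · rw [e2]; exact ⟨2 :: List.replicate j 1, by simp⟩

/-! ### Decimal codes as prefix-free sequences -/

/-- Neither of two sequences is a prefix of the other one. -/
def Incomparable (a b : List ℕ) : Prop := ¬ a <+: b ∧ ¬ b <+: a

theorem Incomparable.symm {a b : List ℕ} (h : Incomparable a b) : Incomparable b a := ⟨h.2, h.1⟩

theorem Incomparable.ne {a b : List ℕ} (h : Incomparable a b) : a ≠ b := by
  rintro rfl; exact h.1 List.prefix_rfl

theorem Incomparable.concat {a b : List ℕ} (h : Incomparable a b) (x : ℕ) :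
    Incomparable a (b ++ [x]) := by
  constructor
  · intro hp
    rcases List.prefix_concat_iff.1 hp with rfl | hp
    · exact h.2 (List.prefix_append _ _)
    · exact h.1 hp
  · intro hp
    exact h.2 ((List.prefix_append _ _).trans hp)

theorem incomparable_concat {a : List ℕ} {x y : ℕ} (h : x ≠ y) :
    Incomparable (a ++ [x]) (a ++ [y]) := by
  constructor
  · intro hp
    have := hp.eq_of_length (by simp)
    simp at this; exact h this
  · intro hp
    have := hp.eq_of_length (by simp)
    simp at this; exact h this.symm

/-- The conditions on decimal codes in a form adapted to induction: no entry is a head of another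
one. The existence and uniqueness of the block anchors is then automatic. -/
structure ValidCode (δ : List DecimalNumber) : Prop where
  ne_nil : ∀ ν ∈ δ, ν.digits ≠ []
  pos : ∀ ν ∈ δ, ∀ d ∈ ν.digits, 1 ≤ d
  prefixFree : δ.Pairwise fun ν μ => Incomparable ν.digits μ.digits
  cut : ∀ h, IsBranchHead δ h → IsColoredPairing (nodeCut δ h)
  labels : ∃ m, ∀ i, IsBlockLabel δ i ↔ 1 ≤ i ∧ i ≤ m
  anchor_color : ∀ ν ∈ δ, ∀ i j, IsAnchorWith i j ν → ν.color = if j = 0 then .black else .blue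
  anchor_order : δ.Pairwise fun ν μ => ∀ i j, IsAnchor i ν → IsAnchor j μ → i < j

theorem eq_of_prefixFree {δ : List DecimalNumber}
    (hδ : δ.Pairwise fun ν μ => Incomparable ν.digits μ.digits)
    {ν μ : DecimalNumber} (hν : ν ∈ δ) (hμ : μ ∈ δ) (h : ν.digits <+: μ.digits) : ν = μ := by
  by_contra hne
  have : Std.Symm fun ν μ : DecimalNumber => Incomparable ν.digits μ.digits :=
    ⟨fun _ _ h => h.symm⟩
  exact (hδ.forall hν hμ hne).1 h

theorem incomparable_of_prefixFree {δ : List DecimalNumber}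
    (hδ : δ.Pairwise fun ν μ => Incomparable ν.digits μ.digits)
    {ν μ : DecimalNumber} (hν : ν ∈ δ) (hμ : μ ∈ δ) (h : ν.digits ≠ μ.digits) :
    Incomparable ν.digits μ.digits :=
  ⟨fun hp => h (by rw [eq_of_prefixFree hδ hν hμ hp]),
    fun hp => h (by rw [eq_of_prefixFree hδ hμ hν hp])⟩

theorem ValidCode.nodup {δ : List DecimalNumber} (hδ : ValidCode δ) : δ.Nodup :=
  hδ.prefixFree.imp fun h e => h.ne (by rw [e])

theorem isBranchHead_of_prefix {δ : List DecimalNumber} {h : List ℕ} {q : ℕ} {ν : DecimalNumber}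
    (hh : h ≠ []) (hν : ν ∈ δ) (hp : h ++ [q] <+: ν.digits) : IsBranchHead δ h := by
  refine ⟨ν, hν, ⟨hh, (List.prefix_append _ _).trans hp⟩, ?_⟩
  intro e
  have := hp.length_le
  rw [e] at this; simp at this

theorem IsBranchHead.ne_nil {δ : List DecimalNumber} {h : List ℕ} (hb : IsBranchHead δ h) :
    h ≠ [] := by
  obtain ⟨_, _, hh, _⟩ := hb; exact hh.1

/-- A colored pairing sequence contains a blue and a red, so that it has at least two positive
elements. -/
theorem IsColoredPairing.two_le {s : List (ℕ × Mark)} (h : IsColoredPairing s) {K : ℕ}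
    (hK : positiveDigits s = List.range' 1 K) : 2 ≤ K := by
  have hb := IsColoredPairing.blueThenRed h
  obtain ⟨q₁, h1⟩ := mem_cutColors.1 hb.blue_mem
  obtain ⟨q₂, h2⟩ := mem_cutColors.1 hb.red_mem
  have hne : q₁ ≠ q₂ := by
    rintro rfl
    have := h.eq_leaf h1 h2
    simp at this
  have m1 : q₁ ∈ List.range' 1 K := by
    rw [← hK]; exact mem_positiveDigits.2 ⟨_, h1, by simp⟩
  have m2 : q₂ ∈ List.range' 1 K := by
    rw [← hK]; exact mem_positiveDigits.2 ⟨_, h2, by simp⟩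
  rw [List.mem_range'_1] at m1 m2
  omega

/-- For each digit `q` which follows a branch head, the node cut has a positive element `q`: a
leaf, or the first of a pair, which comes from the founder `q.1.⋯.1`. -/
theorem exists_mem_nodeCut {δ : List DecimalNumber}
    (hcut : ∀ h, IsBranchHead δ h → IsColoredPairing (nodeCut δ h)) {h : List ℕ} (hh : h ≠ [])
    {q : ℕ} {ν : DecimalNumber} (hν : ν ∈ δ) (hp : h ++ [q] <+: ν.digits) :
    ∃ m, m ≠ Mark.two ∧ (q, m) ∈ nodeCut δ h := by
  by_cases e : ν.digits = h ++ [q]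
  · refine ⟨.leaf ν.color, by simp, (leaf_mem_nodeCut hh).2 ?_⟩
    rw [← e]; exact hν
  · have hb : IsBranchHead δ (h ++ [q]) := ⟨ν, hν, ⟨by simp, hp⟩, e⟩
    have hc := hcut _ hb
    obtain ⟨K, hK⟩ := hc.positives
    change positiveDigits _ = _ at hK
    have h2 := hc.two_le hK
    have h1 : 1 ∈ positiveDigits (nodeCut δ (h ++ [q])) := by
      rw [hK, List.mem_range'_1]; omega
    obtain ⟨m, hm, hm2⟩ := mem_positiveDigits.1 h1
    obtain ⟨μ, hμ, e1⟩ := mem_nodeCut.1 hm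
    refine ⟨.one, by simp, mem_nodeCut.2 ⟨μ, hμ, cutEntry_eq_some.2 ⟨hh, Or.inr (Or.inl ?_)⟩⟩⟩
    obtain ⟨_, (⟨c', _, rfl⟩ | ⟨j, _, e2⟩ | ⟨j, e3, _⟩)⟩ := cutEntry_eq_some.1 e1
    · exact ⟨0, rfl, by simp⟩
    · exact ⟨j + 1, rfl, by rw [e2]; simp [List.replicate_succ]⟩
    · exact absurd e3 hm2

/-- In a node cut all the pairs are complete: if `h.q` is a branch head, then there are the
entries `h.q.1.⋯.1` and `h.q.2.1.⋯.1`, because the node cut of `h.q` has positive elements `1` and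
`2`. -/
theorem two_mem_nodeCut {δ : List DecimalNumber}
    (hcut : ∀ h, IsBranchHead δ h → IsColoredPairing (nodeCut δ h)) {h : List ℕ}
    {q : ℕ} (hq : (q, Mark.one) ∈ nodeCut δ h) : (q, Mark.two) ∈ nodeCut δ h := by
  obtain ⟨ν, hν, e⟩ := mem_nodeCut.1 hq
  obtain ⟨hh, (⟨c', e1, _⟩ | ⟨j, _, e2⟩ | ⟨j, e1, _⟩)⟩ := cutEntry_eq_some.1 e
  · simp at e1
  · have hb : IsBranchHead δ (h ++ [q]) :=
      ⟨ν, hν, ⟨by simp, by rw [e2]; exact ⟨1 :: List.replicate j 1, by simp⟩⟩, by rw [e2]; simp⟩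
    have hc := hcut _ hb
    obtain ⟨K, hK⟩ := hc.positives
    change positiveDigits _ = _ at hK
    have h2 := hc.two_le hK
    have h1 : 2 ∈ positiveDigits (nodeCut δ (h ++ [q])) := by
      rw [hK, List.mem_range'_1]; omega
    obtain ⟨m, hm, hm2⟩ := mem_positiveDigits.1 h1
    obtain ⟨μ, hμ, e1⟩ := mem_nodeCut.1 hm
    refine mem_nodeCut.2 ⟨μ, hμ, cutEntry_eq_some.2 ⟨hh, Or.inr (Or.inr ?_)⟩⟩
    obtain ⟨_, (⟨c', _, rfl⟩ | ⟨j, _, e2⟩ | ⟨j, e3, _⟩)⟩ := cutEntry_eq_some.1 e1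
    · exact ⟨0, rfl, by simp⟩
    · exact ⟨j + 1, rfl, by rw [e2]; simp [List.replicate_succ]⟩
    · exact absurd e3 hm2
  · simp at e1

/-- The digits which follow a branch head are those of the positive elements of its node cut. -/
theorem exists_prefix_iff {δ : List DecimalNumber}
    (hcut : ∀ h, IsBranchHead δ h → IsColoredPairing (nodeCut δ h)) {h : List ℕ} (hh : h ≠ [])
    (q : ℕ) : (∃ ν ∈ δ, h ++ [q] <+: ν.digits) ↔ q ∈ positiveDigits (nodeCut δ h) := by
  rw [mem_positiveDigits]
  constructor
  · rintro ⟨ν, hν, hp⟩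
    obtain ⟨m, hm, h1⟩ := exists_mem_nodeCut hcut hh hν hp
    exact ⟨m, h1, hm⟩
  · rintro ⟨m, h1, _⟩
    obtain ⟨ν, hν, e⟩ := mem_nodeCut.1 h1
    exact ⟨ν, hν, prefix_of_cutEntry e⟩

/-- Every block label has an anchor: the entry `i.c` of a singlet, or the entry which gives the
positive element `1` in the node cut of `i`. -/
theorem exists_anchor {δ : List DecimalNumber} (hne : ∀ ν ∈ δ, ν.digits ≠ [])
    (hcut : ∀ h, IsBranchHead δ h → IsColoredPairing (nodeCut δ h)) {i : ℕ}
    (hi : IsBlockLabel δ i) : ∃ ν ∈ δ, IsAnchor i ν := by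
  obtain ⟨ν, hν, e⟩ := hi
  have hp : [i] <+: ν.digits := by
    match hd : ν.digits with
    | [] => exact absurd hd (hne ν hν)
    | a :: l => rw [hd] at e; simp at e; simp [e]
  by_cases h1 : ν.digits = [i]
  · exact ⟨ν, hν, 0, h1⟩
  · have hc := hcut [i] ⟨ν, hν, ⟨by simp, hp⟩, h1⟩
    obtain ⟨K, hK⟩ := hc.positives
    change positiveDigits _ = _ at hK
    have h2 := hc.two_le hK
    have h1 : 1 ∈ positiveDigits (nodeCut δ [i]) := by
      rw [hK, List.mem_range'_1]; omega
    obtain ⟨m, hm, hm2⟩ := mem_positiveDigits.1 h1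
    obtain ⟨μ, hμ, e1⟩ := mem_nodeCut.1 hm
    refine ⟨μ, hμ, ?_⟩
    obtain ⟨_, (⟨c', _, rfl⟩ | ⟨j, _, e2⟩ | ⟨j, e3, _⟩)⟩ := cutEntry_eq_some.1 e1
    · exact ⟨1, rfl⟩
    · exact ⟨j + 2, e2⟩
    · exact absurd e3 hm2

/-- Two anchors of a block are comparable, so that in a prefix-free code they are equal. -/
theorem IsAnchor.prefix_or {i : ℕ} {ν μ : DecimalNumber} (h : IsAnchor i ν) (h' : IsAnchor i μ) :
    ν.digits <+: μ.digits ∨ μ.digits <+: ν.digits := by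
  obtain ⟨j, h⟩ := h
  obtain ⟨j', h'⟩ := h'
  unfold IsAnchorWith at h h'
  rw [h, h']
  rcases le_total j j' with hj | hj
  · left
    rw [List.cons_prefix_cons]
    exact ⟨rfl, List.replicate (j' - j) 1, by rw [List.replicate_append_replicate]; congr; omega⟩
  · right
    rw [List.cons_prefix_cons]
    exact ⟨rfl, List.replicate (j - j') 1, by rw [List.replicate_append_replicate]; congr; omega⟩

/-- The condition on heads says that the code is prefix-free, and the unique existence of the
anchors follows from the other conditions. -/
theorem isDecimalCode_iff_validCode (δ : List DecimalNumber) : IsDecimalCode δ ↔ ValidCode δ := by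
  constructor
  · intro h
    refine ⟨h.digits_ne_nil, h.digits_pos, ?_, h.nodeCut_pairing, h.blockLabels, h.anchor_color,
      h.anchor_order⟩
    rw [List.pairwise_iff_forall_sublist]
    intro ν μ hsub
    have hν : ν ∈ δ := hsub.subset (by simp)
    have hμ : μ ∈ δ := hsub.subset (by simp)
    -- two entries, one of them a head of the other one, would both be counted for this head
    have key : ∀ a ∈ δ, ∀ b ∈ δ, a.digits <+: b.digits →
        (∀ p : DecimalNumber → Bool, p a → p b → 2 ≤ δ.countP p) → False := by
      intro a ha b hb hp h2
      have hha : IsHead a.digits a := ⟨h.digits_ne_nil a ha, List.prefix_rfl⟩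
      have hhb : IsHead a.digits b := ⟨h.digits_ne_nil a ha, hp⟩
      rcases h.leaf_or_branch a.digits ⟨a, ha, hha⟩ with ⟨h1, _⟩ | h1
      · have := h2 (fun ν => decide (IsHead a.digits ν)) (by simpa using hha) (by simpa using hhb)
        omega
      · exact h1 a ha hha rfl
    constructor
    · intro hp
      refine key ν hν μ hμ hp fun p h1 h2 => ?_
      have := hsub.countP_le (p := p)
      simp only [List.countP_cons, h1, h2, List.countP_nil, if_true] at this
      exact this
    · intro hp
      refine key μ hμ ν hν hp fun p h1 h2 => ?_
      have := hsub.countP_le (p := p)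
      simp only [List.countP_cons, h1, h2, List.countP_nil, if_true] at this
      exact this
  · intro h
    refine ⟨h.ne_nil, h.pos, ?_, h.cut, h.labels, ?_, h.anchor_color, h.anchor_order⟩
    · rintro g ⟨ν, hν, hh⟩
      -- a head which is an entry is a head of this entry only; the other heads are branch heads
      by_cases hex : ∃ μ ∈ δ, μ.digits = g
      · left
        obtain ⟨μ, hμ, rfl⟩ := hex
        have hu : ∀ ν' ∈ δ, IsHead μ.digits ν' → ν' = μ := fun ν' h1 h2 =>
          (eq_of_prefixFree h.prefixFree hμ h1 h2.2).symm
        refine ⟨?_, fun ν' h1 h2 => by rw [hu ν' h1 h2]⟩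
        have hn := h.nodup
        have e : δ.countP (fun ν => decide (IsHead μ.digits ν)) = δ.count μ := by
          unfold List.count
          apply List.countP_congr
          intro x hx
          simp only [decide_eq_true_eq, beq_iff_eq]
          constructor
          · exact hu x hx
          · rintro rfl; exact ⟨h.ne_nil x hx, List.prefix_rfl⟩
        rw [e]
        exact List.count_eq_one_of_mem hn hμ
      · right
        intro ν' h1 _ e
        exact hex ⟨ν', h1, e⟩
    · -- the anchor of a block
      intro i hi
      obtain ⟨ν, hν, ha⟩ := exists_anchor h.ne_nil h.cut hi
      obtain ⟨k, hk⟩ := List.mem_iff_get.1 hν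
      refine ⟨k, by beta_reduce; rw [hk]; exact ha, ?_⟩
      intro k' hk'
      have e : δ.get k' = δ.get k := by
        rw [hk]
        rcases hk'.prefix_or ha with hp | hp
        · exact eq_of_prefixFree h.prefixFree (List.get_mem _ _) hν hp
        · exact (eq_of_prefixFree h.prefixFree hν (List.get_mem _ _) hp).symm
      exact (List.nodup_iff_injective_get.1 h.nodup) e

/-! ### Replacing an entry of a code -/

/-- Replace the entry with digits `D` by `μ`. -/
def recode (D : List ℕ) (μ : DecimalNumber) (δ : List DecimalNumber) : List DecimalNumber :=
  δ.map fun ν => if ν.digits = D then μ else ν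

theorem length_recode (D : List ℕ) (μ : DecimalNumber) (δ : List DecimalNumber) :
    (recode D μ δ).length = δ.length := by simp [recode]

theorem mem_recode {D : List ℕ} {μ ν : DecimalNumber} {δ : List DecimalNumber} :
    ν ∈ recode D μ δ ↔ (ν = μ ∧ ∃ ν' ∈ δ, ν'.digits = D) ∨ (ν ∈ δ ∧ ν.digits ≠ D) := by
  simp only [recode, List.mem_map]
  constructor
  · rintro ⟨a, ha, rfl⟩
    split_ifs with h
    · exact Or.inl ⟨rfl, a, ha, h⟩
    · exact Or.inr ⟨ha, h⟩
  · rintro (⟨rfl, a, ha, h⟩ | ⟨ha, h⟩)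
    · exact ⟨a, ha, by simp [h]⟩
    · exact ⟨ν, ha, by simp [h]⟩

theorem mem_recode_of_ne {D : List ℕ} {μ ν : DecimalNumber} {δ : List DecimalNumber}
    (h : ν.digits ≠ D) (h' : ν ≠ μ) : ν ∈ recode D μ δ ↔ ν ∈ δ := by
  rw [mem_recode]; simp [h, h']

theorem prefixFree_recode {D : List ℕ} {μ : DecimalNumber} {δ : List DecimalNumber}
    (hδ : δ.Pairwise fun ν μ => Incomparable ν.digits μ.digits)
    (h : ∀ ν ∈ δ, ν.digits ≠ D → Incomparable ν.digits μ.digits) :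
    (recode D μ δ).Pairwise fun ν μ => Incomparable ν.digits μ.digits := by
  unfold recode
  rw [List.pairwise_map]
  refine hδ.imp_of_mem fun {a b} ha hb hab => ?_
  by_cases h1 : a.digits = D <;> by_cases h2 : b.digits = D
  · exact absurd (h1.trans h2.symm) hab.ne
  · simp only [h1, h2, if_true, if_false]; exact (h b hb h2).symm
  · simp only [h1, h2, if_true, if_false]; exact h a ha h1
  · simpa only [h1, h2, if_false] using hab

/-- The order of the anchors is kept if the new entry is an anchor only where the former one was. -/
theorem anchor_order_recode {D : List ℕ} {μ : DecimalNumber} {δ : List DecimalNumber}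
    (hδ : δ.Pairwise fun ν μ => ∀ i j, IsAnchor i ν → IsAnchor j μ → i < j)
    (h : ∀ i c, IsAnchor i μ → IsAnchor i ⟨D, c⟩) :
    (recode D μ δ).Pairwise fun ν μ => ∀ i j, IsAnchor i ν → IsAnchor j μ → i < j := by
  unfold recode
  rw [List.pairwise_map]
  have h' : ∀ (a : DecimalNumber) i, IsAnchor i (if a.digits = D then μ else a) →
      IsAnchor i a := by
    intro a i ha
    split_ifs at ha with e
    · have := h i a.color ha
      rwa [← e] at this
    · exact ha
  exact hδ.imp fun {a b} hab i j hi hj => hab i j (h' a i hi) (h' b j hj)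

theorem isBlockLabel_recode {D : List ℕ} {μ : DecimalNumber} {δ : List DecimalNumber}
    (h : μ.digits.head? = D.head?) (i : ℕ) :
    IsBlockLabel (recode D μ δ) i ↔ IsBlockLabel δ i := by
  unfold IsBlockLabel
  constructor
  · rintro ⟨ν, hν, e⟩
    rcases mem_recode.1 hν with ⟨rfl, ν', h1, h2⟩ | ⟨h1, _⟩
    · exact ⟨ν', h1, by rw [h2, ← h, e]⟩
    · exact ⟨ν, h1, e⟩
  · rintro ⟨ν, hν, e⟩
    by_cases hD : ν.digits = D
    · exact ⟨μ, mem_recode.2 (Or.inl ⟨rfl, ν, hν, hD⟩), by rw [h, ← hD, e]⟩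
    · exact ⟨ν, mem_recode.2 (Or.inr ⟨hν, hD⟩), e⟩

/-- A replacement is undone by the inverse replacement if each of the two entries has the place of
the other one to itself. -/
theorem recode_recode {D : List ℕ} {μ ν₀ : DecimalNumber} {δ : List DecimalNumber}
    (h0 : ∀ ν ∈ δ, ν.digits = D → ν = ν₀) (h1 : ∀ ν ∈ δ, ν.digits = μ.digits → ν.digits = D) :
    recode μ.digits ν₀ (recode D μ δ) = δ := by
  unfold recode
  rw [List.map_map]
  conv_rhs => rw [← List.map_id δ]
  apply List.map_congr_left
  intro ν hν
  by_cases e : ν.digits = D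
  · simp only [Function.comp, e, if_true, id]
    exact (h0 ν hν e).symm
  · have : ν.digits ≠ μ.digits := fun h => e (h1 ν hν h)
    simp [e, this]

/-- A replacement which the node cut of `g` does not see leaves this node cut unchanged. -/
theorem nodeCut_recode_of_eq {D g : List ℕ} {μ : DecimalNumber} {δ : List DecimalNumber}
    (h : ∀ c, ⟨D, c⟩ ∈ δ → cutEntry g μ = cutEntry g ⟨D, c⟩) :
    nodeCut (recode D μ δ) g = nodeCut δ g := by
  unfold nodeCut recode
  rw [List.filterMap_map]
  apply List.filterMap_congr
  intro ν hν
  by_cases e : ν.digits = D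
  · simp only [Function.comp, e, if_true]
    rw [h ν.color (by rw [← e]; exact hν), ← e]
  · simp only [Function.comp, e, if_false]

/-- Replacing an entry `g.p.c` by an entry which gives `p` with the mark `m` changes the mark of
`p` in the node cut of `g`. -/
theorem nodeCut_recode_of_remark {g : List ℕ} (hg : g ≠ []) {p : ℕ} {m : Mark} {μ : DecimalNumber}
    {δ : List DecimalNumber} (hμ : cutEntry g μ = some (p, m))
    (h : ∀ ν ∈ δ, g ++ [p] <+: ν.digits → ν.digits = g ++ [p]) :
    nodeCut (recode (g ++ [p]) μ δ) g = remark p m (nodeCut δ g) := by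
  unfold nodeCut recode remark
  rw [List.filterMap_map, List.map_filterMap]
  apply List.filterMap_congr
  intro ν hν
  by_cases e : ν.digits = g ++ [p]
  · simp only [Function.comp, e, if_true]
    have : ν = ⟨g ++ [p], ν.color⟩ := by rw [← e]
    rw [this, hμ, cutEntry_append_singleton hg]
    simp
  · simp only [Function.comp, e, if_false]
    cases hc : cutEntry g ν with
    | none => rfl
    | some x =>
      have hx : x.1 ≠ p := by
        rintro rfl
        exact e (h ν hν (prefix_of_cutEntry hc))
      simp [hx]

theorem nodeCut_eq_nil {g : List ℕ} {δ : List DecimalNumber} (h : ∀ ν ∈ δ, ¬ g <+: ν.digits) :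
    nodeCut δ g = [] := by
  rw [List.eq_nil_iff_forall_not_mem]
  intro x hx
  obtain ⟨ν, hν, e⟩ := mem_nodeCut.1 hx
  exact h ν hν ((List.prefix_append _ _).trans (prefix_of_cutEntry e))

/-- If a leaf becomes a branch head, only the entry which replaces it is in its node cut. -/
theorem nodeCut_recode_self {D : List ℕ} {μ ν₀ : DecimalNumber} {δ : List DecimalNumber}
    (hδ : δ.Pairwise fun ν μ => Incomparable ν.digits μ.digits) (h0 : ν₀ ∈ δ)
    (hD : ν₀.digits = D) : nodeCut (recode D μ δ) D = (cutEntry D μ).toList := by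
  obtain ⟨l₁, l₂, rfl⟩ := List.append_of_mem h0
  subst hD
  rw [List.pairwise_append, List.pairwise_cons] at hδ
  have e : recode ν₀.digits μ (l₁ ++ ν₀ :: l₂) = l₁ ++ [μ] ++ l₂ := by
    have h1 : ∀ l : List DecimalNumber, (∀ ν ∈ l, ν.digits ≠ ν₀.digits) →
        recode ν₀.digits μ l = l := by
      intro l hl
      unfold recode
      conv_rhs => rw [← List.map_id l]
      apply List.map_congr_left
      intro ν hν
      simp [hl ν hν]
    have h2 : recode ν₀.digits μ (l₁ ++ ν₀ :: l₂) =
        recode ν₀.digits μ l₁ ++ μ :: recode ν₀.digits μ l₂ := by simp [recode]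
    rw [h2, h1 l₁ fun ν hν => (hδ.2.2 ν hν ν₀ (by simp)).ne,
      h1 l₂ fun ν hν => (hδ.2.1.1 ν hν).symm.ne]
    simp
  rw [e, nodeCut_append, nodeCut_append, nodeCut_singleton,
    nodeCut_eq_nil fun ν hν => (hδ.2.2 ν hν ν₀ (by simp)).2,
    nodeCut_eq_nil fun ν hν => (hδ.2.1.1 ν hν).1]
  simp

/-! ### The growth of a code by one entry -/

/-- In the code `δ`, the entry `h.p.c` is the last blue with head `h`, or the only red: `CutFit`
in terms of the entries. -/
def Fit (δ : List DecimalNumber) (h : List ℕ) (p : ℕ) (c : Color) : Prop :=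
  (c = .blue ∧ ∀ q, ⟨h ++ [q], .blue⟩ ∈ δ → q ≤ p) ∨
    (c = .red ∧ ∀ q, ⟨h ++ [q], .red⟩ ∈ δ → q = p)

theorem fit_iff_cutFit {δ : List DecimalNumber} {h : List ℕ} (hh : h ≠ []) (p : ℕ) (c : Color) :
    Fit δ h p c ↔ CutFit (nodeCut δ h) p c := by
  unfold Fit CutFit
  simp only [leaf_mem_nodeCut hh]

/-- The effect on the code of the insertion of a new largest value: at the end (`append`); before
the value with digits `D`, which becomes `D.1` while the new value gets `D.2` (`pair`); or before
the value with digits `h.p`, the family of which the new value joins, with the digits `h.(K+1)`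
where `K` is the number of digits in use after `h` (`join`). The option is `none`, or the digits
of the friend, the value before which the new one is inserted. -/
inductive CodeStep (δ : List DecimalNumber) : Option (List ℕ) → List DecimalNumber → Prop where
  | append (M : ℕ) (hM : ∀ i, IsBlockLabel δ i ↔ 1 ≤ i ∧ i ≤ M) :
      CodeStep δ none (δ ++ [⟨[M + 1], .black⟩])
  | pair (D : List ℕ) (c : Color) (hD : ⟨D, c⟩ ∈ δ)
      (hfit : ∀ h p, h ≠ [] → D = h ++ [p] → ¬ Fit δ h p c) :
      CodeStep δ (some D) (recode D ⟨D ++ [1], .blue⟩ δ ++ [⟨D ++ [2], .red⟩])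
  | join (h : List ℕ) (p : ℕ) (c : Color) (K : ℕ) (hh : h ≠ []) (hD : ⟨h ++ [p], c⟩ ∈ δ)
      (hfit : Fit δ h p c) (hK : ∀ q, (∃ ν ∈ δ, h ++ [q] <+: ν.digits) ↔ 1 ≤ q ∧ q ≤ K) :
      CodeStep δ (some (h ++ [p]))
        (recode (h ++ [p]) ⟨h ++ [p], .blue⟩ δ ++ [⟨h ++ [K + 1], .red⟩])

/-- The first value of a new parenthesis is an anchor exactly if the leaf which it replaces was
one. -/
theorem isAnchor_concat_one {i : ℕ} {D : List ℕ} {c c' : Color} (hD : D ≠ []) :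
    IsAnchor i ⟨D ++ [1], c⟩ ↔ IsAnchor i ⟨D, c'⟩ := by
  unfold IsAnchor IsAnchorWith
  match D, hD with
  | a :: l, _ =>
    simp only [List.cons_append, List.cons.injEq]
    constructor
    · rintro ⟨j, rfl, h⟩
      match j with
      | 0 => simp at h
      | j + 1 =>
        rw [List.replicate_succ'] at h
        exact ⟨j, rfl, (List.append_inj' h rfl).1⟩
    · rintro ⟨j, rfl, h⟩
      exact ⟨j + 1, rfl, by rw [List.replicate_succ', h]⟩

theorem not_isAnchor_concat {i q : ℕ} {D : List ℕ} {c : Color} (hD : D ≠ []) (hq : q ≠ 1) :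
    ¬ IsAnchor i ⟨D ++ [q], c⟩ := by
  rintro ⟨j, h⟩
  unfold IsAnchorWith at h
  match D, hD with
  | a :: l, _ =>
    simp only [List.cons_append, List.cons.injEq] at h
    have : q ∈ List.replicate j 1 := by rw [← h.2]; simp
    exact hq (List.mem_replicate.1 this).2

/-- An anchor with at least two digits ends with a digit `1`, and is not a singlet. -/
theorem anchorWith_pos {i j p : ℕ} {h : List ℕ} {c : Color} (hh : h ≠ [])
    (ha : IsAnchorWith i j ⟨h ++ [p], c⟩) : j ≠ 0 ∧ p = 1 := by
  constructor
  · rintro rfl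
    unfold IsAnchorWith at ha
    match h, hh with
    | a :: l, _ => simp at ha
  · by_contra hp
    exact not_isAnchor_concat hh hp ⟨j, ha⟩

theorem pairwise_concat {α : Type*} {R : α → α → Prop} {l : List α} {a : α}
    (hl : l.Pairwise R) (h : ∀ x ∈ l, R x a) : (l ++ [a]).Pairwise R := by
  rw [List.pairwise_append]
  exact ⟨hl, by simp, by simpa using h⟩

/-- The node cut of `h` has positive digits `1, …, K`, where `K` is the number of digits which
follow `h` in the code. -/
theorem positiveDigits_nodeCut {δ : List DecimalNumber} (hδ : ValidCode δ) {h : List ℕ} {K : ℕ}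
    (hb : IsBranchHead δ h)
    (hK : ∀ q, (∃ ν ∈ δ, h ++ [q] <+: ν.digits) ↔ 1 ≤ q ∧ q ≤ K) :
    positiveDigits (nodeCut δ h) = List.range' 1 K := by
  obtain ⟨K', hK'⟩ := (hδ.cut h hb).positives
  change positiveDigits _ = _ at hK'
  rw [hK']
  congr 1
  have key : ∀ q, (1 ≤ q ∧ q ≤ K') ↔ (1 ≤ q ∧ q ≤ K) := by
    intro q
    rw [← hK q, exists_prefix_iff hδ.cut hb.ne_nil, hK', List.mem_range'_1]
    omega
  have h1 := key K
  have h2 := key K'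
  omega

theorem isBlockLabel_append {δ : List DecimalNumber} {ν : DecimalNumber} {i : ℕ} :
    IsBlockLabel (δ ++ [ν]) i ↔ IsBlockLabel δ i ∨ ν.digits.head? = some i := by
  simp [IsBlockLabel, or_and_right, exists_or]

theorem isBlockLabel_append_of_head {δ : List DecimalNumber} {ν μ : DecimalNumber} (hμ : μ ∈ δ)
    (h : ν.digits.head? = μ.digits.head?) (i : ℕ) :
    IsBlockLabel (δ ++ [ν]) i ↔ IsBlockLabel δ i := by
  rw [isBlockLabel_append]
  exact ⟨fun h' => h'.elim id fun e => ⟨μ, hμ, h ▸ e⟩, Or.inl⟩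

theorem head?_append_of_ne_nil {α : Type*} {l l' : List α} (h : l ≠ []) :
    (l ++ l').head? = l.head? := by
  cases l with
  | nil => exact absurd rfl h
  | cons a l => rfl

/-- The `append` step leads to a code. -/
theorem ValidCode.append {δ : List DecimalNumber} (hδ : ValidCode δ) {M : ℕ}
    (hM : ∀ i, IsBlockLabel δ i ↔ 1 ≤ i ∧ i ≤ M) : ValidCode (δ ++ [⟨[M + 1], .black⟩]) := by
  have hhead : ∀ ν ∈ δ, ∀ i l, ν.digits = i :: l → 1 ≤ i ∧ i ≤ M := fun ν hν i l e =>
    (hM i).1 ⟨ν, hν, by rw [e]; rfl⟩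
  refine ⟨?_, ?_, ?_, ?_, ?_, ?_, ?_⟩
  · intro ν hν
    rcases List.mem_append.1 hν with hν | hν
    · exact hδ.ne_nil ν hν
    · simp at hν; subst hν; simp
  · intro ν hν d hd
    rcases List.mem_append.1 hν with hν | hν
    · exact hδ.pos ν hν d hd
    · simp at hν; subst hν; simp at hd; omega
  · refine pairwise_concat hδ.prefixFree fun ν hν => ?_
    have hne := hδ.ne_nil ν hν
    match hd : ν.digits with
    | [] => exact absurd hd hne
    | a :: l =>
      have := hhead ν hν a l hd
      constructor
      · intro hp
        rw [List.cons_prefix_cons] at hp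
        omega
      · intro hp
        rw [List.cons_prefix_cons] at hp
        omega
  · -- a single digit is not visible in the node cuts
    intro g hg
    have hc : cutEntry g ⟨[M + 1], .black⟩ = none := by
      cases e : cutEntry g ⟨[M + 1], .black⟩ with
      | none => rfl
      | some x =>
        have := (prefix_of_cutEntry e).length_le
        simp at this
        exact absurd this hg.ne_nil
    rw [nodeCut_append, nodeCut_singleton, hc]
    simp only [Option.toList, List.append_nil]
    apply hδ.cut
    obtain ⟨ν, hν, hh, hne⟩ := hg
    rcases List.mem_append.1 hν with hν | hν
    · exact ⟨ν, hν, hh, hne⟩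
    · simp at hν; subst hν
      obtain ⟨h1, h2⟩ := hh
      have h3 := h2.length_le
      have h4 : 0 < g.length := List.length_pos_iff.2 h1
      rw [List.length_singleton] at h3
      exact absurd (h2.eq_of_length (by rw [List.length_singleton]; omega)).symm hne
  · refine ⟨M + 1, fun i => ?_⟩
    rw [isBlockLabel_append, hM i]
    simp
    omega
  · intro ν hν i j ha
    rcases List.mem_append.1 hν with hν | hν
    · exact hδ.anchor_color ν hν i j ha
    · simp at hν; subst hν
      have : j = 0 := by
        unfold IsAnchorWith at ha
        simp at ha
        exact ha.2
      simp [this]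
  · refine pairwise_concat hδ.anchor_order fun ν hν i j hi hj => ?_
    obtain ⟨k, hi⟩ := hi
    obtain ⟨k', hj⟩ := hj
    have h1 := hhead ν hν i _ hi
    unfold IsAnchorWith at hj
    simp at hj
    omega

theorem incomparable_of_mem {δ : List DecimalNumber} (hδ : ValidCode δ) {D : List ℕ} {c : Color}
    (hD : ⟨D, c⟩ ∈ δ) {ν : DecimalNumber} (hν : ν ∈ δ) (h : ν.digits ≠ D) :
    Incomparable ν.digits D :=
  incomparable_of_prefixFree hδ.prefixFree hν hD h

/-- The node cuts after the pair step: `D` becomes a branch head with node cut `1.b, 2.r`, a new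
pair appears in the node cut of the head one digit shorter, and nothing else changes. -/
theorem nodeCut_pair {δ : List DecimalNumber} (hδ : ValidCode δ) {D : List ℕ} {c : Color}
    (hD : ⟨D, c⟩ ∈ δ) (g : List ℕ) (hg : g ≠ []) :
    nodeCut (recode D ⟨D ++ [1], .blue⟩ δ ++ [⟨D ++ [2], .red⟩]) g =
      if g = D then [(1, .leaf .blue), (2, .leaf .red)]
      else if g = D.dropLast then
        remark (D.getLastD 0) .one (nodeCut δ g) ++ [(D.getLastD 0, .two)]
      else nodeCut δ g := by
  have hDn : D ≠ [] := hδ.ne_nil _ hD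
  rw [nodeCut_append, nodeCut_singleton]
  split_ifs with h1 h2
  · subst h1
    rw [nodeCut_recode_self hδ.prefixFree hD rfl, cutEntry_append_singleton hg,
      cutEntry_append_singleton hg]
    rfl
  · obtain ⟨p, rfl⟩ : ∃ p, D = g ++ [p] :=
      ⟨D.getLast hDn, by rw [h2, List.dropLast_append_getLast]⟩
    rw [nodeCut_recode_of_remark hg (cutEntry_append_pair_one hg p _)
      fun ν hν hp => by rw [← eq_of_prefixFree hδ.prefixFree hD hν hp],
      cutEntry_append_pair_two hg]
    simp
  · have h2' : ∀ k, D ≠ g ++ [k] := fun k e => h2 (by rw [e, List.dropLast_concat])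
    rw [nodeCut_recode_of_eq fun c _ => cutEntry_append_one h1 h2' _ _,
      cutEntry_append_two h1 h2']
    simp

/-- The node cuts after the join step: only the node cut of `h` changes. Since the new digit is at
least `3`, the new entry is invisible in the other ones. -/
theorem nodeCut_join {δ : List DecimalNumber} (hδ : ValidCode δ) {h : List ℕ} {p : ℕ} {c : Color}
    (hh : h ≠ []) (hD : ⟨h ++ [p], c⟩ ∈ δ) {K : ℕ} (hK : 2 ≤ K) (g : List ℕ) :
    nodeCut (recode (h ++ [p]) ⟨h ++ [p], .blue⟩ δ ++ [⟨h ++ [K + 1], .red⟩]) g =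
      if g = h then remark p (.leaf .blue) (nodeCut δ h) ++ [(K + 1, .leaf .red)]
      else nodeCut δ g := by
  rw [nodeCut_append, nodeCut_singleton]
  split_ifs with h1
  · subst h1
    rw [nodeCut_recode_of_remark hh (cutEntry_append_singleton hh p _)
      fun ν hν hp => by rw [← eq_of_prefixFree hδ.prefixFree hD hν hp],
      cutEntry_append_singleton hh]
    rfl
  · have h2 : ∀ k, h ++ [p] ≠ g ++ [k] := fun k e => h1 (List.append_inj' e rfl).1.symm
    rw [nodeCut_recode_of_eq fun c _ => cutEntry_color h2 _ _,
      cutEntry_append_large h1 (by omega)]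
    simp

/-- The `pair` step leads to a code: the node cut of `D` is `1.b, 2.r`, and the node cut of the
head one digit shorter grows by `IsColoredPairing.pair`. -/
theorem ValidCode.pair {δ : List DecimalNumber} (hδ : ValidCode δ) {D : List ℕ} {c : Color}
    (hD : ⟨D, c⟩ ∈ δ) (hfit : ∀ h p, h ≠ [] → D = h ++ [p] → ¬ Fit δ h p c) :
    ValidCode (recode D ⟨D ++ [1], .blue⟩ δ ++ [⟨D ++ [2], .red⟩]) := by
  have hDn : D ≠ [] := hδ.ne_nil _ hD
  have hmem : ∀ ν ∈ recode D ⟨D ++ [1], .blue⟩ δ ++ [⟨D ++ [2], .red⟩],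
      ν = ⟨D ++ [1], .blue⟩ ∨ ν = ⟨D ++ [2], .red⟩ ∨ (ν ∈ δ ∧ ν.digits ≠ D) := by
    intro ν hν
    rcases List.mem_append.1 hν with hν | hν
    · rcases mem_recode.1 hν with ⟨h, _⟩ | h
      · exact Or.inl h
      · exact Or.inr (Or.inr h)
    · simp at hν; exact Or.inr (Or.inl hν)
  refine ⟨?_, ?_, ?_, ?_, ?_, ?_, ?_⟩
  · intro ν hν
    rcases hmem ν hν with rfl | rfl | ⟨h, _⟩
    · simp
    · simp
    · exact hδ.ne_nil ν h
  · intro ν hν d hd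
    rcases hmem ν hν with rfl | rfl | ⟨h, _⟩
    · rcases List.mem_append.1 hd with hd | hd
      · exact hδ.pos _ hD d hd
      · simp at hd; omega
    · rcases List.mem_append.1 hd with hd | hd
      · exact hδ.pos _ hD d hd
      · simp at hd; omega
    · exact hδ.pos ν h d hd
  · refine pairwise_concat (prefixFree_recode hδ.prefixFree fun ν hν h =>
      (incomparable_of_mem hδ hD hν h).concat 1) fun ν hν => ?_
    rcases mem_recode.1 hν with ⟨rfl, _⟩ | ⟨hν, h⟩
    · exact incomparable_concat (by simp)
    · exact (incomparable_of_mem hδ hD hν h).concat 2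
  · intro g hg
    have hgn := hg.ne_nil
    rw [nodeCut_pair hδ hD g hgn]
    -- the new node cut, the node cut with the new pair, and the unchanged ones
    split_ifs with h1 h2
    · refine ⟨⟨2, rfl⟩, ?_, ?_, ⟨1, 1, le_rfl, le_rfl, rfl⟩, ?_⟩
      · intro i k hi
        have := List.mem_of_getElem? hi
        simp at this
      · intro k
        rw [List.count_eq_zero_of_not_mem (by simp)]; simp
      · intro k hk hk'
        simp at hk'
        have : k = 2 := by omega
        subst this
        simp [Mark.sign]
    · obtain ⟨p, rfl⟩ : ∃ p, D = g ++ [p] :=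
        ⟨D.getLast hDn, by rw [h2, List.dropLast_append_getLast]⟩
      have hb : IsBranchHead δ g := isBranchHead_of_prefix hgn hD List.prefix_rfl
      have hf := hfit g p hgn rfl
      rw [fit_iff_cutFit hgn] at hf
      simpa using (hδ.cut g hb).pair ((leaf_mem_nodeCut hgn).2 hD) hf
    · apply hδ.cut
      obtain ⟨ν, hν, ⟨_, hp⟩, hne⟩ := hg
      have hsub : ∀ x, g <+: D ++ [x] → D ++ [x] ≠ g → IsBranchHead δ g := by
        intro x hp hne
        rcases List.prefix_concat_iff.1 hp with e | hp
        · exact absurd e.symm hne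
        · exact ⟨_, hD, ⟨hgn, hp⟩, fun e => h1 e.symm⟩
      rcases hmem ν hν with rfl | rfl | ⟨h, _⟩
      · exact hsub 1 hp hne
      · exact hsub 2 hp hne
      · exact ⟨ν, h, ⟨hgn, hp⟩, hne⟩
  · obtain ⟨m, hm⟩ := hδ.labels
    refine ⟨m, fun i => ?_⟩
    rw [isBlockLabel_append_of_head (μ := ⟨D ++ [1], .blue⟩)
      (mem_recode.2 (Or.inl ⟨rfl, _, hD, rfl⟩))
      (by simp only [head?_append_of_ne_nil hDn]),
      isBlockLabel_recode (by simp only [head?_append_of_ne_nil hDn]), hm]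
  · intro ν hν i j ha
    rcases hmem ν hν with rfl | rfl | ⟨h, _⟩
    · simp [(anchorWith_pos hDn ha).1]
    · exact absurd ⟨j, ha⟩ (not_isAnchor_concat hDn (by simp))
    · exact hδ.anchor_color ν h i j ha
  · refine pairwise_concat (anchor_order_recode hδ.anchor_order fun i c h =>
      (isAnchor_concat_one hDn).1 h) fun ν hν i j hi hj => ?_
    exact absurd hj (not_isAnchor_concat hDn (by simp))

/-- The `join` step leads to a code: the node cut of `h` grows by `IsColoredPairing.join`. -/
theorem ValidCode.join {δ : List DecimalNumber} (hδ : ValidCode δ) {h : List ℕ} {p K : ℕ}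
    {c : Color} (hh : h ≠ []) (hD : ⟨h ++ [p], c⟩ ∈ δ) (hfit : Fit δ h p c)
    (hK : ∀ q, (∃ ν ∈ δ, h ++ [q] <+: ν.digits) ↔ 1 ≤ q ∧ q ≤ K) :
    ValidCode (recode (h ++ [p]) ⟨h ++ [p], .blue⟩ δ ++ [⟨h ++ [K + 1], .red⟩]) := by
  have hb : IsBranchHead δ h := isBranchHead_of_prefix hh hD List.prefix_rfl
  have hpos := positiveDigits_nodeCut hδ hb hK
  have hK2 := (hδ.cut h hb).two_le hpos
  have hmem : ∀ ν ∈ recode (h ++ [p]) ⟨h ++ [p], .blue⟩ δ ++ [⟨h ++ [K + 1], .red⟩],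
      ν = ⟨h ++ [p], .blue⟩ ∨ ν = ⟨h ++ [K + 1], .red⟩ ∨ (ν ∈ δ ∧ ν.digits ≠ h ++ [p]) := by
    intro ν hν
    rcases List.mem_append.1 hν with hν | hν
    · rcases mem_recode.1 hν with ⟨h, _⟩ | h
      · exact Or.inl h
      · exact Or.inr (Or.inr h)
    · simp at hν; exact Or.inr (Or.inl hν)
  -- the digit `K + 1` is not used after `h`
  have hnew : ∀ ν ∈ δ, Incomparable ν.digits (h ++ [K + 1]) := by
    intro ν hν
    constructor
    · intro hp
      rcases List.prefix_concat_iff.1 hp with e | hp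
      · have := (hK (K + 1)).1 ⟨ν, hν, by rw [e]⟩
        omega
      · have := eq_of_prefixFree hδ.prefixFree hν hD (hp.trans (List.prefix_append _ _))
        subst this
        have := hp.length_le
        simp at this
    · intro hp
      have := (hK (K + 1)).1 ⟨ν, hν, hp⟩
      omega
  refine ⟨?_, ?_, ?_, ?_, ?_, ?_, ?_⟩
  · intro ν hν
    rcases hmem ν hν with rfl | rfl | ⟨h, _⟩
    · simp
    · simp
    · exact hδ.ne_nil ν h
  · intro ν hν d hd
    rcases hmem ν hν with rfl | rfl | ⟨h, _⟩
    · exact hδ.pos _ hD d hd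
    · rcases List.mem_append.1 hd with hd | hd
      · exact hδ.pos _ hD d (List.mem_append_left _ hd)
      · simp at hd; omega
    · exact hδ.pos ν h d hd
  · refine pairwise_concat (prefixFree_recode hδ.prefixFree fun ν hν h =>
      incomparable_of_mem hδ hD hν h) fun ν hν => ?_
    rcases mem_recode.1 hν with ⟨rfl, _⟩ | ⟨hν, _⟩
    · exact hnew ⟨h ++ [p], c⟩ hD
    · exact hnew ν hν
  · intro g hg
    have hgn := hg.ne_nil
    rw [nodeCut_join hδ hh hD hK2 g]
    split_ifs with h1
    · exact (hδ.cut h hb).join ((leaf_mem_nodeCut hh).2 hD) ((fit_iff_cutFit hh p c).1 hfit) hpos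
    · apply hδ.cut
      obtain ⟨ν, hν, ⟨_, hp⟩, hne⟩ := hg
      rcases hmem ν hν with rfl | rfl | ⟨h, _⟩
      · exact ⟨_, hD, ⟨hgn, hp⟩, hne⟩
      · rcases List.prefix_concat_iff.1 hp with e | hp
        · exact absurd e.symm hne
        · refine ⟨_, hD, ⟨hgn, hp.trans (List.prefix_append _ _)⟩, fun e => ?_⟩
          have := hp.length_le
          rw [← e] at this
          simp at this
      · exact ⟨ν, h, ⟨hgn, hp⟩, hne⟩
  · obtain ⟨m, hm⟩ := hδ.labels
    refine ⟨m, fun i => ?_⟩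
    rw [isBlockLabel_append_of_head (μ := ⟨h ++ [p], .blue⟩)
      (mem_recode.2 (Or.inl ⟨rfl, ⟨h ++ [p], c⟩, hD, rfl⟩))
      (by simp only [head?_append_of_ne_nil hh]), isBlockLabel_recode (D := h ++ [p]) rfl, hm]
  · intro ν hν i j ha
    rcases hmem ν hν with rfl | rfl | ⟨h', _⟩
    · simp [(anchorWith_pos hh ha).1]
    · exact absurd ⟨j, ha⟩ (not_isAnchor_concat hh (by omega))
    · exact hδ.anchor_color ν h' i j ha
  · refine pairwise_concat (anchor_order_recode hδ.anchor_order fun i c h => h)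
      fun ν hν i j hi hj => ?_
    exact absurd hj (not_isAnchor_concat hh (by omega))

theorem ValidCode.step {δ δ' : List DecimalNumber} (hδ : ValidCode δ) {D : Option (List ℕ)}
    (h : CodeStep δ D δ') : ValidCode δ' := by
  cases h with
  | append M hM => exact hδ.append hM
  | pair D c hD hfit => exact hδ.pair hD hfit
  | join h p c K hh hD hfit hK => exact hδ.join hh hD hfit hK

/-! ### The growth of a code is injective -/

/-- In a colored pairing sequence the digits of the blues are smaller than those of the reds. -/
theorem IsColoredPairing.blue_lt_red {s : List (ℕ × Mark)} (h : IsColoredPairing s) {p q : ℕ}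
    (hp : (p, Mark.leaf .red) ∈ s) (hq : (q, Mark.leaf .blue) ∈ s) : q < p := by
  have hb := (IsColoredPairing.blueThenRed h).sorted
  obtain ⟨K, hK⟩ := h.positives
  change positiveDigits _ = _ at hK
  obtain ⟨s₁, s₂, rfl⟩ := List.append_of_mem hp
  have ec : cutColors (s₁ ++ (p, Mark.leaf .red) :: s₂) =
      cutColors s₁ ++ .red :: cutColors s₂ := by simp [cutColors, Mark.color?]
  have ep : positiveDigits (s₁ ++ (p, Mark.leaf .red) :: s₂) =
      positiveDigits s₁ ++ p :: positiveDigits s₂ := by simp [positiveDigits]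
  rw [ec] at hb
  have hs : (positiveDigits s₁ ++ p :: positiveDigits s₂).Pairwise (· < ·) := by
    rw [← ep, hK]; exact List.pairwise_lt_range'
  simp only [List.mem_append, List.mem_cons, Prod.mk.injEq, Mark.leaf.injEq, reduceCtorEq,
    and_false, false_or] at hq
  rcases hq with hq | hq
  · exact (List.pairwise_append.1 hs).2.2 q (mem_positiveDigits.2 ⟨_, hq, by simp⟩) p (by simp)
  · have := (List.pairwise_cons.1 (List.pairwise_append.1 hb).2.1).1 .blue
      (mem_cutColors.2 ⟨q, hq⟩) rfl
    simp at this

theorem ValidCode.color_ne_black {δ : List DecimalNumber} (hδ : ValidCode δ) {h : List ℕ} {p : ℕ}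
    {c : Color} (hh : h ≠ []) (hD : ⟨h ++ [p], c⟩ ∈ δ) : c ≠ .black := by
  rintro rfl
  have hb : IsBranchHead δ h := isBranchHead_of_prefix hh hD List.prefix_rfl
  exact (IsColoredPairing.blueThenRed (hδ.cut h hb)).not_black
    (mem_cutColors.2 ⟨p, (leaf_mem_nodeCut hh).2 hD⟩)

theorem ValidCode.blue_lt_red {δ : List DecimalNumber} (hδ : ValidCode δ) {h : List ℕ} {p q : ℕ}
    (hh : h ≠ []) (hp : ⟨h ++ [p], .red⟩ ∈ δ) (hq : ⟨h ++ [q], .blue⟩ ∈ δ) : q < p :=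
  (hδ.cut h (isBranchHead_of_prefix hh hp List.prefix_rfl)).blue_lt_red
    ((leaf_mem_nodeCut hh).2 hp) ((leaf_mem_nodeCut hh).2 hq)

theorem ValidCode.eq_of_digits {δ : List DecimalNumber} (hδ : ValidCode δ) {ν μ : DecimalNumber}
    (hν : ν ∈ δ) (hμ : μ ∈ δ) (h : ν.digits = μ.digits) : ν = μ :=
  eq_of_prefixFree hδ.prefixFree hν hμ (by rw [h])

/-- The code before the `pair` step is recovered from the code after it, the digits of the friend
and its former color. -/
theorem recode_pair_inverse {δ : List DecimalNumber} (hδ : ValidCode δ) {D : List ℕ} {c : Color}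
    (hD : ⟨D, c⟩ ∈ δ) :
    recode (D ++ [1]) ⟨D, c⟩ (recode D ⟨D ++ [1], .blue⟩ δ) = δ := by
  apply recode_recode (μ := ⟨D ++ [1], .blue⟩)
  · intro ν hν e
    exact hδ.eq_of_digits hν hD e
  · intro ν hν e
    have := eq_of_prefixFree hδ.prefixFree hD hν (by rw [e]; exact List.prefix_append _ _)
    rw [← this]

/-- The code before the `join` step is recovered from the code after it, the digits of the friend
and its former color. -/
theorem recode_join_inverse {δ : List DecimalNumber} (hδ : ValidCode δ) {D : List ℕ} {c : Color}
    (hD : ⟨D, c⟩ ∈ δ) :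
    recode D ⟨D, c⟩ (recode D ⟨D, .blue⟩ δ) = δ := by
  apply recode_recode (μ := ⟨D, .blue⟩)
  · intro ν hν e
    exact hδ.eq_of_digits hν hD e
  · intro ν hν e
    exact e

/-- Two codes with the same result of the `pair` step at `D = h.p` cannot have a blue `D` and a
red `D`, respectively. In the second code all the blues with head `h` come before `p`, and the
other entries of the two codes are the same; so in the first code `p` is the last blue with head
`h`, and the new value would have joined its family. -/
theorem pair_color_aux {δ₁ δ₂ : List DecimalNumber} (h₂ : ValidCode δ₂) {D : List ℕ}
    (hD₂ : ⟨D, .red⟩ ∈ δ₂)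
    (hfit : ∀ h p, h ≠ [] → D = h ++ [p] → ¬ Fit δ₁ h p .blue)
    (e : recode D ⟨D ++ [1], .blue⟩ δ₁ = recode D ⟨D ++ [1], .blue⟩ δ₂)
    {h : List ℕ} {p : ℕ} (hh : h ≠ []) (hDh : D = h ++ [p]) : False := by
  have hf := hfit h p hh hDh
  apply hf
  left
  refine ⟨rfl, fun q hq => ?_⟩
  by_contra hlt
  have hne : h ++ [q] ≠ D := by
    rw [hDh]; intro e; simp at e; omega
  have h1 : (⟨h ++ [q], .blue⟩ : DecimalNumber) ∈ recode D ⟨D ++ [1], .blue⟩ δ₁ :=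
    mem_recode.2 (Or.inr ⟨hq, hne⟩)
  rw [e, mem_recode_of_ne hne] at h1
  · have := h₂.blue_lt_red hh (hDh ▸ hD₂) h1
    omega
  · intro e
    injection e with e _
    have := congrArg List.length e
    rw [hDh] at this
    simp at this

/-- The result of the `pair` step determines the former color of the friend: black for a single
digit, and otherwise by `pair_color_aux`. -/
theorem pair_color_eq {δ₁ δ₂ : List DecimalNumber} (h₁ : ValidCode δ₁) (h₂ : ValidCode δ₂)
    {D : List ℕ} {c₁ c₂ : Color} (hD₁ : ⟨D, c₁⟩ ∈ δ₁) (hD₂ : ⟨D, c₂⟩ ∈ δ₂)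
    (hfit₁ : ∀ h p, h ≠ [] → D = h ++ [p] → ¬ Fit δ₁ h p c₁)
    (hfit₂ : ∀ h p, h ≠ [] → D = h ++ [p] → ¬ Fit δ₂ h p c₂)
    (e : recode D ⟨D ++ [1], .blue⟩ δ₁ = recode D ⟨D ++ [1], .blue⟩ δ₂) : c₁ = c₂ := by
  rcases List.eq_nil_or_concat' D with rfl | ⟨h, p, rfl⟩
  · exact absurd rfl (h₁.ne_nil _ hD₁)
  -- the entry of a single digit is an anchor, and therefore black
  by_cases hh : h = []
  · subst hh
    have e1 := h₁.anchor_color _ hD₁ p 0 rfl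
    have e2 := h₂.anchor_color _ hD₂ p 0 rfl
    exact e1.trans e2.symm
  · have n1 := h₁.color_ne_black hh hD₁
    have n2 := h₂.color_ne_black hh hD₂
    cases c₁ <;> cases c₂ <;> simp at n1 n2 ⊢
    · exact pair_color_aux h₁ hD₁ hfit₂ e.symm hh rfl
    · exact pair_color_aux h₂ hD₂ hfit₁ e hh rfl

/-- After the `join` step the friend is the last blue with head `h`. -/
theorem join_le_aux {δ₁ δ₂ : List DecimalNumber} (h₁ : ValidCode δ₁)
    {h : List ℕ} (hh : h ≠ []) {p₁ p₂ : ℕ} {c₁ c₂ : Color} (hD₁ : ⟨h ++ [p₁], c₁⟩ ∈ δ₁)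
    (hD₂ : ⟨h ++ [p₂], c₂⟩ ∈ δ₂) (hfit₁ : Fit δ₁ h p₁ c₁)
    (e : recode (h ++ [p₁]) ⟨h ++ [p₁], .blue⟩ δ₁ = recode (h ++ [p₂]) ⟨h ++ [p₂], .blue⟩ δ₂) :
    p₂ ≤ p₁ := by
  have hm : (⟨h ++ [p₂], .blue⟩ : DecimalNumber) ∈
      recode (h ++ [p₁]) ⟨h ++ [p₁], .blue⟩ δ₁ := by
    rw [e]; exact mem_recode.2 (Or.inl ⟨rfl, _, hD₂, rfl⟩)
  rcases mem_recode.1 hm with ⟨e1, _⟩ | ⟨h1, _⟩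
  · injection e1 with e1 _
    simp at e1; omega
  · rcases hfit₁ with ⟨rfl, hf⟩ | ⟨rfl, hf⟩
    · exact hf _ h1
    · exact (h₁.blue_lt_red hh hD₁ h1).le

/-- Every node cut contains a red. -/
theorem ValidCode.exists_red {δ : List DecimalNumber} (hδ : ValidCode δ) {h : List ℕ}
    (hh : h ≠ []) {p : ℕ} {c : Color} (hD : ⟨h ++ [p], c⟩ ∈ δ) : ∃ q, ⟨h ++ [q], .red⟩ ∈ δ := by
  have hb : IsBranchHead δ h := isBranchHead_of_prefix hh hD List.prefix_rfl
  obtain ⟨q, hq⟩ := mem_cutColors.1 (IsColoredPairing.blueThenRed (hδ.cut h hb)).red_mem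
  exact ⟨q, (leaf_mem_nodeCut hh).1 hq⟩

/-- Two codes with the same result of the `join` step cannot have a blue and a red friend,
respectively. The first code contains another red with head `h`, which is also in the second one,
so that the friend is not the only red there. -/
theorem join_color_aux {δ₁ δ₂ : List DecimalNumber} (h₁ : ValidCode δ₁)
    {h : List ℕ} (hh : h ≠ []) {p : ℕ} (hD₁ : ⟨h ++ [p], .blue⟩ ∈ δ₁)
    (hfit₂ : Fit δ₂ h p .red)
    (e : recode (h ++ [p]) ⟨h ++ [p], .blue⟩ δ₁ = recode (h ++ [p]) ⟨h ++ [p], .blue⟩ δ₂) :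
    False := by
  obtain ⟨q, hq⟩ := h₁.exists_red hh hD₁
  have hqp : q ≠ p := by
    rintro rfl
    have := h₁.eq_of_digits hD₁ hq rfl
    injection this with _ this
    simp at this
  have hne : h ++ [q] ≠ h ++ [p] := by simpa using hqp
  have h1 : (⟨h ++ [q], .red⟩ : DecimalNumber) ∈ recode (h ++ [p]) ⟨h ++ [p], .blue⟩ δ₁ :=
    mem_recode.2 (Or.inr ⟨hq, hne⟩)
  rw [e, mem_recode_of_ne hne (by simp)] at h1
  rcases hfit₂ with ⟨h2, _⟩ | ⟨_, hf⟩
  · simp at h2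
  · exact hqp (hf q h1)

/-- The code after the insertion of a value determines the code before it and the digits of the
friend. -/
theorem codeStep_injective {δ₁ δ₂ δ' : List DecimalNumber} {D₁ D₂ : Option (List ℕ)}
    (h₁ : ValidCode δ₁) (h₂ : ValidCode δ₂) (s₁ : CodeStep δ₁ D₁ δ') (s₂ : CodeStep δ₂ D₂ δ') :
    δ₁ = δ₂ ∧ D₁ = D₂ := by
  -- the results of the `pair` and `join` steps differ in the last digit of the last entry, which
  -- is `2`, respectively `K + 1` with `K` at least `2`
  have hpj : ∀ {δ₁ δ₂ : List DecimalNumber} {D h : List ℕ} {p K : ℕ} {c₂ : Color},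
      ValidCode δ₂ → h ≠ [] →
      ⟨h ++ [p], c₂⟩ ∈ δ₂ → (∀ q, (∃ ν ∈ δ₂, h ++ [q] <+: ν.digits) ↔ 1 ≤ q ∧ q ≤ K) →
      recode D ⟨D ++ [1], .blue⟩ δ₁ ++ [⟨D ++ [2], .red⟩] =
        recode (h ++ [p]) ⟨h ++ [p], .blue⟩ δ₂ ++ [⟨h ++ [K + 1], .red⟩] → False := by
    intro δ₁ δ₂ D h p K c₂ h₂ hh hD₂ hK e
    have hb : IsBranchHead δ₂ h := isBranchHead_of_prefix hh hD₂ List.prefix_rfl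
    have hK2 := (h₂.cut h hb).two_le (positiveDigits_nodeCut h₂ hb hK)
    have := (List.append_inj' e rfl).2
    simp only [List.cons.injEq, DecimalNumber.mk.injEq, and_true] at this
    have := (List.append_inj' this rfl).2
    simp at this
    omega
  generalize hδ' : δ' = δ'' at s₂
  cases s₁ with
  | append M₁ hM₁ =>
    cases s₂ with
    | append M₂ hM₂ => exact ⟨(List.append_inj' hδ' rfl).1, rfl⟩
    | pair D₂ c₂ hD₂ hfit₂ => have := (List.append_inj' hδ' rfl).2; simp at this
    | join h₂ p₂ c₂ K₂ hh₂ hD₂ hfit₂ hK₂ => have := (List.append_inj' hδ' rfl).2; simp at this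
  | pair D₁ c₁ hD₁ hfit₁ =>
    cases s₂ with
    | append M₂ hM₂ => have := (List.append_inj' hδ' rfl).2; simp at this
    | pair D₂ c₂ hD₂ hfit₂ =>
      obtain ⟨e1, e2⟩ := List.append_inj' hδ' rfl
      simp at e2
      subst e2
      have ec := pair_color_eq h₁ h₂ hD₁ hD₂ hfit₁ hfit₂ e1
      subst ec
      refine ⟨?_, rfl⟩
      rw [← recode_pair_inverse h₁ hD₁, e1, recode_pair_inverse h₂ hD₂]
    | join h₂' p₂ c₂ K₂ hh₂ hD₂ hfit₂ hK₂ => exact (hpj h₂ hh₂ hD₂ hK₂ hδ').elim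
  | join h₁' p₁ c₁ K₁ hh₁ hD₁ hfit₁ hK₁ =>
    cases s₂ with
    | append M₂ hM₂ => have := (List.append_inj' hδ' rfl).2; simp at this
    | pair D₂ c₂ hD₂ hfit₂ => exact (hpj h₁ hh₁ hD₁ hK₁ hδ'.symm).elim
    | join h₂' p₂ c₂ K₂ hh₂ hD₂ hfit₂ hK₂ =>
      obtain ⟨e1, e2⟩ := List.append_inj' hδ' rfl
      simp only [List.cons.injEq, DecimalNumber.mk.injEq, and_true] at e2
      have e3 := (List.append_inj' e2 rfl).1
      subst e3
      have hp : p₁ = p₂ := le_antisymm (join_le_aux h₂ hh₁ hD₂ hD₁ hfit₂ e1.symm)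
        (join_le_aux h₁ hh₁ hD₁ hD₂ hfit₁ e1)
      subst hp
      have ec : c₁ = c₂ := by
        have n1 := h₁.color_ne_black hh₁ hD₁
        have n2 := h₂.color_ne_black hh₁ hD₂
        cases c₁ <;> cases c₂ <;> simp at n1 n2 ⊢
        · exact join_color_aux h₂ hh₁ hD₂ hfit₁ e1.symm
        · exact join_color_aux h₁ hh₁ hD₁ hfit₂ e1
      subst ec
      refine ⟨?_, rfl⟩
      rw [← recode_join_inverse h₁ hD₁, e1, recode_join_inverse h₂ hD₂]

/-! ### Every code grows from a shorter one -/

theorem ValidCode.prefixFree_left {X : List DecimalNumber} {ν : DecimalNumber}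
    (h : ValidCode (X ++ [ν])) : X.Pairwise fun ν μ => Incomparable ν.digits μ.digits :=
  (List.pairwise_append.1 h.prefixFree).1

theorem ValidCode.incomparable_last {X : List DecimalNumber} {ν : DecimalNumber}
    (h : ValidCode (X ++ [ν])) {μ : DecimalNumber} (hμ : μ ∈ X) :
    Incomparable μ.digits ν.digits :=
  (List.pairwise_append.1 h.prefixFree).2.2 μ hμ ν (by simp)

/-- A code whose last entry has a single digit arises by the `append` step. -/
theorem ValidCode.exists_append {X : List DecimalNumber} {i : ℕ} {c : Color}
    (h : ValidCode (X ++ [⟨[i], c⟩])) :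
    ValidCode X ∧ CodeStep X none (X ++ [⟨[i], c⟩]) := by
  have hc : c = .black := h.anchor_color ⟨[i], c⟩ (by simp) i 0 rfl
  subst hc
  have hne : ∀ ν ∈ X, ν.digits ≠ [] := fun ν hν => h.ne_nil ν (by simp [hν])
  have hnot : ¬ IsBlockLabel X i := by
    rintro ⟨ν, hν, e⟩
    apply (h.incomparable_last hν).2
    match hd : ν.digits with
    | [] => exact absurd hd (hne ν hν)
    | a :: l => rw [hd] at e; simp at e; simp [e]
  -- the last entry is not visible in the node cuts
  have hcut : ∀ g, IsBranchHead X g → IsColoredPairing (nodeCut X g) := by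
    intro g hg
    have h1 := h.cut g (by
      obtain ⟨ν, hν, h1, h2⟩ := hg
      exact ⟨ν, by simp [hν], h1, h2⟩)
    have hc : cutEntry g ⟨[i], .black⟩ = none := by
      cases e : cutEntry g ⟨[i], .black⟩ with
      | none => rfl
      | some x =>
        have := (prefix_of_cutEntry e).length_le
        simp at this
        exact absurd this hg.ne_nil
    rw [nodeCut_append, nodeCut_singleton, hc] at h1
    simpa using h1
  obtain ⟨M, hM⟩ := h.labels
  have hi : 1 ≤ i ∧ i ≤ M := (hM i).1 ⟨⟨[i], .black⟩, by simp, rfl⟩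
  have hX : ∀ j, IsBlockLabel X j ↔ 1 ≤ j ∧ j ≤ M ∧ j ≠ i := by
    intro j
    have := hM j
    rw [isBlockLabel_append] at this
    simp only [List.head?_cons, Option.some.injEq] at this
    constructor
    · intro hj
      have h1 := this.1 (Or.inl hj)
      exact ⟨h1.1, h1.2, fun e => hnot (e ▸ hj)⟩
    · rintro ⟨h1, h2, h3⟩
      exact (this.2 ⟨h1, h2⟩).resolve_right fun e => h3 e.symm
  -- the anchors are in order, so the last label is the largest
  have hmax : ∀ j, IsBlockLabel X j → j < i := by
    intro j hj
    obtain ⟨ν, hν, ha⟩ := exists_anchor hne hcut hj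
    exact (List.pairwise_append.1 h.anchor_order).2.2 ν hν ⟨[i], .black⟩ (by simp) j i ha ⟨0, rfl⟩
  have hiM : i = M := by
    by_contra hne
    have := hmax M ((hX M).2 ⟨by omega, le_rfl, fun e => hne e.symm⟩)
    omega
  subst hiM
  have hlab : ∀ j, IsBlockLabel X j ↔ 1 ≤ j ∧ j ≤ i - 1 := by
    intro j
    rw [hX]
    omega
  refine ⟨⟨hne, fun ν hν => h.pos ν (by simp [hν]), h.prefixFree_left, hcut, ⟨_, hlab⟩,
    fun ν hν => h.anchor_color ν (by simp [hν]), (List.pairwise_append.1 h.anchor_order).1⟩, ?_⟩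
  have := CodeStep.append (δ := X) (i - 1) hlab
  rwa [Nat.sub_add_cancel hi.1] at this

/-- A code with last entry `D.2.r`, in which `D.1.b` is the only other entry with head `D`, arises
by the `pair` step. The former entry `D.c` of the friend is black if it is a singlet block, and
otherwise given by `IsColoredPairing.exists_pair` for the node cut of the head one digit shorter. -/
theorem ValidCode.exists_pair {X : List DecimalNumber} {D : List ℕ} (hD : D ≠ [])
    (h : ValidCode (X ++ [⟨D ++ [2], .red⟩])) (hX : ⟨D ++ [1], .blue⟩ ∈ X)
    (honly : ∀ ν ∈ X, D <+: ν.digits → ν.digits = D ++ [1]) :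
    ∃ δ, ValidCode δ ∧ CodeStep δ (some D) (X ++ [⟨D ++ [2], .red⟩]) := by
  have hpf := h.prefixFree_left
  have hinc : ∀ ν ∈ X, ν.digits ≠ D ++ [1] → Incomparable ν.digits D := by
    intro ν hν hne
    refine ⟨fun hp => ?_, fun hp => hne (honly ν hν hp)⟩
    exact (h.incomparable_last hν).1 (hp.trans (List.prefix_append _ _))
  -- the color of the friend is determined by the node cut
  obtain ⟨c, hc1, hc2, hc3⟩ : ∃ c : Color, (∀ i j, IsAnchorWith i j ⟨D, c⟩ →
      c = if j = 0 then .black else .blue) ∧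
      (∀ g p, g ≠ [] → D = g ++ [p] → IsColoredPairing (remark p (.leaf c) (nodeCut X g))) ∧
      (∀ g p, g ≠ [] → D = g ++ [p] → ¬ CutFit (remark p (.leaf c) (nodeCut X g)) p c) := by
    rcases List.eq_nil_or_concat' D with rfl | ⟨g, p, rfl⟩
    · exact absurd rfl hD
    by_cases hg : g = []
    · subst hg
      refine ⟨.black, fun i j ha => ?_, fun g p' hg e => ?_, fun g p' hg e => ?_⟩
      · unfold IsAnchorWith at ha
        simp at ha
        simp [ha.2]
      · exact absurd (List.append_inj' e rfl).1.symm hg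
      · exact absurd (List.append_inj' e rfl).1.symm hg
    · have hb : IsBranchHead (X ++ [⟨g ++ [p] ++ [2], .red⟩]) g :=
        isBranchHead_of_prefix (ν := ⟨g ++ [p] ++ [2], .red⟩) (q := p) hg (by simp)
          (List.prefix_append _ _)
      have hcut := h.cut g hb
      rw [nodeCut_append, nodeCut_singleton, cutEntry_append_pair_two hg] at hcut
      obtain ⟨c, h1, h2, h3, h4, h5, h6⟩ := hcut.exists_pair
      refine ⟨c, fun i j ha => ?_, fun g' p' _ e => ?_, fun g' p' _ e => ?_⟩
      · have := anchorWith_pos hg ha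
        simp [this.1, h1 this.2]
      · have e' := List.append_inj' e rfl
        simp at e'
        obtain ⟨rfl, rfl⟩ := e'
        exact h5
      · have e' := List.append_inj' e rfl
        simp at e'
        obtain ⟨rfl, rfl⟩ := e'
        exact h6
  -- the node cuts of the other heads do not see the step
  have hcut1 : ∀ g, g ≠ [] → g ≠ D → g ≠ D.dropLast →
      nodeCut (recode (D ++ [1]) ⟨D, c⟩ X) g = nodeCut (X ++ [⟨D ++ [2], .red⟩]) g := by
    intro g hg h1 h2
    have h2' : ∀ k, D ≠ g ++ [k] := fun k e => h2 (by rw [e, List.dropLast_concat])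
    rw [nodeCut_recode_of_eq fun c' _ => (cutEntry_append_one h1 h2' c' c).symm,
      nodeCut_append, nodeCut_singleton, cutEntry_append_two h1 h2']
    simp
  -- in the node cut of the head one digit shorter, `p.1` becomes `p.c`
  have hcut2 : ∀ g p, g ≠ [] → D = g ++ [p] →
      nodeCut (recode (D ++ [1]) ⟨D, c⟩ X) g = remark p (.leaf c) (nodeCut X g) := by
    rintro g p hg rfl
    unfold nodeCut recode remark
    rw [List.filterMap_map, List.map_filterMap]
    apply List.filterMap_congr
    intro ν hν
    by_cases e : ν.digits = g ++ [p] ++ [1]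
    · simp only [Function.comp, e, if_true]
      have : ν = ⟨g ++ [p] ++ [1], ν.color⟩ := by rw [← e]
      rw [this, cutEntry_append_singleton hg, cutEntry_append_pair_one hg]
      simp
    · simp only [Function.comp, e, if_false]
      cases hc : cutEntry g ν with
      | none => rfl
      | some x =>
        have hx : x.1 ≠ p := by
          rintro rfl
          exact e (honly ν hν (prefix_of_cutEntry hc))
        simp [hx]
  have hmem : ∀ ν ∈ recode (D ++ [1]) ⟨D, c⟩ X, ν = ⟨D, c⟩ ∨ (ν ∈ X ∧ ν.digits ≠ D ++ [1]) := by
    intro ν hν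
    rcases mem_recode.1 hν with ⟨h, _⟩ | h
    · exact Or.inl h
    · exact Or.inr h
  have hDmem : (⟨D, c⟩ : DecimalNumber) ∈ recode (D ++ [1]) ⟨D, c⟩ X :=
    mem_recode.2 (Or.inl ⟨rfl, _, hX, rfl⟩)
  have hvalid : ValidCode (recode (D ++ [1]) ⟨D, c⟩ X) := by
    refine ⟨?_, ?_, prefixFree_recode hpf hinc, ?_, ?_, ?_, ?_⟩
    · intro ν hν
      rcases hmem ν hν with rfl | ⟨h', _⟩
      · exact hD
      · exact h.ne_nil ν (by simp [h'])
    · intro ν hν d hd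
      rcases hmem ν hν with rfl | ⟨h', _⟩
      · exact h.pos ⟨D ++ [1], .blue⟩ (by simp [hX]) d (List.mem_append_left _ hd)
      · exact h.pos ν (by simp [h']) d hd
    · intro g hg
      have hgn := hg.ne_nil
      have hgD : g ≠ D := by
        rintro rfl
        obtain ⟨ν, hν, ⟨_, hp⟩, hne⟩ := hg
        rcases hmem ν hν with rfl | ⟨h', h''⟩
        · exact hne rfl
        · exact h'' (honly ν h' hp)
      by_cases h2 : g = D.dropLast
      · have e : D = g ++ [D.getLast hD] := by rw [h2, List.dropLast_append_getLast]
        rw [hcut2 g _ hgn e]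
        exact hc2 g _ hgn e
      · rw [hcut1 g hgn hgD h2]
        apply h.cut
        obtain ⟨ν, hν, ⟨_, hp⟩, hne⟩ := hg
        rcases hmem ν hν with rfl | ⟨h', _⟩
        · refine ⟨⟨D ++ [1], .blue⟩, by simp [hX], ⟨hgn, hp.trans (List.prefix_append _ _)⟩, ?_⟩
          intro e
          have := hp.length_le
          rw [← e] at this
          simp at this
        · exact ⟨ν, by simp [h'], ⟨hgn, hp⟩, hne⟩
    · obtain ⟨m, hm⟩ := h.labels
      refine ⟨m, fun i => ?_⟩
      rw [isBlockLabel_recode (by simp only [head?_append_of_ne_nil hD]), ← hm,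
        isBlockLabel_append_of_head hX (by simp only [head?_append_of_ne_nil hD])]
    · intro ν hν i j ha
      rcases hmem ν hν with rfl | ⟨h', _⟩
      · exact hc1 i j ha
      · exact h.anchor_color ν (by simp [h']) i j ha
    · exact anchor_order_recode (List.pairwise_append.1 h.anchor_order).1
        fun i c' ha => (isAnchor_concat_one hD).2 ha
  refine ⟨_, hvalid, ?_⟩
  have hstep := CodeStep.pair (δ := recode (D ++ [1]) ⟨D, c⟩ X) D c hDmem (by
    intro g p hg e
    rw [fit_iff_cutFit hg, hcut2 g p hg e]
    exact hc3 g p hg e)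
  -- the `pair` step at `D` leads back to the given code
  have hinv : recode D ⟨D ++ [1], .blue⟩ (recode (D ++ [1]) ⟨D, c⟩ X) = X := by
    apply recode_recode (D := D ++ [1]) (μ := ⟨D, c⟩)
    · intro ν hν e
      exact eq_of_prefixFree hpf hν hX (by rw [e])
    · intro ν hν e
      exact honly ν hν (by rw [e])
  rwa [hinv] at hstep

/-- A code whose last entry `h.q.c` is preceded by at least two elements in the node cut of `h`
arises by the `join` step. -/
theorem ValidCode.exists_join {X : List DecimalNumber} {h : List ℕ} {q : ℕ} {c : Color}
    (hh : h ≠ []) (hv : ValidCode (X ++ [⟨h ++ [q], c⟩])) (hlen : 2 ≤ (nodeCut X h).length) :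
    ∃ δ D, ValidCode δ ∧ CodeStep δ (some D) (X ++ [⟨h ++ [q], c⟩]) := by
  have hpf := hv.prefixFree_left
  have hb : IsBranchHead (X ++ [⟨h ++ [q], c⟩]) h :=
    isBranchHead_of_prefix (ν := ⟨h ++ [q], c⟩) (q := q) hh (by simp) List.prefix_rfl
  have hcut := hv.cut h hb
  have hcute : nodeCut (X ++ [⟨h ++ [q], c⟩]) h = nodeCut X h ++ [(q, .leaf c)] := by
    rw [nodeCut_append, nodeCut_singleton, cutEntry_append_singleton hh]; rfl
  rw [hcute] at hcut
  -- the friend, and its former color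
  obtain ⟨p, c', hp, hpc, hs, hfit⟩ := hcut.exists_join (fun k hk => by
    have := two_mem_nodeCut (h := h) hv.cut (by rw [hcute]; exact List.mem_append_left _ hk)
    rw [hcute] at this
    simpa using this) hlen
  have hD : (⟨h ++ [p], .blue⟩ : DecimalNumber) ∈ X := (leaf_mem_nodeCut hh).1 hp
  obtain ⟨K', hK'⟩ := hcut.positives
  change positiveDigits _ = _ at hK'
  rw [positiveDigits_append] at hK'
  -- the last digit `q` is the largest one which follows `h`
  obtain ⟨K, rfl, hK, rfl⟩ : ∃ K, K' = K + 1 ∧ positiveDigits (nodeCut X h) = List.range' 1 K ∧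
      q = K + 1 := by
    match K' with
    | 0 => simp [positiveDigits] at hK'
    | K + 1 =>
      rw [List.range'_concat] at hK'
      have e := List.append_inj' hK' rfl
      refine ⟨K, rfl, e.1, ?_⟩
      have e2 := e.2
      simp [positiveDigits] at e2
      omega
  -- a blue with the largest digit would be larger than a red
  obtain rfl : c = .red := by
    have hn := (IsColoredPairing.blueThenRed hcut).not_black
    have hb1 := hcut.blue_lt_red (p := K + 1) (q := K + 1)
    obtain ⟨r, hr⟩ := mem_cutColors.1 (IsColoredPairing.blueThenRed hcut).red_mem
    cases c with
    | red => rfl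
    | black => exact absurd (mem_cutColors.2 ⟨K + 1, by simp⟩) hn
    | blue =>
      have h1 := hcut.blue_lt_red hr (q := K + 1) (by simp)
      have h2 : r ∈ positiveDigits (nodeCut X h) :=
        mem_positiveDigits.2 ⟨.leaf .red, by simpa using hr, by simp⟩
      rw [hK, List.mem_range'_1] at h2
      omega
  -- the node cuts after the removal of the last entry, at `h` and elsewhere
  have hcutself : nodeCut (recode (h ++ [p]) ⟨h ++ [p], c'⟩ X) h =
      remark p (.leaf c') (nodeCut X h) :=
    nodeCut_recode_of_remark hh (cutEntry_append_singleton hh p _)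
      fun ν hν hp => by rw [← eq_of_prefixFree hpf hD hν hp]
  have hcutne : ∀ g, g ≠ h → nodeCut (recode (h ++ [p]) ⟨h ++ [p], c'⟩ X) g =
      nodeCut (X ++ [⟨h ++ [K + 1], .red⟩]) g := by
    intro g hg
    have h2 : ∀ k, h ++ [p] ≠ g ++ [k] := fun k e => hg (List.append_inj' e rfl).1.symm
    have hK2 : 2 ≤ K := by
      have := hs.two_le (K := K) (by
        rw [positiveDigits_remark (by simp), hK]
        intro hm
        exact hcut.two_not_mem (List.mem_append_left _ hp) (List.mem_append_left _ hm))
      exact this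
    rw [nodeCut_recode_of_eq fun c _ => cutEntry_color h2 _ _, nodeCut_append, nodeCut_singleton,
      cutEntry_append_large hg (by omega)]
    simp
  have hmem : ∀ ν ∈ recode (h ++ [p]) ⟨h ++ [p], c'⟩ X,
      ν = ⟨h ++ [p], c'⟩ ∨ (ν ∈ X ∧ ν.digits ≠ h ++ [p]) := by
    intro ν hν
    rcases mem_recode.1 hν with ⟨h, _⟩ | h
    · exact Or.inl h
    · exact Or.inr h
  have hDmem : (⟨h ++ [p], c'⟩ : DecimalNumber) ∈ recode (h ++ [p]) ⟨h ++ [p], c'⟩ X :=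
    mem_recode.2 (Or.inl ⟨rfl, _, hD, rfl⟩)
  have hvalid : ValidCode (recode (h ++ [p]) ⟨h ++ [p], c'⟩ X) := by
    refine ⟨?_, ?_, ?_, ?_, ?_, ?_, ?_⟩
    · intro ν hν
      rcases hmem ν hν with rfl | ⟨h', _⟩
      · simp
      · exact hv.ne_nil ν (by simp [h'])
    · intro ν hν d hd
      rcases hmem ν hν with rfl | ⟨h', _⟩
      · exact hv.pos ⟨h ++ [p], .blue⟩ (by simp [hD]) d hd
      · exact hv.pos ν (by simp [h']) d hd
    · exact prefixFree_recode hpf fun ν hν hne =>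
        incomparable_of_prefixFree (μ := ⟨h ++ [p], .blue⟩) hpf hν hD hne
    · intro g hg
      by_cases hgh : g = h
      · subst hgh
        rw [hcutself]
        exact hs
      · rw [hcutne g hgh]
        apply hv.cut
        obtain ⟨ν, hν, hd, hne⟩ := hg
        rcases hmem ν hν with rfl | ⟨h', _⟩
        · exact ⟨⟨h ++ [p], .blue⟩, by simp [hD], hd, hne⟩
        · exact ⟨ν, by simp [h'], hd, hne⟩
    · obtain ⟨m, hm⟩ := hv.labels
      refine ⟨m, fun i => ?_⟩
      rw [isBlockLabel_recode (D := h ++ [p]) rfl, ← hm,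
        isBlockLabel_append_of_head hD (by simp only [head?_append_of_ne_nil hh])]
    · intro ν hν i j ha
      rcases hmem ν hν with rfl | ⟨h', _⟩
      · have := anchorWith_pos hh ha
        simp [this.1, hpc this.2]
      · exact hv.anchor_color ν (by simp [h']) i j ha
    · exact anchor_order_recode (List.pairwise_append.1 hv.anchor_order).1 fun i c' ha => ha
  refine ⟨_, h ++ [p], hvalid, ?_⟩
  have hpos : positiveDigits (nodeCut (recode (h ++ [p]) ⟨h ++ [p], c'⟩ X) h) =
      List.range' 1 K := by
    rw [hcutself, positiveDigits_remark (by simp), hK]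
    intro hm
    exact hcut.two_not_mem (List.mem_append_left _ hp) (List.mem_append_left _ hm)
  have hstep := CodeStep.join (δ := recode (h ++ [p]) ⟨h ++ [p], c'⟩ X) h p c' K hh hDmem (by
    rw [fit_iff_cutFit hh, hcutself]
    exact hfit) (by
    intro k
    rw [exists_prefix_iff hvalid.cut hh, hpos, List.mem_range'_1]
    omega)
  -- the `join` step leads back to the given code
  have hinv : recode (h ++ [p]) ⟨h ++ [p], .blue⟩ (recode (h ++ [p]) ⟨h ++ [p], c'⟩ X) = X := by
    apply recode_recode (D := h ++ [p]) (μ := ⟨h ++ [p], c'⟩)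
    · intro ν hν e
      exact eq_of_prefixFree hpf hν hD (by rw [e])
    · intro ν hν e
      exact e
  rwa [hinv] at hstep

/-- Every nonempty code arises from a code with one entry less. The kind of the step is read off
from the last entry: `append` for a single digit, and otherwise `pair` or `join` according to the
length of the node cut in which it is a leaf. -/
theorem exists_codeStep {X : List DecimalNumber} {ν : DecimalNumber} (h : ValidCode (X ++ [ν])) :
    ∃ δ D, ValidCode δ ∧ CodeStep δ D (X ++ [ν]) := by
  obtain ⟨D, c⟩ := ν
  rcases List.eq_nil_or_concat' D with rfl | ⟨g, q, rfl⟩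
  · exact absurd rfl (h.ne_nil ⟨[], c⟩ (by simp))
  by_cases hg : g = []
  · subst hg
    obtain ⟨h1, h2⟩ := ValidCode.exists_append (i := q) h
    exact ⟨X, none, h1, h2⟩
  have hb : IsBranchHead (X ++ [⟨g ++ [q], c⟩]) g :=
    isBranchHead_of_prefix (ν := ⟨g ++ [q], c⟩) (q := q) hg (by simp) List.prefix_rfl
  have hcut := h.cut g hb
  have hcute : nodeCut (X ++ [⟨g ++ [q], c⟩]) g = nodeCut X g ++ [(q, .leaf c)] := by
    rw [nodeCut_append, nodeCut_singleton, cutEntry_append_singleton hg]; rfl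
  rw [hcute] at hcut
  by_cases hlen : 2 ≤ (nodeCut X g).length
  · obtain ⟨δ, D, h1, h2⟩ := h.exists_join hg hlen
    exact ⟨δ, some D, h1, h2⟩
  -- only two entries in the node cut: they are `1.blue` and `2.red`
  have hbr := IsColoredPairing.blueThenRed hcut
  have h2 := blueThenRed_two_le hbr
  obtain ⟨K, hK⟩ := hcut.positives
  change positiveDigits _ = _ at hK
  have hK2 := hcut.two_le hK
  match hs : nodeCut X g with
  | [] =>
    rw [hs] at h2; simp [cutColors, Mark.color?] at h2
  | a :: b :: l => rw [hs] at hlen; simp at hlen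
  | [(p, m)] =>
    rw [hs] at hcut hbr h2 hK
    have hKle := congrArg List.length hK
    have hle : (positiveDigits ([(p, m)] ++ [(q, Mark.leaf c)])).length ≤ 2 := by
      unfold positiveDigits
      rw [List.length_map]
      exact List.length_filter_le _ _
    rw [List.length_range'] at hKle
    obtain rfl : K = 2 := by omega
    cases m with
    | one => simp [cutColors, Mark.color?] at h2
    | two => simp [cutColors, Mark.color?] at h2
    | leaf c' =>
      have e : p = 1 ∧ q = 2 := by
        simp [positiveDigits, List.range'] at hK
        exact hK
      obtain ⟨rfl, rfl⟩ := e
      have ecc : cutColors ([(1, Mark.leaf c')] ++ [(2, Mark.leaf c)]) = [c', c] := rfl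
      rw [ecc] at hbr
      have ecol : c' = .blue ∧ c = .red := by
        have h1 := hbr.sorted
        have h2 := hbr.blue_mem
        have h3 := hbr.red_mem
        cases c' <;> cases c <;> simp_all
      obtain ⟨rfl, rfl⟩ := ecol
      have h1mem : (⟨g ++ [1], .blue⟩ : DecimalNumber) ∈ X :=
        (leaf_mem_nodeCut hg).1 (by rw [hs]; simp)
      -- an entry with head `g` has `1` or `2` as its next digit, and then it is `g.1`, since
      -- `g.2` is the last entry
      obtain ⟨δ, h3, h4⟩ := ValidCode.exists_pair hg h h1mem (by
        intro ν hν hp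
        obtain ⟨t, ht⟩ := hp
        match t with
        | [] =>
          exfalso
          rw [List.append_nil] at ht
          exact (h.incomparable_last hν).1 (by rw [← ht]; exact List.prefix_append _ _)
        | a :: t =>
          have hpa : g ++ [a] <+: ν.digits := by rw [← ht]; exact ⟨t, by simp⟩
          have := (exists_prefix_iff h.cut hg a).1 ⟨ν, by simp [hν], hpa⟩
          rw [hcute, hs, hK, List.mem_range'_1] at this
          have ha : a = 1 ∨ a = 2 := by omega
          rcases ha with rfl | rfl
          · rw [← eq_of_prefixFree h.prefixFree_left h1mem hν hpa]
          · exact absurd hpa (h.incomparable_last hν).2)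
      exact ⟨δ, some g, h3, h4⟩

theorem CodeStep.length_eq {δ δ' : List DecimalNumber} {D : Option (List ℕ)}
    (h : CodeStep δ D δ') : δ'.length = δ.length + 1 := by
  cases h <;> simp [length_recode]

/-! ### Insertion before an element of a list -/

theorem insertBefore_of_not_mem {n m : ℕ} {l : List ℕ} (h : m ∉ l) : insertBefore n m l = l := by
  induction l with
  | nil => rfl
  | cons a l ih =>
    simp only [List.mem_cons, not_or] at h
    have ha : a ≠ m := fun e => h.1 e.symm
    simp [insertBefore, ha, ih h.2]

/-- The definition of `insertBefore` at a decomposition of the list. -/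
theorem insertBefore_append {n m : ℕ} {l₁ l₂ : List ℕ} (h : m ∉ l₁) :
    insertBefore n m (l₁ ++ m :: l₂) = l₁ ++ n :: m :: l₂ := by
  induction l₁ with
  | nil => simp [insertBefore]
  | cons a l ih =>
    simp only [List.mem_cons, not_or] at h
    have ha : a ≠ m := fun e => h.1 e.symm
    simp [insertBefore, ha, ih h.2]

theorem insertBefore_append_left {n m : ℕ} {l₁ l₂ : List ℕ} (h : m ∉ l₂) :
    insertBefore n m (l₁ ++ l₂) = insertBefore n m l₁ ++ l₂ := by
  induction l₁ with
  | nil => simp [insertBefore_of_not_mem h, insertBefore]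
  | cons a l ih =>
    simp only [insertBefore, List.cons_append]
    split_ifs <;> simp [ih]

theorem insertBefore_append_right {n m : ℕ} {l₁ l₂ : List ℕ} (h : m ∉ l₁) :
    insertBefore n m (l₁ ++ l₂) = l₁ ++ insertBefore n m l₂ := by
  induction l₁ with
  | nil => rfl
  | cons a l ih =>
    simp only [List.mem_cons, not_or] at h
    have ha : a ≠ m := fun e => h.1 e.symm
    simp [insertBefore, ha, ih h.2]

/-- A member of a list splits it at its first occurrence. -/
theorem exists_split {m : ℕ} {l : List ℕ} (h : m ∈ l) :
    ∃ l₁ l₂, l = l₁ ++ m :: l₂ ∧ m ∉ l₁ := by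
  induction l with
  | nil => simp at h
  | cons a l ih =>
    by_cases ha : a = m
    · subst ha; exact ⟨[], l, rfl, by simp⟩
    · rcases List.mem_cons.1 h with rfl | h
      · exact absurd rfl ha
      · obtain ⟨l₁, l₂, rfl, h2⟩ := ih h
        refine ⟨a :: l₁, l₂, rfl, ?_⟩
        simp only [List.mem_cons, not_or]
        exact ⟨fun e => ha e.symm, h2⟩

theorem insertBefore_perm {n m : ℕ} {l : List ℕ} (h : m ∈ l) :
    (insertBefore n m l).Perm (n :: l) := by
  obtain ⟨l₁, l₂, rfl, h2⟩ := exists_split h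
  rw [insertBefore_append h2]
  exact List.perm_middle

theorem mem_insertBefore {n m x : ℕ} {l : List ℕ} (h : m ∈ l) :
    x ∈ insertBefore n m l ↔ x = n ∨ x ∈ l := by
  rw [(insertBefore_perm h).mem_iff, List.mem_cons]

theorem length_insertBefore {n m : ℕ} {l : List ℕ} (h : m ∈ l) :
    (insertBefore n m l).length = l.length + 1 := by
  rw [(insertBefore_perm h).length_eq, List.length_cons]

theorem nodup_insertBefore {n m : ℕ} {l : List ℕ} (hl : l.Nodup) (hn : n ∉ l) :
    (insertBefore n m l).Nodup := by
  by_cases h : m ∈ l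
  · rw [(insertBefore_perm h).nodup_iff, List.nodup_cons]
    exact ⟨hn, hl⟩
  · rwa [insertBefore_of_not_mem h]

theorem map_insertBefore {f : ℕ → ℕ} {n m : ℕ} {l : List ℕ}
    (hf : ∀ x ∈ l, f x = f m → x = m) :
    (insertBefore n m l).map f = insertBefore (f n) (f m) (l.map f) := by
  induction l with
  | nil => rfl
  | cons a l ih =>
    have ih := ih fun x hx => hf x (List.mem_cons_of_mem _ hx)
    have ha := hf a (by simp)
    by_cases h : a = m
    · subst h; simp [insertBefore]
    · have : f a ≠ f m := fun e => h (ha e)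
      simp [insertBefore, h, this, ih]

theorem erase_insertBefore {n m : ℕ} {l : List ℕ} (hn : n ∉ l) :
    (insertBefore n m l).erase n = l := by
  induction l with
  | nil => rfl
  | cons a l ih =>
    simp only [List.mem_cons, not_or] at hn
    have ha : a ≠ n := fun e => hn.1 e.symm
    simp only [insertBefore]
    split_ifs with h
    · simp
    · rw [List.erase_cons_tail (by simpa using ha), ih hn.2]

/-! ### Ranks -/

theorem rank_perm {l l' : List ℕ} (h : l.Perm l') (x : ℕ) : rank l x = rank l' x :=
  h.countP_eq _

theorem rank_cons_of_lt {n x : ℕ} (l : List ℕ) (h : x < n) : rank (n :: l) x = rank l x := by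
  have : ¬ n ≤ x := by omega
  simp [rank, this]

/-- A new largest element does not change the ranks of the other ones. -/
theorem rank_insertBefore {n m x : ℕ} {l : List ℕ} (h : x < n) :
    rank (insertBefore n m l) x = rank l x := by
  by_cases hm : m ∈ l
  · rw [rank_perm (insertBefore_perm hm), rank_cons_of_lt l h]
  · rw [insertBefore_of_not_mem hm]

theorem rank_eq_length {l : List ℕ} {x : ℕ} (h : ∀ y ∈ l, y ≤ x) : rank l x = l.length := by
  unfold rank
  rw [List.countP_eq_length]
  simpa using h

theorem rank_insertBefore_self {n m : ℕ} {l : List ℕ} (hm : m ∈ l) (h : ∀ y ∈ l, y < n) :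
    rank (insertBefore n m l) n = l.length + 1 := by
  rw [rank_perm (insertBefore_perm hm), rank_eq_length, List.length_cons]
  intro y hy
  rcases List.mem_cons.1 hy with rfl | hy
  · exact le_rfl
  · exact (h y hy).le

theorem rank_mono {l : List ℕ} {x y : ℕ} (h : x ≤ y) : rank l x ≤ rank l y :=
  List.countP_mono_left fun z _ hz => by simp at hz ⊢; omega

theorem rank_lt_rank {l : List ℕ} {x y : ℕ} (hy : y ∈ l) (h : x < y) : rank l x < rank l y := by
  obtain ⟨l₁, l₂, rfl⟩ := List.append_of_mem hy
  have h1 := rank_mono (l := l₁) h.le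
  have h2 := rank_mono (l := l₂) h.le
  unfold rank at h1 h2 ⊢
  have hn : ¬ y ≤ x := by omega
  simp only [List.countP_append, List.countP_cons, le_refl, decide_true, if_true, hn,
    decide_false] at h1 h2 ⊢
  simp
  omega

theorem rank_lt_rank_iff {l : List ℕ} {x y : ℕ} (hy : y ∈ l) :
    rank l x < rank l y ↔ x < y := by
  refine ⟨fun h => ?_, rank_lt_rank hy⟩
  by_contra hle
  exact absurd (rank_mono (l := l) (not_lt.1 hle)) (by omega)

theorem rank_injective {l : List ℕ} {x y : ℕ} (hx : x ∈ l) (hy : y ∈ l)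
    (h : rank l x = rank l y) : x = y := by
  rcases lt_trichotomy x y with hlt | rfl | hlt
  · have := rank_lt_rank hy hlt; omega
  · rfl
  · have := rank_lt_rank hx hlt; omega

theorem rank_pos {l : List ℕ} {x : ℕ} (hx : x ∈ l) : 1 ≤ rank l x :=
  List.countP_pos_iff.2 ⟨x, hx, by simp⟩

theorem rank_le_length (l : List ℕ) (x : ℕ) : rank l x ≤ l.length := List.countP_le_length

/-- In a strictly increasing sequence the rank is the position. -/
theorem rank_getElem_of_sorted {l : List ℕ} (h : l.Pairwise (· < ·)) (i : ℕ) (hi : i < l.length) :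
    rank l l[i] = i + 1 := by
  induction l generalizing i with
  | nil => simp at hi
  | cons a l ih =>
    rw [List.pairwise_cons] at h
    cases i with
    | zero =>
      have : rank l a = 0 := by
        unfold rank
        rw [List.countP_eq_zero]
        intro x hx
        have := h.1 x hx
        simp; omega
      simp only [rank, List.getElem_cons_zero, List.countP_cons, le_refl, decide_true, if_true] at *
      omega
    | succ i =>
      simp only [List.length_cons, Nat.add_lt_add_iff_right] at hi
      have h1 := ih h.2 i hi
      have h2 : a ≤ l[i] := (h.1 _ (List.getElem_mem hi)).le
      simp only [rank, List.getElem_cons_succ, List.countP_cons, h2, decide_true, if_true] at *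
      omega

theorem sorted_range'_filter (n : ℕ) (p : ℕ → Bool) :
    ((List.range' 1 n).filter p).Pairwise (· < ·) :=
  List.Pairwise.filter p List.pairwise_lt_range'

/-- A list of distinct elements contains an element of each rank. -/
theorem exists_rank_eq {l : List ℕ} (hl : l.Nodup) {q : ℕ} (h1 : 1 ≤ q) (h2 : q ≤ l.length) :
    ∃ x ∈ l, rank l x = q := by
  have hp : (l.mergeSort (· ≤ ·)).Perm l := List.mergeSort_perm l _
  have hs : (l.mergeSort (· ≤ ·)).Pairwise (· < ·) := by
    have h3 : (l.mergeSort (· ≤ ·)).Pairwise fun a b => decide (a ≤ b) = true :=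
      List.pairwise_mergeSort (fun a b c => by simp; omega) (fun a b => by simp; omega) l
    have h4 : (l.mergeSort (· ≤ ·)).Nodup := hp.nodup_iff.2 hl
    refine (List.Pairwise.and h3 h4).imp ?_
    rintro a b ⟨hab, hne⟩
    have : a ≤ b := by simpa using hab
    exact lt_of_le_of_ne this hne
  have hlen := hp.length_eq
  refine ⟨(l.mergeSort (· ≤ ·))[q - 1]'(by omega), hp.mem_iff.1 (List.getElem_mem _), ?_⟩
  rw [← rank_perm hp, rank_getElem_of_sorted hs]
  omega

/-! ### Ascents and descents -/

/-- The color of `v` in terms of the element before it. -/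
theorem ascentColor_append {l₁ l₂ : List ℕ} {v : ℕ} (h : v ∉ l₁) :
    ascentColor (l₁ ++ v :: l₂) v = if l₁.getLastD 0 < v then .red else .blue := by
  have hi : (l₁ ++ v :: l₂).idxOf v = l₁.length := by
    rw [List.idxOf_append_of_notMem h, List.idxOf_cons_self, Nat.add_zero]
  unfold ascentColor
  rw [hi]
  congr 2
  rcases List.eq_nil_or_concat' l₁ with rfl | ⟨L, b, rfl⟩
  · simp
  · simp

theorem exists_split_nodup {v : ℕ} {l : List ℕ} (hl : l.Nodup) (h : v ∈ l) :
    ∃ l₁ l₂, l = l₁ ++ v :: l₂ ∧ v ∉ l₁ ∧ v ∉ l₂ := by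
  obtain ⟨l₁, l₂, rfl, h1⟩ := exists_split h
  refine ⟨l₁, l₂, rfl, h1, fun h2 => ?_⟩
  rw [List.nodup_append] at hl
  exact (List.nodup_cons.1 hl.2.1).1 h2

theorem getLastD_append_cons (l₁ l₂ : List ℕ) (a d : ℕ) :
    (l₁ ++ a :: l₂).getLastD d = (a :: l₂).getLastD d := by
  rcases List.eq_nil_or_concat' l₂ with rfl | ⟨L, b, rfl⟩
  · simp
  · rw [show l₁ ++ a :: (L ++ [b]) = (l₁ ++ a :: L) ++ [b] by simp,
      show a :: (L ++ [b]) = (a :: L) ++ [b] by simp, List.getLastD_concat, List.getLastD_concat]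

theorem getLastD_mem_or {l : List ℕ} : l.getLastD 0 ∈ l ∨ l.getLastD 0 = 0 := by
  rcases List.eq_nil_or_concat' l with rfl | ⟨L, b, rfl⟩
  · simp
  · simp

/-- Only the friend has a new left neighbour after an insertion. -/
theorem ascentColor_insertBefore_of_ne {n m v : ℕ} {l : List ℕ} (hl : l.Nodup) (hm : m ∈ l)
    (hn : n ∉ l) (hv : v ∈ l) (hvm : v ≠ m) :
    ascentColor (insertBefore n m l) v = ascentColor l v := by
  obtain ⟨l₁, l₂, rfl, h1, h2⟩ := exists_split_nodup hl hm
  rw [insertBefore_append h1]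
  have hvn : v ≠ n := by rintro rfl; exact hn hv
  simp only [List.mem_append, List.mem_cons, hvm, false_or] at hv
  rcases hv with hv | hv
  · obtain ⟨a, b, rfl, h3⟩ := exists_split hv
    rw [List.append_assoc, List.append_assoc, List.cons_append, List.cons_append,
      ascentColor_append h3, ascentColor_append h3]
  · have hv1 : v ∉ l₁ := fun h =>
      (List.nodup_append.1 hl).2.2 v h v (List.mem_cons_of_mem _ hv) rfl
    obtain ⟨a, b, rfl, h3⟩ := exists_split hv
    rw [show l₁ ++ n :: m :: (a ++ v :: b) = (l₁ ++ n :: m :: a) ++ v :: b by simp,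
      show l₁ ++ m :: (a ++ v :: b) = (l₁ ++ m :: a) ++ v :: b by simp,
      ascentColor_append (by simp [hv1, hvn, hvm, h3]),
      ascentColor_append (by simp [hv1, hvm, h3]), getLastD_append_cons,
      show n :: m :: a = [n] ++ m :: a by simp, getLastD_append_cons, getLastD_append_cons]

/-- The friend of a larger value is a descent value. -/
theorem ascentColor_insertBefore_friend {n m : ℕ} {l : List ℕ} (hl : l.Nodup) (hm : m ∈ l)
    (hmn : m < n) : ascentColor (insertBefore n m l) m = .blue := by
  obtain ⟨l₁, l₂, rfl, h1, h2⟩ := exists_split_nodup hl hm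
  rw [insertBefore_append h1, show l₁ ++ n :: m :: l₂ = (l₁ ++ [n]) ++ m :: l₂ by simp,
    ascentColor_append (by simp [h1, hmn.ne]), List.getLastD_concat, if_neg (by omega)]

theorem ascentColor_insertBefore_self {n m : ℕ} {l : List ℕ} (hm : m ∈ l)
    (hn : ∀ x ∈ l, x < n) : ascentColor (insertBefore n m l) n = .red := by
  obtain ⟨l₁, l₂, rfl, h1⟩ := exists_split hm
  have hnl : n ∉ l₁ := fun h => absurd (hn n (by simp [h])) (lt_irrefl n)
  rw [insertBefore_append h1, ascentColor_append hnl, if_pos]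
  have hmn := hn m (by simp)
  rcases getLastD_mem_or (l := l₁) with h | h
  · exact hn _ (List.mem_append_left _ h)
  · omega

theorem ascentColor_append_singleton {n v : ℕ} {l : List ℕ} (hv : v ∈ l) :
    ascentColor (l ++ [n]) v = ascentColor l v := by
  obtain ⟨a, b, rfl, h3⟩ := exists_split hv
  rw [List.append_assoc, List.cons_append, ascentColor_append h3, ascentColor_append h3]

/-- The colors depend only on the relative order of the elements, and not on their values, as long
as these are positive. -/
theorem ascentColor_map {f : ℕ → ℕ} {l : List ℕ} {v : ℕ} (hv : v ∈ l)
    (hf : ∀ x ∈ l, ∀ y ∈ l, f x < f y ↔ x < y) (h0 : ∀ x ∈ l, 0 < x) (hf0 : ∀ x ∈ l, 0 < f x) :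
    ascentColor (l.map f) (f v) = ascentColor l v := by
  obtain ⟨a, b, rfl, h3⟩ := exists_split hv
  have hfv : f v ∉ a.map f := by
    intro h
    obtain ⟨x, hx, e⟩ := List.mem_map.1 h
    have h1 := hf x (by simp [hx]) v hv
    have h2 := hf v hv x (by simp [hx])
    have : x ≠ v := by rintro rfl; exact h3 hx
    omega
  rw [List.map_append, List.map_cons, ascentColor_append h3, ascentColor_append hfv]
  rcases List.eq_nil_or_concat' a with rfl | ⟨L, c, rfl⟩
  · simp [h0 v hv, hf0 v hv]
  · rw [List.map_append, List.map_singleton, List.getLastD_concat, List.getLastD_concat,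
      if_congr (hf c (by simp) v hv) rfl rfl]

/-! ### Families -/

/-- `R` is increasing, `B` is decreasing, and the elements of `R` are larger than those of `B`:
the reds and the blues of a family with at least two elements. -/
structure IsRedBlue (R B : List ℕ) : Prop where
  red_ne_nil : R ≠ []
  blue_ne_nil : B ≠ []
  red_lt : R.Pairwise (· < ·)
  blue_gt : B.Pairwise (· > ·)
  blue_lt_red : ∀ a ∈ R, ∀ b ∈ B, b < a

/-- A family with at least two elements is cut into its reds and its blues. -/
theorem isFamily_iff {l : List ℕ} (h : 2 ≤ l.length) :
    IsFamily l ↔ ∃ R B, l = R ++ B ∧ IsRedBlue R B := by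
  unfold IsFamily
  constructor
  · rintro (h1 | ⟨k, hk, h1, h2, h3⟩)
    · omega
    · rw [Finset.mem_Ioo] at hk
      refine ⟨_, _, (List.take_append_drop k l).symm, ?_, ?_, h1, h2, h3⟩
      · intro e
        have := congrArg List.length e
        rw [List.length_take, List.length_nil] at this
        omega
      · intro e
        have := congrArg List.length e
        rw [List.length_drop, List.length_nil] at this
        omega
  · rintro ⟨R, B, rfl, hRB⟩
    right
    have hR := List.length_pos_iff.2 hRB.red_ne_nil
    have hB := List.length_pos_iff.2 hRB.blue_ne_nil
    refine ⟨R.length, ?_, ?_⟩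
    · rw [Finset.mem_Ioo, List.length_append]; omega
    · rw [List.take_left, List.drop_left]
      exact ⟨hRB.red_lt, hRB.blue_gt, hRB.blue_lt_red⟩

theorem IsRedBlue.isFamily {R B : List ℕ} (h : IsRedBlue R B) : IsFamily (R ++ B) := by
  have hR := List.length_pos_iff.2 h.red_ne_nil
  have hB := List.length_pos_iff.2 h.blue_ne_nil
  exact (isFamily_iff (by rw [List.length_append]; omega)).2 ⟨R, B, rfl, h⟩

theorem IsRedBlue.nodup {R B : List ℕ} (h : IsRedBlue R B) : (R ++ B).Nodup := by
  rw [List.nodup_append]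
  refine ⟨h.red_lt.imp fun h => h.ne, h.blue_gt.imp fun h => h.ne', ?_⟩
  rintro a ha b hb rfl
  exact absurd (h.blue_lt_red a ha a hb) (lt_irrefl a)

/-- The reds of a family are its ascent values. For the first one this depends on the convention
that a `0` precedes the line. -/
theorem IsRedBlue.color_red {R B : List ℕ} (h : IsRedBlue R B) (h0 : ∀ x ∈ R, 0 < x) {v : ℕ}
    (hv : v ∈ R) : ascentColor (R ++ B) v = .red := by
  obtain ⟨a, b, rfl, h3⟩ := exists_split hv
  rw [List.append_assoc, List.cons_append, ascentColor_append h3, if_pos]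
  rcases getLastD_mem_or (l := a) with h1 | h1
  · exact (List.pairwise_append.1 h.red_lt).2.2 _ h1 v (by simp)
  · rw [h1]; exact h0 v hv

/-- The blues of a family are its descent values. -/
theorem IsRedBlue.color_blue {R B : List ℕ} (h : IsRedBlue R B) {v : ℕ}
    (hv : v ∈ B) : ascentColor (R ++ B) v = .blue := by
  obtain ⟨a, b, rfl, h3⟩ := exists_split hv
  have hvR : v ∉ R := fun hR => absurd (h.blue_lt_red v hR v hv) (lt_irrefl v)
  rw [← List.append_assoc, ascentColor_append (by simp [h3, hvR]), if_neg]
  rw [not_lt]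
  apply le_of_lt
  rcases List.eq_nil_or_concat' a with rfl | ⟨L, c, rfl⟩
  · rw [List.append_nil]
    rcases List.eq_nil_or_concat' R with rfl | ⟨L, c, rfl⟩
    · exact absurd rfl h.red_ne_nil
    · rw [List.getLastD_concat]
      exact h.blue_lt_red c (by simp) v hv
  · rw [← List.append_assoc, List.getLastD_concat]
    exact (List.pairwise_append.1 h.blue_gt).2.2 c (by simp) v (by simp)

/-- The largest element of a family is its last red. -/
theorem IsRedBlue.eq_of_max {R B u w : List ℕ} {n : ℕ} (h : IsRedBlue R B)
    (e : R ++ B = u ++ n :: w) (hu : ∀ x ∈ u, x < n) (hw : ∀ x ∈ w, x < n) :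
    R = u ++ [n] ∧ B = w := by
  have hle : ∀ x ∈ R ++ B, x ≤ n := by
    intro x hx
    rw [e] at hx
    rcases List.mem_append.1 hx with hx | hx
    · exact (hu x hx).le
    · rcases List.mem_cons.1 hx with rfl | hx
      · exact le_rfl
      · exact (hw x hx).le
  have hn : n ∈ R ++ B := by rw [e]; simp
  have hnR : n ∈ R := by
    rcases List.mem_append.1 hn with hR | hB
    · exact hR
    · obtain ⟨a, ha⟩ := List.exists_mem_of_ne_nil _ h.red_ne_nil
      have h1 := h.blue_lt_red a ha n hB
      have h2 := hle a (List.mem_append_left _ ha)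
      omega
  obtain ⟨s, t, rfl⟩ := List.append_of_mem hnR
  have ht : t = [] := by
    rw [List.eq_nil_iff_forall_not_mem]
    intro x hx
    have h1 := (List.pairwise_cons.1 (List.pairwise_append.1 h.red_lt).2.1).1 x hx
    have h2 := hle x (by simp [hx])
    omega
  subst ht
  have hs : n ∉ s := fun hs => by
    have := (List.pairwise_append.1 h.red_lt).2.2 n hs n (by simp)
    omega
  have hu' : n ∉ u := fun h => absurd (hu n h) (lt_irrefl n)
  have hw' : n ∉ w := fun h => absurd (hw n h) (lt_irrefl n)
  have hB : n ∉ B := fun hB => absurd (h.blue_lt_red n hnR n hB) (lt_irrefl n)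
  rw [List.append_assoc, List.singleton_append] at e
  rw [List.append_cons_inj_of_notMem hs hB] at e
  exact ⟨by rw [e.1], e.2.2⟩

/-- A new largest element joins a family before `m` only if `m` is its only red or its last
blue. -/
theorem IsRedBlue.isFamily_insertBefore_iff {R B : List ℕ} (h : IsRedBlue R B) {n m : ℕ}
    (hm : m ∈ R ++ B) (hn : ∀ x ∈ R ++ B, x < n) :
    IsFamily (insertBefore n m (R ++ B)) ↔ R = [m] ∨ B.head? = some m := by
  have hlen : 2 ≤ (insertBefore n m (R ++ B)).length := by
    rw [length_insertBefore hm]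
    have := List.length_pos_of_mem hm
    omega
  rw [isFamily_iff hlen]
  constructor
  · rintro ⟨R', B', e, h'⟩
    -- the new element is the last red of the larger family, so that the elements after it are
    -- the blues: `m` is red only if all the former reds from `m` on turn blue
    rcases List.mem_append.1 hm with hR | hB
    · left
      obtain ⟨a, b, rfl, h3⟩ := exists_split hR
      rw [List.append_assoc, List.cons_append, insertBefore_append h3] at e
      obtain ⟨rfl, rfl⟩ := h'.eq_of_max e.symm (fun x hx => hn x (by simp [hx]))
        (fun x hx => hn x (by
          simp only [List.mem_cons, List.mem_append] at hx ⊢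
          tauto))
      -- a red before `m` would be smaller than `m`, which is blue now
      have ha : a = [] := by
        rw [List.eq_nil_iff_forall_not_mem]
        intro x hx
        have h1 := h'.blue_lt_red x (by simp [hx]) m (by simp)
        have h2 := (List.pairwise_append.1 h.red_lt).2.2 x hx m (by simp)
        omega
      -- a red after `m` would be larger than `m`, but the blues decrease
      have hb : b = [] := by
        rw [List.eq_nil_iff_forall_not_mem]
        intro x hx
        have h1 := (List.pairwise_cons.1 h'.blue_gt).1 x (by simp [hx])
        have h2 := (List.pairwise_cons.1 (List.pairwise_append.1 h.red_lt).2.1).1 x hx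
        omega
      rw [ha, hb]; rfl
    · right
      obtain ⟨a, b, rfl, h3⟩ := exists_split hB
      have hmR : m ∉ R := fun hR => absurd (h.blue_lt_red m hR m hB) (lt_irrefl m)
      rw [← List.append_assoc, insertBefore_append (by simp [h3, hmR])] at e
      obtain ⟨rfl, rfl⟩ := h'.eq_of_max e.symm (fun x hx => hn x (by
          simp only [List.mem_cons, List.mem_append] at hx ⊢
          tauto)) (fun x hx => hn x (by
          simp only [List.mem_cons, List.mem_append] at hx ⊢
          tauto))
      have ha : a = [] := by
        rw [List.eq_nil_iff_forall_not_mem]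
        intro x hx
        -- a blue before `m` would be a red of the larger family, and larger than the reds
        obtain ⟨r, hr⟩ := List.exists_mem_of_ne_nil _ h.red_ne_nil
        have h1 := h.blue_lt_red r hr x (by simp [hx])
        have h2 := h'.red_lt
        rw [List.append_assoc] at h2
        have h4 := (List.pairwise_append.1 h2).2.2 r hr x (by simp [hx])
        omega
      rw [ha]; rfl
  · rintro (rfl | hB)
    · refine ⟨[n], m :: B, by simp [insertBefore], by simp, by simp, by simp, ?_, ?_⟩
      · rw [List.pairwise_cons]
        exact ⟨fun b hb => h.blue_lt_red m (by simp) b hb, h.blue_gt⟩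
      · intro a ha b hb
        simp at ha; subst ha
        rcases List.mem_cons.1 hb with rfl | hb
        · exact hn b (by simp)
        · exact hn b (by simp [hb])
    · obtain ⟨b, rfl⟩ : ∃ b, B = m :: b := by
        cases B with
        | nil => simp at hB
        | cons x b => simp at hB; exact ⟨b, by rw [hB]⟩
      have hmR : m ∉ R := fun hR => absurd (h.blue_lt_red m hR m (by simp)) (lt_irrefl m)
      refine ⟨R ++ [n], m :: b, by rw [insertBefore_append hmR]; simp, by simp, by simp, ?_,
        h.blue_gt, ?_⟩
      · exact pairwise_concat h.red_lt fun x hx => hn x (by simp [hx])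
      · intro x hx y hy
        rcases List.mem_append.1 hx with hx | hx
        · exact h.blue_lt_red x hx y hy
        · simp at hx; subst hx
          exact hn y (List.mem_append_right _ hy)

/-- The condition for joining a family in terms of colors: the friend is the last blue, which is
the largest one, or the only red. It corresponds to `Fit` for codes. -/
theorem isFamily_insertBefore_iff_color {A : List ℕ} (hA : IsFamily A) (h2 : 2 ≤ A.length)
    (h0 : ∀ x ∈ A, 0 < x) {n m : ℕ} (hm : m ∈ A) (hn : ∀ x ∈ A, x < n) :
    IsFamily (insertBefore n m A) ↔
      (ascentColor A m = .blue ∧ ∀ x ∈ A, ascentColor A x = .blue → x ≤ m) ∨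
        (ascentColor A m = .red ∧ ∀ x ∈ A, ascentColor A x = .red → x = m) := by
  obtain ⟨R, B, rfl, h⟩ := (isFamily_iff h2).1 hA
  have hr : ∀ x ∈ R, ascentColor (R ++ B) x = .red := fun x hx =>
    h.color_red (fun x hx => h0 x (by simp [hx])) hx
  have hb : ∀ x ∈ B, ascentColor (R ++ B) x = .blue := fun x hx => h.color_blue hx
  rw [h.isFamily_insertBefore_iff hm hn]
  constructor
  · rintro (rfl | hB)
    · right
      refine ⟨hr m (by simp), fun x hx hc => ?_⟩
      rcases List.mem_append.1 hx with hx | hx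
      · simpa using hx
      · rw [hb x hx] at hc; simp at hc
    · left
      obtain ⟨b, rfl⟩ : ∃ b, B = m :: b := by
        cases B with
        | nil => simp at hB
        | cons x b => simp at hB; exact ⟨b, by rw [hB]⟩
      refine ⟨hb m (by simp), fun x hx hc => ?_⟩
      rcases List.mem_append.1 hx with hx | hx
      · rw [hr x hx] at hc; simp at hc
      · rcases List.mem_cons.1 hx with rfl | hx
        · exact le_rfl
        · exact ((List.pairwise_cons.1 h.blue_gt).1 x hx).le
  · rintro (⟨hc, hx⟩ | ⟨hc, hx⟩)
    · right
      have hmB : m ∈ B := by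
        rcases List.mem_append.1 hm with hm | hm
        · rw [hr m hm] at hc; simp at hc
        · exact hm
      match hB : B with
      | [] => simp at hmB
      | y :: b =>
        have h1 := hx y (by simp) (hb y (by simp))
        rcases List.mem_cons.1 hmB with rfl | hmb
        · rfl
        · have h3 := (List.pairwise_cons.1 h.blue_gt).1 m hmb
          omega
    · left
      have hmR : m ∈ R := by
        rcases List.mem_append.1 hm with hm | hm
        · exact hm
        · rw [hb m hm] at hc; simp at hc
      have hall : ∀ y ∈ R, y = m := fun y hy => hx y (by simp [hy]) (hr y hy)
      have hrep := List.eq_replicate_iff.2 ⟨rfl, hall⟩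
      have hnd := (List.nodup_append.1 h.nodup).1
      match hR : R with
      | [] => simp at hmR
      | [y] => rw [hall y (by simp)]
      | y :: z :: r =>
        have h1 := hall y (by simp)
        have h2 := hall z (by simp)
        rw [h1, h2] at hnd
        simp at hnd

/-- An element which the new largest element cannot join leaves a family, without change of the
colors. -/
theorem isFamily_erase {A : List ℕ} (hA : IsFamily A) (h2 : 2 ≤ A.length)
    (h0 : ∀ x ∈ A, 0 < x) {n m : ℕ} (hm : m ∈ A) (hn : ∀ x ∈ A, x < n)
    (hfit : ¬ IsFamily (insertBefore n m A)) :
    IsFamily (A.erase m) ∧ 2 ≤ (A.erase m).length ∧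
      ∀ v ∈ A.erase m, ascentColor (A.erase m) v = ascentColor A v := by
  obtain ⟨R, B, rfl, h⟩ := (isFamily_iff h2).1 hA
  rw [h.isFamily_insertBefore_iff hm hn] at hfit
  push Not at hfit
  -- a red and a blue remain: `m` is not the only red, and if it were the only blue, it would be
  -- the first of the blues
  have key : (R ++ B).erase m = R.erase m ++ B.erase m ∧ IsRedBlue (R.erase m) (B.erase m) := by
    have hne : R.erase m ≠ [] ∧ B.erase m ≠ [] ∧
        (R ++ B).erase m = R.erase m ++ B.erase m := by
      rcases List.mem_append.1 hm with hR | hB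
      · have hmB : m ∉ B := fun hB => absurd (h.blue_lt_red m hR m hB) (lt_irrefl m)
        rw [List.erase_append_left _ hR, List.erase_of_not_mem hmB]
        refine ⟨fun e => ?_, h.blue_ne_nil, rfl⟩
        rw [List.erase_eq_nil_iff] at e
        exact e.elim h.red_ne_nil hfit.1
      · have hmR : m ∉ R := fun hR => absurd (h.blue_lt_red m hR m hB) (lt_irrefl m)
        rw [List.erase_append_right _ hmR, List.erase_of_not_mem hmR]
        refine ⟨h.red_ne_nil, fun e => ?_, rfl⟩
        rw [List.erase_eq_nil_iff] at e
        rcases e with e | e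
        · exact h.blue_ne_nil e
        · exact hfit.2 (by rw [e]; rfl)
    exact ⟨hne.2.2, hne.1, hne.2.1, h.red_lt.sublist List.erase_sublist,
      h.blue_gt.sublist List.erase_sublist, fun a ha b hb =>
        h.blue_lt_red a (List.mem_of_mem_erase ha) b (List.mem_of_mem_erase hb)⟩
  obtain ⟨e, hRB⟩ := key
  rw [e]
  refine ⟨hRB.isFamily, ?_, ?_⟩
  · have h1 := List.length_pos_iff.2 hRB.red_ne_nil
    have h2 := List.length_pos_iff.2 hRB.blue_ne_nil
    rw [List.length_append]; omega
  · intro v hv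
    rcases List.mem_append.1 hv with hv | hv
    · rw [hRB.color_red (fun x hx => h0 x (by simp [List.mem_of_mem_erase hx])) hv,
        h.color_red (fun x hx => h0 x (by simp [hx])) (List.mem_of_mem_erase hv)]
    · rw [hRB.color_blue hv, h.color_blue (List.mem_of_mem_erase hv)]

/-- Being a family depends only on the relative order of the elements. -/
theorem isFamily_map {f : ℕ → ℕ} {l : List ℕ} (hf : ∀ x ∈ l, ∀ y ∈ l, f x < f y ↔ x < y) :
    IsFamily (l.map f) ↔ IsFamily l := by
  unfold IsFamily
  rw [List.length_map]
  apply or_congr Iff.rfl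
  apply exists_congr
  intro k
  apply and_congr Iff.rfl
  have ht : ∀ {x}, x ∈ l.take k → x ∈ l := fun h => List.mem_of_mem_take h
  have hd : ∀ {x}, x ∈ l.drop k → x ∈ l := fun h => List.mem_of_mem_drop h
  rw [← List.map_take, ← List.map_drop, List.pairwise_map, List.pairwise_map]
  refine and_congr ?_ (and_congr ?_ ?_)
  · exact ⟨fun h => h.imp_of_mem fun ha hb h => (hf _ (ht ha) _ (ht hb)).1 h,
      fun h => h.imp_of_mem fun ha hb h => (hf _ (ht ha) _ (ht hb)).2 h⟩
  · exact ⟨fun h => h.imp_of_mem fun ha hb h => (hf _ (hd hb) _ (hd ha)).1 h,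
      fun h => h.imp_of_mem fun ha hb h => (hf _ (hd hb) _ (hd ha)).2 h⟩
  · simp only [List.forall_mem_map]
    exact ⟨fun h a ha b hb => (hf _ (hd hb) _ (ht ha)).1 (h a ha b hb),
      fun h a ha b hb => (hf _ (hd hb) _ (ht ha)).2 (h a ha b hb)⟩

/-! ### Blocks -/

/-- The left fold of `min` is the minimum. -/
theorem foldl_min_spec (l : List ℕ) (a : ℕ) :
    l.foldl min a ∈ a :: l ∧ ∀ x ∈ a :: l, l.foldl min a ≤ x := by
  induction l generalizing a with
  | nil => simp
  | cons b l ih =>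
    obtain ⟨h1, h2⟩ := ih (min a b)
    rw [List.foldl_cons]
    constructor
    · rcases List.mem_cons.1 h1 with h | h
      · rw [h]
        rcases min_choice a b with e | e <;> rw [e] <;> simp
      · simp [h]
    · have hmin := h2 (min a b) (by simp)
      intro x hx
      simp only [List.mem_cons] at hx
      rcases hx with rfl | rfl | hx
      · exact hmin.trans (min_le_left _ _)
      · exact hmin.trans (min_le_right _ _)
      · exact h2 x (by simp [hx])

theorem blocks_nil : blocks [] = [] := by rw [blocks]

/-- The first block ends with the minimum. -/
theorem blocks_append_cons {l₁ l₂ : List ℕ} {a : ℕ} (h : ∀ x ∈ l₁ ++ l₂, a < x) :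
    blocks (l₁ ++ a :: l₂) = (l₁ ++ [a]) :: blocks l₂ := by
  obtain ⟨b, l', e⟩ : ∃ b l', l₁ ++ a :: l₂ = b :: l' := by
    cases l₁ with
    | nil => exact ⟨a, l₂, rfl⟩
    | cons b l => exact ⟨b, l ++ a :: l₂, rfl⟩
  have hmin : l'.foldl min b = a := by
    obtain ⟨h1, h2⟩ := foldl_min_spec l' b
    rw [← e] at h1 h2
    have h3 := h2 a (by simp)
    by_contra hne
    have h4 : l'.foldl min b ∈ l₁ ++ l₂ := by
      simp only [List.mem_append, List.mem_cons, hne, false_or] at h1 ⊢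
      exact h1
    have := h _ h4
    omega
  have ha : a ∉ l₁ := fun ha => absurd (h a (by simp [ha])) (lt_irrefl a)
  rw [e, blocks, hmin, ← e]
  have hi : (l₁ ++ a :: l₂).idxOf a = l₁.length := by
    rw [List.idxOf_append_of_notMem ha, List.idxOf_cons_self, Nat.add_zero]
  rw [hi]
  have e2 : l₁ ++ a :: l₂ = (l₁ ++ [a]) ++ l₂ := by simp
  have e3 : l₁.length + 1 = (l₁ ++ [a]).length := by simp
  rw [e2, e3, List.take_left, List.drop_left]

theorem exists_min_split {l : List ℕ} (hl : l.Nodup) (h : l ≠ []) :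
    ∃ l₁ a l₂, l = l₁ ++ a :: l₂ ∧ ∀ x ∈ l₁ ++ l₂, a < x := by
  match l, h with
  | b :: l', _ =>
    obtain ⟨h1, h2⟩ := foldl_min_spec l' b
    obtain ⟨l₁, l₂, e, h3, h4⟩ := exists_split_nodup hl h1
    refine ⟨l₁, _, l₂, e, fun x hx => ?_⟩
    have h5 : x ∈ b :: l' := by
      rw [e]
      simp only [List.mem_append, List.mem_cons] at hx ⊢
      tauto
    refine lt_of_le_of_ne (h2 x h5) ?_
    rintro rfl
    exact (List.mem_append.1 hx).elim h3 h4

/-- Induction on a sequence of distinct numbers by its blocks. -/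
theorem blocks_induction {P : List ℕ → Prop} (h0 : P [])
    (h1 : ∀ l₁ a l₂, (l₁ ++ a :: l₂).Nodup → (∀ x ∈ l₁ ++ l₂, a < x) → P l₂ →
      P (l₁ ++ a :: l₂)) : ∀ l : List ℕ, l.Nodup → P l := by
  intro l
  induction hn : l.length using Nat.strong_induction_on generalizing l with
  | _ k ih =>
    intro hl
    by_cases hne : l = []
    · rw [hne]; exact h0
    · obtain ⟨l₁, a, l₂, rfl, h2⟩ := exists_min_split hl hne
      refine h1 l₁ a l₂ hl h2 (ih l₂.length ?_ l₂ rfl ?_)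
      · simp at hn; omega
      · exact (List.nodup_cons.1 (List.nodup_append.1 hl).2.1).2

theorem flatten_blocks {l : List ℕ} (hl : l.Nodup) : (blocks l).flatten = l := by
  refine blocks_induction (P := fun l => (blocks l).flatten = l) ?_ ?_ l hl
  · rw [blocks_nil]; rfl
  · intro l₁ a l₂ _ h ih
    rw [blocks_append_cons h, List.flatten_cons, ih]
    simp

/-- A new largest value at the end is a block of its own. -/
theorem blocks_append_singleton {l : List ℕ} (hl : l.Nodup) {n : ℕ} (hn : ∀ x ∈ l, x < n) :
    blocks (l ++ [n]) = blocks l ++ [[n]] := by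
  revert hn
  refine blocks_induction
    (P := fun l => (∀ x ∈ l, x < n) → blocks (l ++ [n]) = blocks l ++ [[n]]) ?_ ?_ l hl
  · intro _
    have := blocks_append_cons (l₁ := []) (l₂ := []) (a := n) (by simp)
    rw [List.nil_append] at this ⊢
    rw [this, blocks_nil]
    rfl
  · intro l₁ a l₂ _ h ih hn
    have ih := ih fun x hx => hn x (by simp [hx])
    rw [List.append_assoc, List.cons_append, blocks_append_cons, blocks_append_cons h, ih]
    · rfl
    · intro x hx
      rw [← List.append_assoc] at hx
      rcases List.mem_append.1 hx with hx | hx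
      · exact h x hx
      · simp at hx; rw [hx]; exact hn a (by simp)

/-- The insertion of a large number before a member of a sequence is an insertion into one of its
blocks. -/
theorem blocks_insertBefore {l : List ℕ} (hl : l.Nodup) {n : ℕ} (m : ℕ) (hn : ∀ x ∈ l, x < n) :
    blocks (insertBefore n m l) = (blocks l).map (insertBefore n m) := by
  revert hn
  refine blocks_induction
    (P := fun l => (∀ x ∈ l, x < n) →
      blocks (insertBefore n m l) = (blocks l).map (insertBefore n m)) ?_ ?_ l hl
  · intro _
    rw [insertBefore, blocks_nil]; rfl
  · intro l₁ a l₂ hnd h ih hn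
    have ih := ih fun x hx => hn x (by simp [hx])
    have hd := List.nodup_append.1 hnd
    rw [blocks_append_cons h, List.map_cons, ← ih]
    -- the friend is in the first block before its last element `a`, or `a` itself, or in a later
    -- block
    by_cases h1 : m ∈ l₁
    · have h2 : m ∉ a :: l₂ := fun h2 => hd.2.2 m h1 m h2 rfl
      have h3 : m ∉ l₂ := fun h3 => h2 (List.mem_cons_of_mem _ h3)
      have h4 : m ∉ [a] := fun h4 => h2 (by simp at h4; simp [h4])
      rw [insertBefore_append_left h2, insertBefore_append_left h4, insertBefore_of_not_mem h3,
        blocks_append_cons]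
      intro x hx
      rcases List.mem_append.1 hx with hx | hx
      · rw [mem_insertBefore h1] at hx
        rcases hx with rfl | hx
        · exact hn a (by simp)
        · exact h x (by simp [hx])
      · exact h x (by simp [hx])
    · by_cases ha : m = a
      · subst ha
        have h3 := (List.nodup_cons.1 hd.2.1).1
        rw [insertBefore_append h1, insertBefore_append h1, insertBefore_of_not_mem h3,
          show l₁ ++ n :: m :: l₂ = (l₁ ++ [n]) ++ m :: l₂ by simp, blocks_append_cons]
        · simp
        · intro x hx
          simp only [List.mem_append, List.mem_singleton] at hx
          rcases hx with (hx | rfl) | hx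
          · exact h x (by simp [hx])
          · exact hn m (by simp)
          · exact h x (by simp [hx])
      · have h4 : m ∉ l₁ ++ [a] := by simp [h1, ha]
        rw [show l₁ ++ a :: l₂ = (l₁ ++ [a]) ++ l₂ by simp, insertBefore_append_right h4,
          insertBefore_of_not_mem h4, List.append_assoc, List.singleton_append, blocks_append_cons]
        intro x hx
        rcases List.mem_append.1 hx with hx | hx
        · exact h x (by simp [hx])
        · by_cases h2 : m ∈ l₂
          · rw [mem_insertBefore h2] at hx
            rcases hx with rfl | hx
            · exact hn a (by simp)
            · exact h x (by simp [hx])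
          · rw [insertBefore_of_not_mem h2] at hx
            exact h x (by simp [hx])

theorem mem_of_mem_blocks {l b : List ℕ} (hl : l.Nodup) (hb : b ∈ blocks l) {x : ℕ} (hx : x ∈ b) :
    x ∈ l := by
  rw [← flatten_blocks hl]
  exact List.mem_flatten.2 ⟨b, hb, hx⟩

theorem valueColor_append_of_mem {l : List ℕ} (hl : l.Nodup) {n v : ℕ} (hn : ∀ x ∈ l, x < n)
    (hv : v ∈ l) : valueColor (l ++ [n]) v = valueColor l v := by
  unfold valueColor
  have hvn : v ≠ n := (hn v hv).ne
  rw [blocks_append_singleton hl hn, ascentColor_append_singleton hv]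
  simp [hvn]

theorem valueColor_append_self {l : List ℕ} (hl : l.Nodup) {n : ℕ} (hn : ∀ x ∈ l, x < n) :
    valueColor (l ++ [n]) n = .black := by
  unfold valueColor
  rw [blocks_append_singleton hl hn]
  simp

/-- An insertion into a block does not lead to a singlet. -/
theorem singleton_eq_insertBefore {n m v : ℕ} {b : List ℕ} (h : insertBefore n m b = [v]) :
    m ∉ b ∧ b = [v] := by
  by_cases hm : m ∈ b
  · have h1 := length_insertBefore (n := n) hm
    have h2 := List.length_pos_of_mem hm
    rw [h] at h1
    simp at h1
    simp [h1] at hm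
  · exact ⟨hm, by rwa [insertBefore_of_not_mem hm] at h⟩

/-- The colors after the insertion of a new largest value: the new value is red, its friend
becomes blue, and the other colors do not change. -/
theorem valueColor_insertBefore {l : List ℕ} (hl : l.Nodup) {n m : ℕ} (hn : ∀ x ∈ l, x < n)
    (hm : m ∈ l) :
    valueColor (insertBefore n m l) n = .red ∧ valueColor (insertBefore n m l) m = .blue ∧
      ∀ v ∈ l, v ≠ m → valueColor (insertBefore n m l) v = valueColor l v := by
  have hnl : n ∉ l := fun h => absurd (hn n h) (lt_irrefl n)
  unfold valueColor
  rw [blocks_insertBefore hl m hn]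
  refine ⟨?_, ?_, ?_⟩
  · rw [if_neg, ascentColor_insertBefore_self hm hn]
    intro h
    obtain ⟨b, hb, e⟩ := List.mem_map.1 h
    obtain ⟨_, rfl⟩ := singleton_eq_insertBefore e
    exact hnl (mem_of_mem_blocks hl hb (by simp))
  · rw [if_neg, ascentColor_insertBefore_friend hl hm (hn m hm)]
    intro h
    obtain ⟨b, hb, e⟩ := List.mem_map.1 h
    obtain ⟨h1, rfl⟩ := singleton_eq_insertBefore e
    simp at h1
  · intro v hv hvm
    rw [ascentColor_insertBefore_of_ne hl hm hnl hv hvm]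
    congr 1
    rw [eq_iff_iff]
    constructor
    · intro h
      obtain ⟨b, hb, e⟩ := List.mem_map.1 h
      obtain ⟨_, rfl⟩ := singleton_eq_insertBefore e
      exact hb
    · intro h
      refine List.mem_map.2 ⟨[v], h, insertBefore_of_not_mem ?_⟩
      simp; exact fun e => hvm e.symm

/-! ### Patterns -/

/-- The insertion of a new largest element before `m` commutes with taking patterns. -/
theorem pattern_insertBefore {l : List ℕ} {n m : ℕ} (hm : m ∈ l) (hn : ∀ x ∈ l, x < n) :
    pattern (insertBefore n m l) = insertBefore (l.length + 1) (rank l m) (pattern l) := by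
  unfold pattern
  have h1 : (insertBefore n m l).map (rank (insertBefore n m l)) =
      insertBefore (rank (insertBefore n m l) n) (rank (insertBefore n m l) m)
        (l.map (rank (insertBefore n m l))) := by
    apply map_insertBefore
    intro x hx e
    rw [rank_insertBefore (hn x hx), rank_insertBefore (hn m hm)] at e
    exact rank_injective hx hm e
  rw [h1, rank_insertBefore_self hm hn, rank_insertBefore (hn m hm)]
  congr 1
  apply List.map_congr_left
  intro x hx
  exact rank_insertBefore (hn x hx)

/-! ### Insertion into a sequence with parentheses -/

theorem insertBefore_append_of_nodup {n m : ℕ} {l₁ l₂ : List ℕ} (h : (l₁ ++ l₂).Nodup) :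
    insertBefore n m (l₁ ++ l₂) = insertBefore n m l₁ ++ insertBefore n m l₂ := by
  by_cases h1 : m ∈ l₁
  · have h2 : m ∉ l₂ := fun h2 => (List.nodup_append.1 h).2.2 m h1 m h2 rfl
    rw [insertBefore_append_left h2, insertBefore_of_not_mem h2]
  · rw [insertBefore_append_right h1, insertBefore_of_not_mem h1]

theorem filter_insertBefore {n m : ℕ} {l : List ℕ} {p : ℕ → Bool} (h : p n = false) :
    (insertBefore n m l).filter p = l.filter p := by
  induction l with
  | nil => rfl
  | cons a l ih =>
    simp only [insertBefore]
    split_ifs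
    · rw [List.filter_cons_of_neg (by simp [h])]
    · rw [List.filter_cons, List.filter_cons, ih]

namespace ParSeq

theorem mem_flatten_of_mem_active {t : ParSeq} {v : ℕ} (h : v ∈ t.active) : v ∈ t.flatten := by
  induction t with
  | nil => simp [active] at h
  | elem a r ih =>
    simp only [active, flatten, List.mem_cons] at h ⊢
    exact h.imp id ih
  | paren s r _ ih =>
    simp only [active, flatten, List.mem_append] at h ⊢
    exact Or.inr (ih h)

theorem active_sublist_flatten (t : ParSeq) : t.active.Sublist t.flatten := by
  induction t with
  | nil => exact List.Sublist.refl _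
  | elem a r ih => exact ih.cons_cons a
  | paren s r _ ih => exact ih.trans (List.sublist_append_right _ _)

theorem flatten_sublist_of_mem_children {t s : ParSeq} (h : s ∈ t.children) :
    s.flatten.Sublist t.flatten := by
  induction t with
  | nil => simp [children] at h
  | elem a r ih => exact (ih h).cons a
  | paren s' r _ ih =>
    simp only [children, List.mem_cons] at h
    rcases h with rfl | h
    · exact List.sublist_append_left _ _
    · exact (ih h).trans (List.sublist_append_right _ _)

theorem flatten_sublist_of_mem_parens {t s : ParSeq} (h : s ∈ t.parens) :
    s.flatten.Sublist t.flatten := by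
  induction t with
  | nil => simp [parens] at h
  | elem a r ih => exact (ih h).cons a
  | paren s' r ih1 ih2 =>
    simp only [parens, List.mem_cons, List.mem_append] at h
    rcases h with rfl | h | h
    · exact List.sublist_append_left _ _
    · exact (ih1 h).trans (List.sublist_append_left _ _)
    · exact (ih2 h).trans (List.sublist_append_right _ _)

theorem mem_parens_of_mem_children {t s : ParSeq} (h : s ∈ t.children) : s ∈ t.parens := by
  induction t with
  | nil => simp [children] at h
  | elem a r ih => exact ih h
  | paren s' r _ ih =>
    simp only [children, parens, List.mem_cons, List.mem_append] at h ⊢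
    exact h.imp id fun h => Or.inr (ih h)

theorem mem_parens_trans {T t s : ParSeq} (h : t ∈ T.parens) (hs : s ∈ t.parens) :
    s ∈ T.parens := by
  induction T with
  | nil => simp [parens] at h
  | elem a r ih => exact ih h
  | paren s' r ih1 ih2 =>
    simp only [parens, List.mem_cons, List.mem_append] at h ⊢
    rcases h with rfl | h | h
    · exact Or.inr (Or.inl hs)
    · exact Or.inr (Or.inl (ih1 h))
    · exact Or.inr (Or.inr (ih2 h))

/-- An insertion before a value which does not occur changes nothing. -/
theorem insertFriend_of_not_mem {n m : ℕ} (t : ParSeq) (fam : List ℕ) (h : m ∉ t.flatten) :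
    t.insertFriend n m fam = t := by
  induction t generalizing fam with
  | nil => rfl
  | elem v r ih =>
    simp only [flatten, List.mem_cons, not_or] at h
    have hv : v ≠ m := fun e => h.1 e.symm
    rw [insertFriend, if_neg hv, ih _ h.2]
  | paren s r ih1 ih2 =>
    simp only [flatten, List.mem_append, not_or] at h
    rw [insertFriend, ih1 _ h.1, ih2 _ h.2]

theorem flatten_insertFriend {n m : ℕ} (t : ParSeq) (fam : List ℕ) (h : t.flatten.Nodup) :
    (t.insertFriend n m fam).flatten = insertBefore n m t.flatten := by
  induction t generalizing fam with
  | nil => rfl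
  | elem v r ih =>
    simp only [flatten, List.nodup_cons] at h
    rw [insertFriend]
    split_ifs with h1 h2
    · subst h1; simp [flatten, insertBefore]
    · subst h1; simp [flatten, insertBefore]
    · simp [flatten, insertBefore, h1, ih _ h.2]
  | paren s r ih1 ih2 =>
    simp only [flatten] at h ⊢
    have hd := List.nodup_append.1 h
    rw [insertFriend, flatten, ih1 _ hd.1, ih2 _ hd.2.1, insertBefore_append_of_nodup h]

/-- If the friend is in an inner parenthesis, the active family does not change. -/
theorem active_insertFriend_of_not_mem {n m : ℕ} (t : ParSeq) (fam : List ℕ) (h : m ∉ t.active) :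
    (t.insertFriend n m fam).active = t.active := by
  induction t with
  | nil => rfl
  | elem v r ih =>
    simp only [active, List.mem_cons, not_or] at h
    have hv : v ≠ m := fun e => h.1 e.symm
    rw [insertFriend, if_neg hv, active, ih h.2, active]
  | paren s r _ ih => rw [insertFriend, active, ih h, active]

/-- If the new value can join, it is inserted into the active family. -/
theorem active_insertFriend_of_fit {n m : ℕ} (t : ParSeq) (fam : List ℕ)
    (hf : IsFamily (insertBefore n m fam)) :
    (t.insertFriend n m fam).active = insertBefore n m t.active := by
  induction t with
  | nil => rfl
  | elem v r ih =>
    rw [insertFriend]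
    split_ifs with h1
    · subst h1; simp [active, insertBefore]
    · simp [active, insertBefore, h1, ih]
  | paren s r _ ih => rw [insertFriend, active, ih, active]

/-- If the new value cannot join, its friend leaves the active family. -/
theorem active_insertFriend_of_not_fit {n m : ℕ} (t : ParSeq) (fam : List ℕ)
    (hf : ¬ IsFamily (insertBefore n m fam)) :
    (t.insertFriend n m fam).active = t.active.erase m := by
  induction t with
  | nil => rfl
  | elem v r ih =>
    rw [insertFriend]
    split_ifs with h1
    · subst h1; simp [active]
    · simp only [active]
      rw [List.erase_cons_tail (by simpa using h1), ih]
  | paren s r _ ih => rw [insertFriend, active, ih, active]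

/-- If the friend is not in the active family, the insertion takes place in the inner parentheses;
it changes at most the one which contains the friend. -/
theorem children_insertFriend_of_not_mem {n m : ℕ} (t : ParSeq) (fam : List ℕ)
    (h : m ∉ t.active) :
    (t.insertFriend n m fam).children =
      t.children.map fun s => s.insertFriend n m s.active := by
  induction t with
  | nil => rfl
  | elem v r ih =>
    simp only [active, List.mem_cons, not_or] at h
    have hv : v ≠ m := fun e => h.1 e.symm
    rw [insertFriend, if_neg hv, children, ih h.2, children]
  | paren s r _ ih => rw [insertFriend, children, ih h, children, List.map_cons]

theorem children_insertFriend_of_fit {n m : ℕ} (t : ParSeq) (fam : List ℕ)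
    (h : t.flatten.Nodup) (hm : m ∈ t.active) (hf : IsFamily (insertBefore n m fam)) :
    (t.insertFriend n m fam).children = t.children := by
  induction t with
  | nil => rfl
  | elem v r ih =>
    simp only [flatten, List.nodup_cons] at h
    rw [insertFriend]
    split_ifs with h1
    · rfl
    · rw [children, children]
      apply ih h.2
      simp only [active, List.mem_cons] at hm
      exact hm.resolve_left fun e => h1 e.symm
  | paren s r _ ih =>
    have hd := List.nodup_append.1 h
    have hs : m ∉ s.flatten := fun hs => hd.2.2 m hs m (mem_flatten_of_mem_active hm) rfl
    rw [insertFriend, children, insertFriend_of_not_mem s _ hs, ih hd.2.1 hm, children]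

/-- If the new value cannot join, it forms a new inner parenthesis with its friend. -/
theorem mem_children_insertFriend_of_not_fit {n m : ℕ} (t : ParSeq) (fam : List ℕ)
    (h : t.flatten.Nodup) (hm : m ∈ t.active) (hf : ¬ IsFamily (insertBefore n m fam))
    (s : ParSeq) :
    s ∈ (t.insertFriend n m fam).children ↔ s = elem n (elem m nil) ∨ s ∈ t.children := by
  induction t with
  | nil => simp [active] at hm
  | elem v r ih =>
    simp only [flatten, List.nodup_cons] at h
    rw [insertFriend]
    split_ifs with h1
    · subst h1; simp [children]
    · rw [children, children]
      apply ih h.2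
      simp only [active, List.mem_cons] at hm
      exact hm.resolve_left fun e => h1 e.symm
  | paren s' r _ ih =>
    have hd := List.nodup_append.1 h
    have hs : m ∉ s'.flatten := fun hs => hd.2.2 m hs m (mem_flatten_of_mem_active hm) rfl
    rw [insertFriend, children, insertFriend_of_not_mem s' _ hs, children, List.mem_cons,
      List.mem_cons, ih hd.2.1 hm]
    tauto

theorem least_spec {t : ParSeq} (h : t.flatten ≠ []) :
    t.least ∈ t.flatten ∧ ∀ x ∈ t.flatten, t.least ≤ x := by
  unfold least
  cases e : t.flatten.min? with
  | none => rw [List.min?_eq_none_iff] at e; exact absurd e h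
  | some a =>
    rw [List.min?_eq_some_iff] at e
    exact e

theorem least_eq {t : ParSeq} {a : ℕ} (h : a ∈ t.flatten) (h' : ∀ x ∈ t.flatten, a ≤ x) :
    t.least = a := by
  obtain ⟨h1, h2⟩ := least_spec (List.ne_nil_of_mem h)
  exact le_antisymm (h2 a h) (h' _ h1)

/-- The founder does not change, since the new value is larger. -/
theorem least_insertFriend {n m : ℕ} (t : ParSeq) (fam : List ℕ) (h : t.flatten.Nodup)
    (hmn : m < n) : (t.insertFriend n m fam).least = t.least := by
  by_cases hm : m ∈ t.flatten
  · obtain ⟨h1, h2⟩ := least_spec (List.ne_nil_of_mem hm)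
    apply least_eq
    · rw [flatten_insertFriend t fam h, mem_insertBefore hm]
      exact Or.inr h1
    · intro x hx
      rw [flatten_insertFriend t fam h, mem_insertBefore hm] at hx
      rcases hx with rfl | hx
      · have := h2 m hm; omega
      · exact h2 x hx
  · rw [insertFriend_of_not_mem t fam hm]

theorem least_pair {n m : ℕ} (h : m < n) : (elem n (elem m nil)).least = m := by
  apply least_eq
  · simp [flatten]
  · intro x hx
    simp [flatten] at hx
    omega

/-- The numbered values do not change if the friend is in an inner parenthesis. -/
theorem founders_insertFriend_of_not_mem {n m : ℕ} (t : ParSeq) (fam : List ℕ)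
    (h : t.flatten.Nodup) (hmn : m < n) (hm : m ∉ t.active) :
    (t.insertFriend n m fam).founders = t.founders := by
  induction t with
  | nil => rfl
  | elem v r ih =>
    simp only [active, List.mem_cons, not_or] at hm
    simp only [flatten, List.nodup_cons] at h
    have hv : v ≠ m := fun e => hm.1 e.symm
    rw [insertFriend, if_neg hv, founders, ih h.2 hm.2, founders]
  | paren s r _ ih =>
    have hd := List.nodup_append.1 h
    rw [insertFriend, founders, ih hd.2.1 hm, least_insertFriend s _ hd.1 hmn, founders]

/-- If the new value joins the active family, it is one more numbered value. -/
theorem founders_insertFriend_of_fit {n m : ℕ} (t : ParSeq) (fam : List ℕ)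
    (h : t.flatten.Nodup) (hm : m ∈ t.active) (hf : IsFamily (insertBefore n m fam)) :
    (t.insertFriend n m fam).founders.Perm (n :: t.founders) := by
  induction t with
  | nil => simp [active] at hm
  | elem v r ih =>
    simp only [flatten, List.nodup_cons] at h
    rw [insertFriend]
    split_ifs with h1
    · simp [founders]
    · rw [founders, founders]
      simp only [active, List.mem_cons] at hm
      exact ((ih h.2 (hm.resolve_left fun e => h1 e.symm)).cons v).trans (List.Perm.swap _ _ _)
  | paren s r _ ih =>
    have hd := List.nodup_append.1 h
    have hs : m ∉ s.flatten := fun hs => hd.2.2 m hs m (mem_flatten_of_mem_active hm) rfl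
    rw [insertFriend, founders, insertFriend_of_not_mem s _ hs, founders]
    exact ((ih hd.2.1 hm).cons _).trans (List.Perm.swap _ _ _)

/-- If the new value forms a new parenthesis with its friend, the friend is numbered as its
founder instead of as a member, so that the numbered values do not change. -/
theorem founders_insertFriend_of_not_fit {n m : ℕ} (t : ParSeq) (fam : List ℕ)
    (h : t.flatten.Nodup) (hmn : m < n) (hm : m ∈ t.active)
    (hf : ¬ IsFamily (insertBefore n m fam)) :
    (t.insertFriend n m fam).founders = t.founders := by
  induction t with
  | nil => rfl
  | elem v r ih =>
    simp only [flatten, List.nodup_cons] at h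
    rw [insertFriend]
    split_ifs with h1
    · subst h1; rw [founders, founders, least_pair hmn]
    · rw [founders, founders]
      simp only [active, List.mem_cons] at hm
      rw [ih h.2 (hm.resolve_left fun e => h1 e.symm)]
  | paren s r _ ih =>
    have hd := List.nodup_append.1 h
    have hs : m ∉ s.flatten := fun hs => hd.2.2 m hs m (mem_flatten_of_mem_active hm) rfl
    rw [insertFriend, founders, insertFriend_of_not_mem s _ hs, founders, ih hd.2.1 hm]

/-- After the insertion of `n` before `m`, every parenthesis arises from a former one by the
insertion, except possibly for the new parenthesis `(n m)`. -/
theorem mem_parens_insertFriend {n m : ℕ} (t : ParSeq) (fam : List ℕ) (h : t.flatten.Nodup)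
    {s : ParSeq} (hs : s ∈ (t.insertFriend n m fam).parens) :
    (s = elem n (elem m nil) ∧ ¬ IsFamily (insertBefore n m fam)) ∨
      (s = elem n (elem m nil) ∧ ∃ s' ∈ t.parens, ¬ IsFamily (insertBefore n m s'.active)) ∨
      ∃ s' ∈ t.parens, s = s'.insertFriend n m s'.active := by
  induction t generalizing fam with
  | nil => simp [insertFriend, parens] at hs
  | elem v r ih =>
    simp only [flatten, List.nodup_cons] at h
    rw [insertFriend] at hs
    have hr : ∀ s ∈ r.parens, v = m → s.insertFriend n m s.active = s := by
      intro s hs' e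
      exact insertFriend_of_not_mem s _ fun hv =>
        h.1 ((flatten_sublist_of_mem_parens hs').subset (e ▸ hv))
    split_ifs at hs with h1 h2
    · exact Or.inr (Or.inr ⟨s, hs, (hr s hs h1).symm⟩)
    · simp only [parens, List.mem_cons, List.nil_append] at hs
      rcases hs with rfl | hs
      · exact Or.inl ⟨by rw [h1], h2⟩
      · exact Or.inr (Or.inr ⟨s, hs, (hr s hs h1).symm⟩)
    · exact ih fam h.2 hs
  | paren s₁ r ih1 ih2 =>
    have hd := List.nodup_append.1 h
    rw [insertFriend] at hs
    simp only [parens, List.mem_cons, List.mem_append] at hs ⊢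
    rcases hs with rfl | hs | hs
    · exact Or.inr (Or.inr ⟨s₁, Or.inl rfl, rfl⟩)
    · rcases ih1 _ hd.1 hs with ⟨e, h1⟩ | ⟨e, s', h1, h2⟩ | ⟨s', h1, h2⟩
      · exact Or.inr (Or.inl ⟨e, s₁, Or.inl rfl, h1⟩)
      · exact Or.inr (Or.inl ⟨e, s', Or.inr (Or.inl h1), h2⟩)
      · exact Or.inr (Or.inr ⟨s', Or.inr (Or.inl h1), h2⟩)
    · rcases ih2 fam hd.2.1 hs with h1 | ⟨e, s', h1, h2⟩ | ⟨s', h1, h2⟩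
      · exact Or.inl h1
      · exact Or.inr (Or.inl ⟨e, s', Or.inr (Or.inr h1), h2⟩)
      · exact Or.inr (Or.inr ⟨s', Or.inr (Or.inr h1), h2⟩)

/-! ### Nodes and buds -/

theorem bud_sublist_flatten (t : ParSeq) : t.bud.Sublist t.flatten := List.filter_sublist

theorem node_sublist_flatten (t : ParSeq) : t.node.Sublist t.flatten := by
  induction t with
  | nil => exact List.Sublist.refl _
  | elem a r ih => exact ih.cons_cons a
  | paren s r _ ih => exact (bud_sublist_flatten s).append ih

theorem active_sublist_node (t : ParSeq) : t.active.Sublist t.node := by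
  induction t with
  | nil => exact List.Sublist.refl _
  | elem a r ih => exact ih.cons_cons a
  | paren s r _ ih => exact ih.trans (List.sublist_append_right _ _)

/-- The bud does not change when a third or later element enters a parenthesis. -/
theorem bud_insertFriend {n m : ℕ} (t : ParSeq) (fam : List ℕ) (h : t.flatten.Nodup)
    (hn : ∀ x ∈ t.flatten, x < n) (h2 : 2 ≤ t.flatten.length) :
    (t.insertFriend n m fam).bud = t.bud := by
  by_cases hm : m ∈ t.flatten
  · unfold bud
    rw [flatten_insertFriend t fam h, filter_insertBefore]
    · apply List.filter_congr
      intro x hx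
      rw [rank_insertBefore (hn x hx)]
    · rw [rank_insertBefore_self hm hn]
      simp; omega
  · rw [insertFriend_of_not_mem t fam hm]

theorem bud_pair {n m : ℕ} (h : m < n) : (elem n (elem m nil)).bud = [n, m] := by
  have h1 : ¬ n ≤ m := by omega
  simp [bud, flatten, rank, h.le, h1]

/-- The node does not change if the friend is not in the active family. -/
theorem node_insertFriend_of_not_mem {n m : ℕ} (t : ParSeq) (fam : List ℕ) (h : t.flatten.Nodup)
    (hn : ∀ x ∈ t.flatten, x < n) (h2 : ∀ s ∈ t.children, 2 ≤ s.flatten.length)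
    (hm : m ∉ t.active) : (t.insertFriend n m fam).node = t.node := by
  induction t with
  | nil => rfl
  | elem v r ih =>
    simp only [active, List.mem_cons, not_or] at hm
    simp only [flatten, List.nodup_cons] at h
    have hv : v ≠ m := fun e => hm.1 e.symm
    rw [insertFriend, if_neg hv, node, ih h.2 (fun x hx => hn x (by simp [flatten, hx])) h2 hm.2,
      node]
  | paren s r _ ih =>
    have hd := List.nodup_append.1 h
    rw [insertFriend, node, ih hd.2.1 (fun x hx => hn x (by simp [flatten, hx]))
      (fun s' hs' => h2 s' (by simp [children, hs'])) hm,
      bud_insertFriend s _ hd.1 (fun x hx => hn x (by simp [flatten, hx]))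
      (h2 s (by simp [children])), node]

/-- If the friend is in the active family, the new value enters the node before it: as a member,
or in the new bud `(n m)`. -/
theorem node_insertFriend_of_mem {n m : ℕ} (t : ParSeq) (fam : List ℕ) (h : t.flatten.Nodup)
    (hmn : m < n) (hm : m ∈ t.active) :
    (t.insertFriend n m fam).node = insertBefore n m t.node := by
  induction t with
  | nil => rfl
  | elem v r ih =>
    simp only [flatten, List.nodup_cons] at h
    rw [insertFriend]
    split_ifs with h1 hf
    · subst h1; simp [node, insertBefore]
    · subst h1; simp [node, insertBefore, bud_pair hmn]
    · simp only [active, List.mem_cons] at hm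
      rw [node, ih h.2 (hm.resolve_left fun e => h1 e.symm), node, insertBefore, if_neg h1]
  | paren s r _ ih =>
    have hd := List.nodup_append.1 h
    have hs : m ∉ s.flatten := fun hs => hd.2.2 m hs m (mem_flatten_of_mem_active hm) rfl
    have hb : m ∉ s.bud := fun hb => hs ((bud_sublist_flatten s).subset hb)
    rw [insertFriend, node, insertFriend_of_not_mem s _ hs, ih hd.2.1 hm, node,
      insertBefore_append_right hb]

/-! ### Appending a singlet -/

theorem flatten_appendSinglet (n : ℕ) (t : ParSeq) :
    (t.appendSinglet n).flatten = t.flatten ++ [n] := by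
  induction t with
  | nil => rfl
  | elem v r ih => rw [appendSinglet, flatten, ih, flatten]; rfl
  | paren s r _ ih => rw [appendSinglet, flatten, ih, flatten, List.append_assoc]

theorem active_appendSinglet (n : ℕ) (t : ParSeq) : (t.appendSinglet n).active = t.active := by
  induction t with
  | nil => rfl
  | elem v r ih => rw [appendSinglet, active, ih, active]
  | paren s r _ ih => rw [appendSinglet, active, ih, active]

theorem children_appendSinglet (n : ℕ) (t : ParSeq) :
    (t.appendSinglet n).children = t.children ++ [elem n nil] := by
  induction t with
  | nil => rfl
  | elem v r ih => rw [appendSinglet, children, ih, children]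
  | paren s r _ ih => rw [appendSinglet, children, ih, children]; rfl

theorem mem_parens_appendSinglet {n : ℕ} {t s : ParSeq} :
    s ∈ (t.appendSinglet n).parens ↔ s ∈ t.parens ∨ s = elem n nil := by
  induction t with
  | nil => simp [appendSinglet, parens]
  | elem v r ih => rw [appendSinglet, parens, ih, parens]
  | paren s r _ ih =>
    simp only [appendSinglet, parens, List.mem_cons, List.mem_append, ih]
    tauto

/-! ### Well-formed sequences with parentheses -/

/-- The conditions on the parenthesized forms of permutations: distinct positive numbers, all of
them in parentheses; every outermost parenthesis is a singlet, or its active family is a family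
with at least two elements; the latter holds for all the inner parentheses. -/
structure WellFormed (T : ParSeq) : Prop where
  nodup : T.flatten.Nodup
  pos : ∀ x ∈ T.flatten, 0 < x
  active_nil : T.active = []
  family : ∀ t ∈ T.parens, (∃ v, t = elem v nil) ∨ (IsFamily t.active ∧ 2 ≤ t.active.length)
  inner : ∀ t ∈ T.parens, ∀ s ∈ t.children, IsFamily s.active ∧ 2 ≤ s.active.length

theorem wellFormed_nil : WellFormed nil :=
  ⟨by simp [flatten], by simp [flatten], rfl, by simp [parens], by simp [parens]⟩

theorem WellFormed.nodup_of_mem {T t : ParSeq} (hT : T.WellFormed) (ht : t ∈ T.parens) :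
    t.flatten.Nodup := hT.nodup.sublist (flatten_sublist_of_mem_parens ht)

theorem WellFormed.appendSinglet {T : ParSeq} (hT : T.WellFormed) {n : ℕ}
    (hn : ∀ x ∈ T.flatten, x < n) (h0 : 0 < n) : (T.appendSinglet n).WellFormed := by
  refine ⟨?_, ?_, ?_, ?_, ?_⟩
  · rw [flatten_appendSinglet, List.nodup_append]
    refine ⟨hT.nodup, by simp, ?_⟩
    rintro a ha b hb rfl
    simp at hb
    exact absurd (hn a ha) (by omega)
  · intro x hx
    rw [flatten_appendSinglet] at hx
    rcases List.mem_append.1 hx with hx | hx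
    · exact hT.pos x hx
    · simp at hx; omega
  · rw [active_appendSinglet, hT.active_nil]
  · intro t ht
    rcases mem_parens_appendSinglet.1 ht with ht | rfl
    · exact hT.family t ht
    · exact Or.inl ⟨n, rfl⟩
  · intro t ht s hs
    rcases mem_parens_appendSinglet.1 ht with ht | rfl
    · exact hT.inner t ht s hs
    · simp [children] at hs

theorem isFamily_pair {n m : ℕ} (h : m < n) : IsFamily [n, m] :=
  IsRedBlue.isFamily (R := [n]) (B := [m])
    ⟨by simp, by simp, by simp, by simp, by simpa using h⟩

/-- The active family of a parenthesis with at least two members remains one after an insertion. -/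
theorem family_insertFriend {n m : ℕ} {t : ParSeq}
    (hpos : ∀ x ∈ t.flatten, 0 < x) (hn : ∀ x ∈ t.flatten, x < n)
    (hf : IsFamily t.active ∧ 2 ≤ t.active.length) :
    IsFamily (t.insertFriend n m t.active).active ∧
      2 ≤ (t.insertFriend n m t.active).active.length := by
  by_cases hm : m ∈ t.active
  · by_cases hfit : IsFamily (insertBefore n m t.active)
    · rw [active_insertFriend_of_fit t _ hfit, length_insertBefore hm]
      exact ⟨hfit, by omega⟩
    · rw [active_insertFriend_of_not_fit t _ hfit]
      have := isFamily_erase hf.1 hf.2 (fun x hx => hpos x (mem_flatten_of_mem_active hx)) hm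
        (fun x hx => hn x (mem_flatten_of_mem_active hx)) hfit
      exact ⟨this.1, this.2.1⟩
  · rw [active_insertFriend_of_not_mem t _ hm]
    exact hf

/-- The new value cannot remain outside a singlet: it joins it, which leads to the same
parenthesis `(n m)` as the formation of a new one. -/
theorem insertFriend_singlet {n m v : ℕ} (h : m < n) :
    (elem v nil).insertFriend n m [v] = if v = m then elem n (elem m nil) else elem v nil := by
  rw [insertFriend]
  split_ifs with h1 h2
  · rw [h1]
  · subst h1
    exact absurd (isFamily_pair h) (by simpa [insertBefore] using h2)
  · rfl

theorem WellFormed.insertFriend {T : ParSeq} (hT : T.WellFormed) {n m : ℕ}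
    (hn : ∀ x ∈ T.flatten, x < n) (hm : m ∈ T.flatten) : (T.insertFriend n m []).WellFormed := by
  have hmn := hn m hm
  have hmem : ∀ t ∈ (T.insertFriend n m []).parens, t = elem n (elem m nil) ∨
      ∃ t' ∈ T.parens, t = t'.insertFriend n m t'.active := by
    intro t ht
    rcases mem_parens_insertFriend T _ hT.nodup ht with ⟨e, _⟩ | ⟨e, _⟩ | h
    · exact Or.inl e
    · exact Or.inl e
    · exact Or.inr h
  have hpairfam : IsFamily (elem n (elem m nil)).active ∧ 2 ≤ (elem n (elem m nil)).active.length :=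
    ⟨isFamily_pair hmn, le_rfl⟩
  have hfam : ∀ t ∈ T.parens, IsFamily t.active ∧ 2 ≤ t.active.length →
      IsFamily (t.insertFriend n m t.active).active ∧
        2 ≤ (t.insertFriend n m t.active).active.length := by
    intro t ht h
    have hsub := (flatten_sublist_of_mem_parens ht).subset
    exact family_insertFriend (fun x hx => hT.pos x (hsub hx))
      (fun x hx => hn x (hsub hx)) h
  refine ⟨?_, ?_, ?_, ?_, ?_⟩
  · rw [flatten_insertFriend T _ hT.nodup]
    exact nodup_insertBefore hT.nodup fun h => absurd (hn n h) (lt_irrefl n)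
  · intro x hx
    rw [flatten_insertFriend T _ hT.nodup, mem_insertBefore hm] at hx
    rcases hx with rfl | hx
    · omega
    · exact hT.pos x hx
  · rw [active_insertFriend_of_not_mem _ _ (by simp [hT.active_nil]), hT.active_nil]
  · intro t ht
    rcases hmem t ht with rfl | ⟨t', ht', rfl⟩
    · exact Or.inr hpairfam
    · rcases hT.family t' ht' with ⟨v, rfl⟩ | h
      · change (∃ w, (elem v nil).insertFriend n m [v] = _) ∨
          (IsFamily ((elem v nil).insertFriend n m [v]).active ∧
            2 ≤ ((elem v nil).insertFriend n m [v]).active.length)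
        rw [insertFriend_singlet hmn]
        split_ifs
        · exact Or.inr hpairfam
        · exact Or.inl ⟨v, rfl⟩
      · exact Or.inr (hfam t' ht' h)
  · intro t ht s hs
    rcases hmem t ht with rfl | ⟨t', ht', rfl⟩
    · simp [children] at hs
    · have hchild : ∀ s ∈ t'.children, s ∈ T.parens := fun s hs =>
        mem_parens_trans ht' (mem_parens_of_mem_children hs)
      by_cases hmt : m ∈ t'.active
      · by_cases hfit : IsFamily (insertBefore n m t'.active)
        · rw [children_insertFriend_of_fit t' _ (hT.nodup_of_mem ht') hmt hfit] at hs
          exact hT.inner t' ht' s hs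
        · rw [mem_children_insertFriend_of_not_fit t' _ (hT.nodup_of_mem ht') hmt hfit] at hs
          rcases hs with rfl | hs
          · exact hpairfam
          · exact hT.inner t' ht' s hs
      · rw [children_insertFriend_of_not_mem t' _ hmt] at hs
        obtain ⟨s', hs', rfl⟩ := List.mem_map.1 hs
        exact hfam s' (hchild s' hs') (hT.inner t' ht' s' hs')

/-! ### The heads of the parentheses -/

/-- `Located T h t`: the parenthesis with content `t` of the sequence `T` has the head `h`.
Singlet parentheses are included. -/
inductive Located (T : ParSeq) : List ℕ → ParSeq → Prop where
  | root {i : ℕ} {t : ParSeq} (h : T.children[i]? = some t) : Located T [i + 1] t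
  | child {h : List ℕ} {t s : ParSeq} (ht : Located T h t) (hs : s ∈ t.children) :
      Located T (h ++ [rank t.founders s.least]) s

theorem Located.mem_parens {T t : ParSeq} {h : List ℕ} (ht : Located T h t) : t ∈ T.parens := by
  induction ht with
  | root h => exact mem_parens_of_mem_children (List.mem_of_getElem? h)
  | child _ hs ih => exact mem_parens_trans ih (mem_parens_of_mem_children hs)

theorem Located.ne_nil {T t : ParSeq} {h : List ℕ} (ht : Located T h t) : h ≠ [] := by
  cases ht <;> simp

theorem Located.flatten_sublist {T t : ParSeq} {h : List ℕ} (ht : Located T h t) :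
    t.flatten.Sublist T.flatten := flatten_sublist_of_mem_parens ht.mem_parens

/-- The parentheses inside a parenthesis with head `h` have heads which begin with `h`. -/
theorem Located.exists_of_mem_parens {T t s : ParSeq} {h : List ℕ} (ht : Located T h t)
    (hs : s ∈ t.parens) : ∃ x, Located T (h ++ x) s := by
  have key : ∀ (r t : ParSeq) (h : List ℕ), Located T h t → r.children ⊆ t.children →
      ∀ s ∈ r.parens, ∃ x, Located T (h ++ x) s := by
    intro r
    induction r with
    | nil => intro t h _ _ s hs; simp [parens] at hs
    | elem v r ih => intro t h ht hr s hs; exact ih t h ht hr s hs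
    | paren u r ih1 ih2 =>
      intro t h ht hr s hs
      have hu := ht.child (s := u) (hr (by simp [children]))
      simp only [parens, List.mem_cons, List.mem_append] at hs
      rcases hs with rfl | hs | hs
      · exact ⟨_, hu⟩
      · obtain ⟨x, hx⟩ := ih1 u _ hu (List.Subset.refl _) s hs
        exact ⟨_, by rwa [List.append_assoc] at hx⟩
      · exact ih2 t h ht (fun y hy => hr (by simp [children, hy])) s hs
  exact key t t h ht (List.Subset.refl _) s hs

theorem mem_parens_iff {T s : ParSeq} :
    s ∈ T.parens ↔ ∃ t ∈ T.children, s = t ∨ s ∈ t.parens := by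
  induction T with
  | nil => simp [parens, children]
  | elem v r ih => exact ih
  | paren u r _ ih =>
    simp only [parens, children, List.mem_cons, List.mem_append, ih]
    constructor
    · rintro (rfl | h | ⟨t, h1, h2⟩)
      · exact ⟨_, Or.inl rfl, Or.inl rfl⟩
      · exact ⟨_, Or.inl rfl, Or.inr h⟩
      · exact ⟨t, Or.inr h1, h2⟩
    · rintro ⟨t, rfl | h1, h2⟩
      · exact h2.imp id Or.inl
      · exact Or.inr (Or.inr ⟨t, h1, h2⟩)

/-- Every parenthesis has a head. -/
theorem exists_located {T t : ParSeq} (ht : t ∈ T.parens) : ∃ h, Located T h t := by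
  obtain ⟨u, hu, h⟩ := mem_parens_iff.1 ht
  obtain ⟨i, hi⟩ := List.mem_iff_getElem?.1 hu
  have hroot := Located.root hi
  rcases h with rfl | h
  · exact ⟨_, hroot⟩
  · obtain ⟨x, hx⟩ := hroot.exists_of_mem_parens h
    exact ⟨_, hx⟩

theorem mem_founders_of_mem_active {t : ParSeq} {v : ℕ} (h : v ∈ t.active) : v ∈ t.founders := by
  induction t with
  | nil => simp [active] at h
  | elem a r ih =>
    simp only [active, founders, List.mem_cons] at h ⊢
    exact h.imp id ih
  | paren s r _ ih => exact List.mem_cons_of_mem _ (ih h)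

theorem least_mem_founders {t s : ParSeq} (h : s ∈ t.children) : s.least ∈ t.founders := by
  induction t with
  | nil => simp [children] at h
  | elem a r ih => exact List.mem_cons_of_mem _ (ih h)
  | paren s' r _ ih =>
    simp only [children, founders, List.mem_cons] at h ⊢
    rcases h with rfl | h
    · exact Or.inl rfl
    · exact Or.inr (ih h)

/-- The numbered values of a parenthesis are the members of its active family and the founders of
its immediate inner parentheses. -/
theorem mem_founders_iff {t : ParSeq} {x : ℕ} :
    x ∈ t.founders ↔ x ∈ t.active ∨ ∃ s ∈ t.children, x = s.least := by
  induction t with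
  | nil => simp [founders, active, children]
  | elem a r ih => simp only [founders, active, children, List.mem_cons, ih]; tauto
  | paren s r _ ih =>
    simp only [founders, active, children, List.mem_cons, ih]
    constructor
    · rintro (h | h | ⟨s', h1, h2⟩)
      · exact Or.inr ⟨s, Or.inl rfl, h⟩
      · exact Or.inl h
      · exact Or.inr ⟨s', Or.inr h1, h2⟩
    · rintro (h | ⟨s', rfl | h1, h2⟩)
      · exact Or.inr (Or.inl h)
      · exact Or.inl h2
      · exact Or.inr (Or.inr ⟨s', h1, h2⟩)

theorem length_founders (t : ParSeq) :
    t.founders.length = t.active.length + t.children.length := by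
  induction t with
  | nil => rfl
  | elem a r ih => simp only [founders, active, children, List.length_cons, ih]; omega
  | paren s r _ ih => simp only [founders, active, children, List.length_cons, ih]; omega

theorem mem_flatten_iff {t : ParSeq} {v : ℕ} :
    v ∈ t.flatten ↔ v ∈ t.active ∨ ∃ s ∈ t.children, v ∈ s.flatten := by
  induction t with
  | nil => simp [flatten, active, children]
  | elem a r ih => simp only [flatten, active, children, List.mem_cons, ih]; tauto
  | paren s r _ ih =>
    simp only [flatten, active, children, List.mem_cons, List.mem_append, ih]
    constructor
    · rintro (h | h | ⟨s', h1, h2⟩)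
      · exact Or.inr ⟨s, Or.inl rfl, h⟩
      · exact Or.inl h
      · exact Or.inr ⟨s', Or.inr h1, h2⟩
    · rintro (h | ⟨s', rfl | h1, h2⟩)
      · exact Or.inr (Or.inl h)
      · exact Or.inl h2
      · exact Or.inr (Or.inr ⟨s', h1, h2⟩)

/-- The members of the active family are outside the inner parentheses. -/
theorem not_mem_active_of_mem_child {t s : ParSeq} (h : t.flatten.Nodup) (hs : s ∈ t.children)
    {v : ℕ} (hv : v ∈ s.flatten) : v ∉ t.active := by
  induction t with
  | nil => simp [active]
  | elem a r ih =>
    simp only [flatten, List.nodup_cons] at h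
    simp only [active, List.mem_cons, not_or]
    refine ⟨?_, ih h.2 hs⟩
    rintro rfl
    exact h.1 ((flatten_sublist_of_mem_children (t := r) hs).subset hv)
  | paren s' r _ ih =>
    have hd := List.nodup_append.1 h
    simp only [children, List.mem_cons] at hs
    rcases hs with rfl | hs
    · exact fun ha => hd.2.2 v hv v (mem_flatten_of_mem_active ha) rfl
    · exact ih hd.2.1 hs

/-- Different inner parentheses are disjoint. -/
theorem eq_of_mem_children {t s s' : ParSeq} (h : t.flatten.Nodup) (hs : s ∈ t.children)
    (hs' : s' ∈ t.children) {v : ℕ} (hv : v ∈ s.flatten) (hv' : v ∈ s'.flatten) : s = s' := by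
  induction t with
  | nil => simp [children] at hs
  | elem a r ih =>
    simp only [flatten, List.nodup_cons] at h
    exact ih h.2 hs hs'
  | paren u r _ ih =>
    have hd := List.nodup_append.1 h
    simp only [children, List.mem_cons] at hs hs'
    rcases hs with rfl | hs <;> rcases hs' with rfl | hs'
    · rfl
    · exact absurd rfl (hd.2.2 v hv v ((flatten_sublist_of_mem_children hs').subset hv'))
    · exact absurd rfl (hd.2.2 v hv' v ((flatten_sublist_of_mem_children hs).subset hv))
    · exact ih hd.2.1 hs hs'

theorem WellFormed.active_ne_nil {T t : ParSeq} (hT : T.WellFormed) (ht : t ∈ T.parens) :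
    t.active ≠ [] := by
  rcases hT.family t ht with ⟨v, rfl⟩ | h
  · simp [active]
  · intro e; rw [e] at h; simp at h

theorem WellFormed.flatten_ne_nil {T t : ParSeq} (hT : T.WellFormed) (ht : t ∈ T.parens) :
    t.flatten ≠ [] := by
  obtain ⟨v, hv⟩ := List.exists_mem_of_ne_nil _ (hT.active_ne_nil ht)
  exact List.ne_nil_of_mem (mem_flatten_of_mem_active hv)

theorem WellFormed.least_mem {T t : ParSeq} (hT : T.WellFormed) (ht : t ∈ T.parens) :
    t.least ∈ t.flatten := (least_spec (hT.flatten_ne_nil ht)).1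

theorem WellFormed.child_mem {T t s : ParSeq} (_ : T.WellFormed) (ht : t ∈ T.parens)
    (hs : s ∈ t.children) : s ∈ T.parens := mem_parens_trans ht (mem_parens_of_mem_children hs)

/-- A head determines the parenthesis. -/
theorem Located.eq {T t t' : ParSeq} {h : List ℕ} (hT : T.WellFormed) (ht : Located T h t)
    (ht' : Located T h t') : t = t' := by
  induction ht generalizing t' with
  | @root i t hi =>
    generalize hh : [i + 1] = h at ht'
    cases ht' with
    | @root j _ hj =>
      simp at hh
      subst hh
      rw [hi] at hj
      exact Option.some.inj hj
    | child ht' hs =>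
      have := (List.append_inj' (s₁ := []) hh rfl).1
      exact absurd this.symm ht'.ne_nil
  | @child h t s ht hs ih =>
    generalize hh : h ++ [rank t.founders s.least] = g at ht'
    cases ht' with
    | root hj =>
      have := (List.append_inj' (s₂ := []) hh rfl).1
      exact absurd this ht.ne_nil
    | @child h' u s' ht' hs' =>
      obtain ⟨e1, e2⟩ := List.append_inj' hh rfl
      subst e1
      have := ih ht'
      subst this
      simp only [List.cons.injEq, and_true] at e2
      have e3 := rank_injective (least_mem_founders hs) (least_mem_founders hs') e2
      have h1 := hT.least_mem (hT.child_mem ht.mem_parens hs)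
      have h2 := hT.least_mem (hT.child_mem ht.mem_parens hs')
      exact eq_of_mem_children (hT.nodup_of_mem ht.mem_parens) hs hs' h1 (e3 ▸ h2)

/-- The parenthesis with a head contains the parentheses with longer heads. -/
theorem Located.of_prefix {T t : ParSeq} {h g : List ℕ} (ht : Located T h t) (hg : g ≠ [])
    (hp : g <+: h) : ∃ u, Located T g u ∧ t.flatten.Sublist u.flatten := by
  induction ht with
  | @root i t hi =>
    have hl := hp.length_le
    have hl' := List.length_pos_iff.2 hg
    simp only [List.length_singleton] at hl
    have := hp.eq_of_length (by rw [List.length_singleton]; omega)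
    subst this
    exact ⟨t, .root hi, List.Sublist.refl _⟩
  | @child h t s ht hs ih =>
    rcases List.prefix_concat_iff.1 hp with rfl | hp
    · exact ⟨s, ht.child hs, List.Sublist.refl _⟩
    · obtain ⟨u, h1, h2⟩ := ih hp
      exact ⟨u, h1, (flatten_sublist_of_mem_children hs).trans h2⟩

theorem sizeOf_lt_of_mem_children {t s : ParSeq} (h : s ∈ t.children) : sizeOf s < sizeOf t := by
  induction t with
  | nil => simp [children] at h
  | elem a r ih => have := ih h; simp; omega
  | paren u r _ ih =>
    simp only [children, List.mem_cons] at h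
    rcases h with rfl | h
    · simp; omega
    · have := ih h; simp; omega

/-- Every value in a parenthesis belongs to the active family of a parenthesis inside it, the
innermost one around the value, the head of which begins with the head of the former. -/
theorem Located.exists_active {T t : ParSeq} {h : List ℕ} (ht : Located T h t) {v : ℕ}
    (hv : v ∈ t.flatten) : ∃ x s, Located T (h ++ x) s ∧ v ∈ s.active := by
  induction hk : t.flatten.length + sizeOf t using Nat.strong_induction_on generalizing h t with
  | _ k ih =>
    rcases mem_flatten_iff.1 hv with hv | ⟨s, hs, hv⟩
    · exact ⟨[], t, by simpa using ht, hv⟩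
    · have h1 := (flatten_sublist_of_mem_children hs).length_le
      have h2 := sizeOf_lt_of_mem_children hs
      obtain ⟨x, u, h3, h4⟩ := ih _ (by omega) (ht.child hs) hv rfl
      exact ⟨_, u, by rwa [List.append_assoc] at h3, h4⟩

/-! ### The decimal numbers of the values -/

/-- The decimal number of a member `v` of the active family of the parenthesis `t` with
head `h`. -/
def entryOf (h : List ℕ) (t : ParSeq) (v : ℕ) : DecimalNumber :=
  if t.active.length ≤ 1 then ⟨h, .black⟩
  else ⟨h ++ [rank t.founders v], ascentColor t.active v⟩

theorem entryOf_singlet (h : List ℕ) (v w : ℕ) : entryOf h (elem v nil) w = ⟨h, .black⟩ := by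
  simp [entryOf, active]

theorem entryOf_of_two_le {h : List ℕ} {t : ParSeq} (ht : 2 ≤ t.active.length) (v : ℕ) :
    entryOf h t v = ⟨h ++ [rank t.founders v], ascentColor t.active v⟩ := by
  rw [entryOf, if_neg (by omega)]

theorem prefix_entryOf (h : List ℕ) (t : ParSeq) (v : ℕ) : h <+: (entryOf h t v).digits := by
  unfold entryOf
  split_ifs
  · exact List.prefix_rfl
  · exact List.prefix_append _ _

/-- The entries of the values in a parenthesis are those of the members of the active family, and
those of the values in the immediate inner parentheses. -/
theorem mem_numberNode {h fs fam : List ℕ} {t : ParSeq} {e : ℕ × DecimalNumber} :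
    e ∈ numberNode h fs fam t ↔
      (∃ v ∈ t.active, e = (v, ⟨h ++ [rank fs v], ascentColor fam v⟩)) ∨
        ∃ s ∈ t.children, e ∈ numberNode (h ++ [rank fs s.least]) s.founders s.active s := by
  induction t with
  | nil => simp [numberNode, active, children]
  | elem a r ih =>
    simp only [numberNode, active, children, List.mem_cons, ih]
    constructor
    · rintro (h | ⟨v, h1, h2⟩ | h)
      · exact Or.inl ⟨a, Or.inl rfl, h⟩
      · exact Or.inl ⟨v, Or.inr h1, h2⟩
      · exact Or.inr h
    · rintro (⟨v, rfl | h1, h2⟩ | h)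
      · exact Or.inl h2
      · exact Or.inr (Or.inl ⟨v, h1, h2⟩)
      · exact Or.inr (Or.inr h)
  | paren s r _ ih =>
    simp only [numberNode, active, children, List.mem_cons, List.mem_append, ih]
    constructor
    · rintro (h | h | ⟨s', h1, h2⟩)
      · exact Or.inr ⟨s, Or.inl rfl, h⟩
      · exact Or.inl h
      · exact Or.inr ⟨s', Or.inr h1, h2⟩
    · rintro (h | ⟨s', rfl | h1, h2⟩)
      · exact Or.inr (Or.inl h)
      · exact Or.inl h2
      · exact Or.inr (Or.inr ⟨s', h1, h2⟩)

theorem numberBlocks_singlet (i v : ℕ) (r : ParSeq) :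
    numberBlocks i (paren (elem v nil) r) = (v, ⟨[i], .black⟩) :: numberBlocks (i + 1) r := by
  rw [numberBlocks]

theorem numberBlocks_paren {i : ℕ} {t r : ParSeq} (ht : 2 ≤ t.active.length) :
    numberBlocks i (paren t r) =
      numberNode [i] t.founders t.active t ++ numberBlocks (i + 1) r := by
  match t with
  | nil => simp [active] at ht
  | elem v nil => simp [active] at ht
  | elem v (elem w r') => rw [numberBlocks]; simp
  | elem v (paren w r') => rw [numberBlocks]; simp
  | paren w r' => rw [numberBlocks]; simp

/-- The numbering of the content of an outermost parenthesis with head `h`. The length of the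
active family tells singlets from the other parentheses of a well-formed sequence. -/
def numberParen (h : List ℕ) (t : ParSeq) : List (ℕ × DecimalNumber) :=
  if t.active.length ≤ 1 then t.active.map fun v => (v, ⟨h, .black⟩)
  else numberNode h t.founders t.active t

theorem mem_numberBlocks {T : ParSeq} {k : ℕ} {e : ℕ × DecimalNumber}
    (hT : ∀ t ∈ T.children, (∃ v, t = elem v nil) ∨ 2 ≤ t.active.length) :
    e ∈ numberBlocks k T ↔ ∃ i t, T.children[i]? = some t ∧ e ∈ numberParen [k + i] t := by
  induction T generalizing k with
  | nil => simp [numberBlocks, children]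
  | elem v r ih => rw [numberBlocks]; exact ih hT
  | paren t r _ ih =>
    have ih := ih (k := k + 1) fun t ht => hT t (by simp [children, ht])
    have hsplit : (∃ i u, (paren t r).children[i]? = some u ∧ e ∈ numberParen [k + i] u) ↔
        e ∈ numberParen [k] t ∨
          ∃ i u, r.children[i]? = some u ∧ e ∈ numberParen [k + 1 + i] u := by
      constructor
      · rintro ⟨i, u, h1, h2⟩
        cases i with
        | zero =>
          simp only [children, List.getElem?_cons_zero, Option.some.injEq] at h1
          subst h1; exact Or.inl h2
        | succ i =>
          refine Or.inr ⟨i, u, by simpa [children] using h1, ?_⟩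
          rwa [show k + 1 + i = k + (i + 1) by omega]
      · rintro (h | ⟨i, u, h1, h2⟩)
        · exact ⟨0, t, by simp [children], h⟩
        · refine ⟨i + 1, u, by simpa [children] using h1, ?_⟩
          rwa [show k + (i + 1) = k + 1 + i by omega]
    rw [hsplit, ← ih]
    rcases hT t (by simp [children]) with ⟨v, rfl⟩ | h2
    · rw [numberBlocks_singlet, List.mem_cons]
      simp [numberParen, active]
    · rw [numberBlocks_paren h2, List.mem_append, numberParen, if_neg (by omega)]

/-- The values with their decimal numbers are the members of the active families of all the
parentheses. -/
theorem mem_numbering {T : ParSeq} (hT : T.WellFormed) {v : ℕ} {ν : DecimalNumber} :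
    (v, ν) ∈ numberBlocks 1 T ↔ ∃ h t, Located T h t ∧ v ∈ t.active ∧ ν = entryOf h t v := by
  have hfam : ∀ t ∈ T.children, (∃ v, t = elem v nil) ∨ 2 ≤ t.active.length := fun t ht =>
    (hT.family t (mem_parens_of_mem_children ht)).imp id And.right
  have hnode : ∀ {h t s}, Located T h t → s ∈ t.children → 2 ≤ s.active.length :=
    fun ht hs => (hT.inner _ ht.mem_parens _ hs).2
  constructor
  · intro he
    obtain ⟨i, t, hi, he⟩ := (mem_numberBlocks hfam).1 he
    have hloc : Located T [i + 1] t := .root hi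
    rw [add_comm] at he
    rcases hfam t (List.mem_of_getElem? hi) with ⟨w, rfl⟩ | h2
    · refine ⟨_, _, hloc, ?_⟩
      simp only [numberParen, active, List.length_singleton, le_refl, if_true, List.map_cons,
        List.map_nil, List.mem_singleton, Prod.mk.injEq] at he ⊢
      exact ⟨he.1, by rw [entryOf_singlet]; exact he.2⟩
    · rw [numberParen, if_neg (by omega)] at he
      -- the entries below a parenthesis, by induction on its size
      have key : ∀ (k : ℕ) (h : List ℕ) (t : ParSeq), sizeOf t = k → Located T h t →
          2 ≤ t.active.length → (v, ν) ∈ numberNode h t.founders t.active t →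
          ∃ h t, Located T h t ∧ v ∈ t.active ∧ ν = entryOf h t v := by
        intro k
        induction k using Nat.strong_induction_on with
        | _ k ih =>
          intro h t hk ht h2 he
          rcases mem_numberNode.1 he with ⟨w, hw, e⟩ | ⟨s, hs, he⟩
          · simp only [Prod.mk.injEq] at e
            obtain ⟨rfl, rfl⟩ := e
            exact ⟨h, t, ht, hw, (entryOf_of_two_le h2 v).symm⟩
          · have hlt := sizeOf_lt_of_mem_children hs
            exact ih _ (by omega) _ s rfl (ht.child hs) (hnode ht hs) he
      exact key _ _ t rfl hloc h2 he
  · rintro ⟨h, t, ht, hv, rfl⟩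
    have key : ∀ {h t}, Located T h t → 2 ≤ t.active.length →
        ∀ e ∈ numberNode h t.founders t.active t, e ∈ numberBlocks 1 T := by
      intro h t ht
      induction ht with
      | @root i t hi =>
        intro h2 e he
        refine (mem_numberBlocks hfam).2 ⟨i, t, hi, ?_⟩
        rw [numberParen, if_neg (by omega), add_comm]
        exact he
      | @child h t s ht hs ih =>
        intro h2 e he
        have h3 : 2 ≤ t.active.length := by
          rcases hT.family t ht.mem_parens with ⟨w, rfl⟩ | h3
          · simp [children] at hs
          · exact h3.2
        exact ih h3 e (mem_numberNode.2 (Or.inr ⟨s, hs, he⟩))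
    rcases hT.family t ht.mem_parens with ⟨w, rfl⟩ | h2
    · rw [entryOf_singlet]
      cases ht with
      | @root i _ hi =>
        refine (mem_numberBlocks hfam).2 ⟨i, _, hi, ?_⟩
        simp only [active, List.mem_singleton] at hv
        simp [numberParen, active, hv, add_comm]
      | child ht hs =>
        have := hnode ht hs
        simp [active] at this
    · rw [entryOf_of_two_le h2.2]
      exact key ht h2.2 _ (mem_numberNode.2 (Or.inl ⟨v, hv, rfl⟩))

/-- The numbering lists the values in the order of the line. -/
theorem map_fst_numberNode (h fs fam : List ℕ) (t : ParSeq) :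
    (numberNode h fs fam t).map Prod.fst = t.flatten := by
  induction t generalizing h fs fam with
  | nil => rfl
  | elem v r ih => simp [numberNode, flatten, ih]
  | paren s r ih1 ih2 => simp [numberNode, flatten, ih1, ih2]

theorem map_fst_numberBlocks {T : ParSeq} (k : ℕ) (hT : T.active = [])
    (h2 : ∀ t ∈ T.children, (∃ v, t = elem v nil) ∨ 2 ≤ t.active.length) :
    (numberBlocks k T).map Prod.fst = T.flatten := by
  induction T generalizing k with
  | nil => rw [numberBlocks]; rfl
  | elem v r ih => simp [active] at hT
  | paren t r _ ih =>
    have ih := ih (k + 1) hT fun t ht => h2 t (by simp [children, ht])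
    rcases h2 t (by simp [children]) with ⟨v, rfl⟩ | h2
    · rw [numberBlocks_singlet, List.map_cons, ih]; rfl
    · rw [numberBlocks_paren h2, List.map_append, ih, map_fst_numberNode]; rfl

theorem WellFormed.map_fst {T : ParSeq} (hT : T.WellFormed) :
    (numberBlocks 1 T).map Prod.fst = T.flatten :=
  map_fst_numberBlocks 1 hT.active_nil fun t ht =>
    (hT.family t (mem_parens_of_mem_children ht)).imp id And.right

theorem WellFormed.numbering_unique {T : ParSeq} (hT : T.WellFormed) {v : ℕ} {ν μ : DecimalNumber}
    (h : (v, ν) ∈ numberBlocks 1 T) (h' : (v, μ) ∈ numberBlocks 1 T) : ν = μ := by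
  have hn : ((numberBlocks 1 T).map Prod.fst).Nodup := by rw [hT.map_fst]; exact hT.nodup
  have := List.inj_on_of_nodup_map hn h h' rfl
  exact (Prod.mk.inj this).2

theorem WellFormed.exists_numbering {T : ParSeq} (hT : T.WellFormed) {v : ℕ}
    (h : v ∈ T.flatten) : ∃ ν, (v, ν) ∈ numberBlocks 1 T := by
  rw [← hT.map_fst] at h
  obtain ⟨⟨w, ν⟩, h1, rfl⟩ := List.mem_map.1 h
  exact ⟨ν, h1⟩

theorem WellFormed.mem_flatten_of_numbering {T : ParSeq} (hT : T.WellFormed) {v : ℕ}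
    {ν : DecimalNumber} (h : (v, ν) ∈ numberBlocks 1 T) : v ∈ T.flatten := by
  rw [← hT.map_fst]
  exact List.mem_map.2 ⟨_, h, rfl⟩

/-- The entries with the head of a parenthesis are those of the values in it. -/
theorem Located.mem_flatten_iff {T t : ParSeq} (hT : T.WellFormed) {h : List ℕ}
    (ht : Located T h t) {v : ℕ} {ν : DecimalNumber} (hv : (v, ν) ∈ numberBlocks 1 T) :
    v ∈ t.flatten ↔ h <+: ν.digits := by
  constructor
  · intro hvt
    obtain ⟨x, s, hs, hvs⟩ := ht.exists_active hvt
    rw [hT.numbering_unique hv ((mem_numbering hT).2 ⟨_, s, hs, hvs, rfl⟩)]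
    exact (List.prefix_append _ _).trans (prefix_entryOf _ _ _)
  · intro hp
    obtain ⟨g, s, hs, hvs, rfl⟩ := (mem_numbering hT).1 hv
    have hin : h <+: g → v ∈ t.flatten := by
      intro hp
      obtain ⟨u, hu, hsub⟩ := hs.of_prefix ht.ne_nil hp
      rw [ht.eq hT hu]
      exact hsub.subset (mem_flatten_of_mem_active hvs)
    rcases hT.family s hs.mem_parens with ⟨w, rfl⟩ | h2
    · rw [entryOf_singlet] at hp
      exact hin hp
    · rw [entryOf_of_two_le h2.2] at hp
      -- the head can be equal to the digits of a value only if this value and the founder of the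
      -- parenthesis have the same number, and then they are equal
      rcases List.prefix_concat_iff.1 hp with e | hp
      · generalize hh : h = h' at ht e
        cases ht with
        | root hi =>
          have := (List.append_inj' (s₁ := []) e rfl).1
          exact absurd this.symm hs.ne_nil
        | @child g' u _ hu ht' =>
          obtain ⟨rfl, e2⟩ := List.append_inj' e rfl
          have := hu.eq hT hs
          subst this
          simp only [List.cons.injEq, and_true] at e2
          have e3 := rank_injective (least_mem_founders ht') (mem_founders_of_mem_active hvs) e2
          rw [← e3]
          exact hT.least_mem (hT.child_mem hu.mem_parens ht')
      · exact hin hp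

/-- The head of a parenthesis with a given content is unique. -/
theorem Located.head_eq {T t : ParSeq} {h h' : List ℕ} (hT : T.WellFormed) (ht : Located T h t)
    (ht' : Located T h' t) : h = h' := by
  obtain ⟨v, hv⟩ := List.exists_mem_of_ne_nil _ (hT.active_ne_nil ht.mem_parens)
  -- both heads are read off from the decimal number of a member
  have e := hT.numbering_unique ((mem_numbering hT).2 ⟨h, t, ht, hv, rfl⟩)
    ((mem_numbering hT).2 ⟨h', t, ht', hv, rfl⟩)
  have e' := congrArg DecimalNumber.digits e
  unfold entryOf at e'
  split_ifs at e'
  · exact e'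
  · exact (List.append_inj' e' rfl).1

/-- The entries `h.p.c`, where `h` is the head of a parenthesis with at least two elements, are
those of the members of its active family. -/
theorem Located.mem_active_of_entry {T t : ParSeq} (hT : T.WellFormed) {h : List ℕ}
    (ht : Located T h t) {v p : ℕ} {c : Color}
    (hv : (v, ⟨h ++ [p], c⟩) ∈ numberBlocks 1 T) :
    v ∈ t.active ∧ p = rank t.founders v ∧ c = ascentColor t.active v := by
  obtain ⟨g, s, hs, hvs, e⟩ := (mem_numbering hT).1 hv
  rcases hT.family s hs.mem_parens with ⟨w, rfl⟩ | h2
  · rw [entryOf_singlet] at e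
    cases hs with
    | root hi =>
      have := congrArg DecimalNumber.digits e
      have := (List.append_inj' (s₂ := []) this rfl).1
      exact absurd this ht.ne_nil
    | child hu hs' =>
      have := (hT.inner _ hu.mem_parens _ hs').2
      simp [active] at this
  · rw [entryOf_of_two_le h2.2] at e
    injection e with e1 e2
    obtain ⟨rfl, e3⟩ := List.append_inj' e1 rfl
    have := ht.eq hT hs
    subst this
    simp only [List.cons.injEq, and_true] at e3
    exact ⟨hvs, e3, e2⟩

/-! ### The decimal numbers after an insertion -/

/-- Appending a singlet keeps the heads of the parentheses. -/
theorem Located.appendSinglet {T t : ParSeq} {h : List ℕ} (n : ℕ) (ht : Located T h t) :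
    Located (T.appendSinglet n) h t := by
  induction ht with
  | root hi =>
    refine .root ?_
    rw [children_appendSinglet, List.getElem?_append_left (List.getElem?_eq_some_iff.1 hi).1]
    exact hi
  | child _ hs ih => exact ih.child hs

theorem located_singlet (T : ParSeq) (n : ℕ) :
    Located (T.appendSinglet n) [T.children.length + 1] (elem n nil) := by
  refine .root ?_
  rw [children_appendSinglet, List.getElem?_append_right le_rfl]
  simp

/-- After a singlet `n` is appended, every parenthesis is a former one, with the same head, or
the new singlet. -/
theorem located_appendSinglet {T t : ParSeq} {h : List ℕ} {n : ℕ}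
    (hT : (T.appendSinglet n).WellFormed) (ht : Located (T.appendSinglet n) h t) :
    Located T h t ∨ t = elem n nil := by
  rcases mem_parens_appendSinglet.1 ht.mem_parens with h1 | h1
  · obtain ⟨g, hg⟩ := exists_located h1
    rw [ht.head_eq hT (hg.appendSinglet n)]
    exact Or.inl hg
  · exact Or.inr h1

/-- Appending a singlet keeps the decimal numbers, and the new value gets the next block label. -/
theorem numbering_appendSinglet {T : ParSeq} (hT : T.WellFormed) {n : ℕ}
    (hn : ∀ x ∈ T.flatten, x < n) (h0 : 0 < n) {v : ℕ} {ν : DecimalNumber} :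
    (v, ν) ∈ numberBlocks 1 (T.appendSinglet n) ↔
      (v, ν) ∈ numberBlocks 1 T ∨ v = n ∧ ν = ⟨[T.children.length + 1], .black⟩ := by
  have hT' := hT.appendSinglet hn h0
  rw [mem_numbering hT', mem_numbering hT]
  constructor
  · rintro ⟨h, t, ht, hv, e⟩
    rcases located_appendSinglet hT' ht with h1 | rfl
    · exact Or.inl ⟨h, t, h1, hv, e⟩
    · rw [ht.head_eq hT' (located_singlet T n), entryOf_singlet] at e
      exact Or.inr ⟨by simpa [active] using hv, e⟩
  · rintro (⟨h, t, h1, hv, e⟩ | ⟨rfl, rfl⟩)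
    · exact ⟨h, t, h1.appendSinglet n, hv, e⟩
    · exact ⟨_, _, located_singlet T v, by simp [active], by rw [entryOf_singlet]⟩

/-- The digits which follow the head of a parenthesis do not change, since the new value is larger
than all the numbered ones. -/
theorem rank_founders_insertFriend {n m x : ℕ} (t : ParSeq) (h : t.flatten.Nodup) (hmn : m < n)
    (hx : x < n) : rank (t.insertFriend n m t.active).founders x = rank t.founders x := by
  by_cases hm : m ∈ t.active
  · by_cases hf : IsFamily (insertBefore n m t.active)
    · rw [rank_perm (founders_insertFriend_of_fit t _ h hm hf), rank_cons_of_lt _ hx]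
    · rw [founders_insertFriend_of_not_fit t _ h hmn hm hf]
  · rw [founders_insertFriend_of_not_mem t _ h hmn hm]

/-- Every inner parenthesis remains one, with the insertion carried out in it. -/
theorem mem_children_insertFriend {n m : ℕ} {t s : ParSeq} (h : t.flatten.Nodup)
    (hs : s ∈ t.children) :
    s.insertFriend n m s.active ∈ (t.insertFriend n m t.active).children := by
  by_cases hm : m ∈ t.active
  · have hms : m ∉ s.flatten := fun hms => not_mem_active_of_mem_child h hs hms hm
    rw [insertFriend_of_not_mem s _ hms]
    by_cases hf : IsFamily (insertBefore n m t.active)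
    · rwa [children_insertFriend_of_fit t _ h hm hf]
    · exact (mem_children_insertFriend_of_not_fit t _ h hm hf s).2 (Or.inr hs)
  · rw [children_insertFriend_of_not_mem t _ hm]
    exact List.mem_map.2 ⟨s, hs, rfl⟩

/-- An insertion keeps the heads of the parentheses. -/
theorem Located.insertFriend {T t : ParSeq} {h : List ℕ} (hT : T.WellFormed) {n m : ℕ}
    (hn : ∀ x ∈ T.flatten, x < n) (hmn : m < n) (ht : Located T h t) :
    Located (T.insertFriend n m []) h (t.insertFriend n m t.active) := by
  induction ht with
  | root hi =>
    refine .root ?_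
    rw [children_insertFriend_of_not_mem T _ (by simp [hT.active_nil]), List.getElem?_map, hi]
    rfl
  | @child h t s ht hs ih =>
    have h1 := ih.child (mem_children_insertFriend (hT.nodup_of_mem ht.mem_parens) hs)
    have hs' := hT.child_mem ht.mem_parens hs
    have hlt : s.least < n :=
      hn _ ((flatten_sublist_of_mem_parens hs').subset (hT.least_mem hs'))
    rwa [least_insertFriend s _ (hT.nodup_of_mem hs') hmn,
      rank_founders_insertFriend t (hT.nodup_of_mem ht.mem_parens) hmn hlt] at h1

/-- After `n` is inserted before `m`, every parenthesis is the new one `(n m)`, or arises from a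
former one with the same head. -/
theorem located_insertFriend {T t : ParSeq} {h : List ℕ} (hT : T.WellFormed) {n m : ℕ}
    (hn : ∀ x ∈ T.flatten, x < n) (hm : m ∈ T.flatten)
    (ht : Located (T.insertFriend n m []) h t) :
    t = elem n (elem m nil) ∨ ∃ s, Located T h s ∧ t = s.insertFriend n m s.active := by
  have hT' := hT.insertFriend hn hm
  have hp : t = elem n (elem m nil) ∨ ∃ s ∈ T.parens, t = s.insertFriend n m s.active := by
    rcases mem_parens_insertFriend T _ hT.nodup ht.mem_parens with ⟨e, _⟩ | ⟨e, _⟩ | h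
    · exact Or.inl e
    · exact Or.inl e
    · exact Or.inr h
  rcases hp with h1 | ⟨s, hs, rfl⟩
  · exact Or.inl h1
  · obtain ⟨g, hg⟩ := exists_located hs
    rw [ht.head_eq hT' (hg.insertFriend hT hn (hn m hm))]
    exact Or.inr ⟨s, hg, rfl⟩

theorem rank_founders_pair {n m : ℕ} (h : m < n) :
    rank (elem n (elem m nil)).founders m = 1 ∧ rank (elem n (elem m nil)).founders n = 2 := by
  have h1 : ¬ n ≤ m := by omega
  simp [founders, rank, h.le, h1]

theorem ascentColor_pair {n m : ℕ} (h : m < n) :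
    ascentColor [n, m] n = .red ∧ ascentColor [n, m] m = .blue := by
  have h0 : n ≠ m := by omega
  have h1 : ¬ n < m := by omega
  have h2 : 0 < n := by omega
  simp [ascentColor, h0, h1, h2]

theorem entryOf_pair (h : List ℕ) {n m : ℕ} (hmn : m < n) :
    entryOf h (elem n (elem m nil)) m = ⟨h ++ [1], .blue⟩ ∧
      entryOf h (elem n (elem m nil)) n = ⟨h ++ [2], .red⟩ := by
  have h2 : 2 ≤ (elem n (elem m nil)).active.length := le_rfl
  rw [entryOf_of_two_le h2, entryOf_of_two_le h2, (rank_founders_pair hmn).1,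
    (rank_founders_pair hmn).2]
  change (⟨_, ascentColor [n, m] m⟩ : DecimalNumber) = _ ∧
    (⟨_, ascentColor [n, m] n⟩ : DecimalNumber) = _
  rw [(ascentColor_pair hmn).1, (ascentColor_pair hmn).2]
  exact ⟨rfl, rfl⟩

/-- The change of the decimal numbers when `n` starts a new parenthesis `(n m)` with its friend
`m`, the former decimal number of which is `μ`. -/
structure PairStep (T : ParSeq) (n m : ℕ) (μ : DecimalNumber) : Prop where
  friend : (m, ⟨μ.digits ++ [1], .blue⟩) ∈ numberBlocks 1 (T.insertFriend n m [])
  new : (n, ⟨μ.digits ++ [2], .red⟩) ∈ numberBlocks 1 (T.insertFriend n m [])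
  not_fit : ∀ h t p c, Located T h t → μ = ⟨h ++ [p], c⟩ →
    ¬ IsFamily (insertBefore n m t.active)

/-- The change of the decimal numbers when `n` joins the family of its friend `m` in the
parenthesis `t` with head `h`, which has at least two members. -/
structure JoinStep (T : ParSeq) (n m : ℕ) (h : List ℕ) (t : ParSeq) : Prop where
  located : Located T h t
  mem : m ∈ t.active
  two_le : 2 ≤ t.active.length
  fit : IsFamily (insertBefore n m t.active)
  friend : (m, ⟨h ++ [rank t.founders m], .blue⟩) ∈ numberBlocks 1 (T.insertFriend n m [])
  new : (n, ⟨h ++ [t.founders.length + 1], .red⟩) ∈ numberBlocks 1 (T.insertFriend n m [])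

/-- The insertion of `n` before `m` changes the decimal numbers by the `pair` or by the `join`
step. An outermost singlet counts as `pair`: its head becomes a branch head. -/
theorem numbering_step {T : ParSeq} (hT : T.WellFormed) {n m : ℕ}
    (hn : ∀ x ∈ T.flatten, x < n) {μ : DecimalNumber} (hm : (m, μ) ∈ numberBlocks 1 T) :
    PairStep T n m μ ∨ ∃ h t, JoinStep T n m h t := by
  have hmT := hT.mem_flatten_of_numbering hm
  have hmn := hn m hmT
  have hT' := hT.insertFriend hn hmT
  obtain ⟨h, t, ht, hmt, rfl⟩ := (mem_numbering hT).1 hm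
  have hsub := ht.flatten_sublist.subset
  have ht' := ht.insertFriend hT hn hmn
  have hnd := hT.nodup_of_mem ht.mem_parens
  have hact : ∀ x ∈ t.active, x < n := fun x hx => hn x (hsub (mem_flatten_of_mem_active hx))
  -- the cases: a singlet block, a family which the new value joins, and a family which it does
  -- not join
  rcases hT.family t ht.mem_parens with ⟨v, rfl⟩ | hfam
  · have hv : m = v := by simpa [active] using hmt
    subst hv
    left
    rw [entryOf_singlet]
    have hloc : Located (T.insertFriend n m []) h (elem n (elem m nil)) := by
      have := insertFriend_singlet (v := m) hmn
      rw [if_pos rfl] at this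
      rw [← this]
      exact ht'
    refine ⟨?_, ?_, ?_⟩
    · exact (mem_numbering hT').2 ⟨h, _, hloc, by simp [active], (entryOf_pair h hmn).1.symm⟩
    · exact (mem_numbering hT').2 ⟨h, _, hloc, by simp [active], (entryOf_pair h hmn).2.symm⟩
    · intro g s p c hs e
      cases ht with
      | root hi =>
        have := congrArg DecimalNumber.digits e
        have := (List.append_inj' (s₁ := []) this rfl).1
        exact absurd this.symm hs.ne_nil
      | child hu hs' =>
        have := (hT.inner _ hu.mem_parens _ hs').2
        simp [active] at this
  · have hentry := entryOf_of_two_le (h := h) hfam.2 m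
    by_cases hfit : IsFamily (insertBefore n m t.active)
    · right
      have hlen : 2 ≤ (t.insertFriend n m t.active).active.length := by
        rw [active_insertFriend_of_fit t _ hfit, length_insertBefore hmt]; omega
      refine ⟨h, t, ht, hmt, hfam.2, hfit, ?_, ?_⟩
      · refine (mem_numbering hT').2 ⟨h, _, ht', ?_, ?_⟩
        · rw [active_insertFriend_of_fit t _ hfit, mem_insertBefore hmt]
          exact Or.inr hmt
        · rw [entryOf_of_two_le hlen, rank_founders_insertFriend t hnd hmn hmn,
            active_insertFriend_of_fit t _ hfit,
            ascentColor_insertBefore_friend (hnd.sublist (active_sublist_flatten t)) hmt hmn]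
      · refine (mem_numbering hT').2 ⟨h, _, ht', ?_, ?_⟩
        · rw [active_insertFriend_of_fit t _ hfit, mem_insertBefore hmt]
          exact Or.inl rfl
        · rw [entryOf_of_two_le hlen, active_insertFriend_of_fit t _ hfit,
            ascentColor_insertBefore_self hmt hact,
            rank_perm (founders_insertFriend_of_fit t _ hnd hmt hfit), rank_eq_length,
            List.length_cons]
          intro y hy
          rcases List.mem_cons.1 hy with rfl | hy
          · exact le_rfl
          · rcases mem_founders_iff.1 hy with hy | ⟨s, hs, rfl⟩
            · exact (hact y hy).le
            · have hs' := hT.child_mem ht.mem_parens hs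
              exact (hn _ ((flatten_sublist_of_mem_parens hs').subset (hT.least_mem hs'))).le
    · left
      have hbud : elem n (elem m nil) ∈ (t.insertFriend n m t.active).children :=
        (mem_children_insertFriend_of_not_fit t _ hnd hmt hfit _).2 (Or.inl rfl)
      have hloc := ht'.child hbud
      rw [least_pair hmn, rank_founders_insertFriend t hnd hmn hmn] at hloc
      rw [hentry]
      refine ⟨?_, ?_, ?_⟩
      · exact (mem_numbering hT').2 ⟨_, _, hloc, by simp [active], (entryOf_pair _ hmn).1.symm⟩
      · exact (mem_numbering hT').2 ⟨_, _, hloc, by simp [active], (entryOf_pair _ hmn).2.symm⟩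
      · intro g s p c hs e
        injection e with e1 e2
        obtain ⟨rfl, _⟩ := List.append_inj' e1 rfl
        rwa [← ht.eq hT hs]

/-- The values other than the friend of the new value keep their decimal numbers. -/
theorem numbering_insertFriend_of_ne {T : ParSeq} (hT : T.WellFormed) {n m : ℕ}
    (hn : ∀ x ∈ T.flatten, x < n) (hm : m ∈ T.flatten) {v : ℕ} (hv : v ≠ m) {ν : DecimalNumber}
    (hν : (v, ν) ∈ numberBlocks 1 T) : (v, ν) ∈ numberBlocks 1 (T.insertFriend n m []) := by
  have hmn := hn m hm
  have hvn := hn v (hT.mem_flatten_of_numbering hν)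
  have hT' := hT.insertFriend hn hm
  obtain ⟨h, t, ht, hvt, rfl⟩ := (mem_numbering hT).1 hν
  have hsub := ht.flatten_sublist.subset
  have ht' := ht.insertFriend hT hn hmn
  have hnd := hT.nodup_of_mem ht.mem_parens
  have hand := hnd.sublist (active_sublist_flatten t)
  have hact : ∀ x ∈ t.active, x < n := fun x hx => hn x (hsub (mem_flatten_of_mem_active hx))
  refine (mem_numbering hT').2 ⟨h, _, ht', ?_⟩
  rcases hT.family t ht.mem_parens with ⟨w, rfl⟩ | hfam
  · have hw : v = w := by simpa [active] using hvt
    subst hw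
    have := insertFriend_singlet (v := v) hmn
    rw [if_neg hv] at this
    change v ∈ ((elem v nil).insertFriend n m [v]).active ∧
      _ = entryOf h ((elem v nil).insertFriend n m [v]) v
    rw [this]
    exact ⟨hvt, rfl⟩
  · have hfam' := family_insertFriend (n := n) (m := m)
      (fun x hx => hT.pos x (hsub hx)) (fun x hx => hn x (hsub hx)) hfam
    rw [entryOf_of_two_le hfam.2, entryOf_of_two_le hfam'.2,
      rank_founders_insertFriend t hnd hmn hvn]
    by_cases hmt : m ∈ t.active
    · by_cases hfit : IsFamily (insertBefore n m t.active)
      · rw [active_insertFriend_of_fit t _ hfit, mem_insertBefore hmt,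
          ascentColor_insertBefore_of_ne hand hmt (fun h => (hact n h).false) hvt hv]
        exact ⟨Or.inr hvt, rfl⟩
      · have hve : v ∈ t.active.erase m := (List.mem_erase_of_ne hv).2 hvt
        rw [active_insertFriend_of_not_fit t _ hfit,
          (isFamily_erase hfam.1 hfam.2
            (fun x hx => hT.pos x (hsub (mem_flatten_of_mem_active hx))) hmt hact hfit).2.2 v hve]
        exact ⟨hve, rfl⟩
    · rw [active_insertFriend_of_not_mem t _ hmt]
      exact ⟨hvt, rfl⟩

/-- After an insertion, the only entries which are not former ones are those of the new value and
of its friend. -/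
theorem numbering_insertFriend_cases {T : ParSeq} (hT : T.WellFormed) {n m : ℕ}
    (hn : ∀ x ∈ T.flatten, x < n) (hm : m ∈ T.flatten) {v : ℕ} {ν : DecimalNumber}
    (hν : (v, ν) ∈ numberBlocks 1 (T.insertFriend n m [])) :
    v = n ∨ v = m ∨ v ≠ m ∧ (v, ν) ∈ numberBlocks 1 T := by
  have hT' := hT.insertFriend hn hm
  have hv := hT'.mem_flatten_of_numbering hν
  rw [flatten_insertFriend T _ hT.nodup, mem_insertBefore hm] at hv
  rcases hv with hv | hv
  · exact Or.inl hv
  · by_cases hvm : v = m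
    · exact Or.inr (Or.inl hvm)
    · obtain ⟨ν', h'⟩ := hT.exists_numbering hv
      rw [hT'.numbering_unique hν (numbering_insertFriend_of_ne hT hn hm hvm h')]
      exact Or.inr (Or.inr ⟨hvm, h'⟩)

/-! ### The primitive permutations at the nodes -/

theorem map_erase_of_inj {f : ℕ → ℕ} {l : List ℕ} {m : ℕ} (hf : ∀ x ∈ l, f x = f m → x = m) :
    (l.erase m).map f = (l.map f).erase (f m) := by
  induction l with
  | nil => rfl
  | cons a l ih =>
    by_cases h : a = m
    · subst h; simp
    · have h' : f a ≠ f m := fun e => h (hf a (by simp) e)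
      rw [List.erase_cons_tail (by simpa using h), List.map_cons, List.map_cons,
        List.erase_cons_tail (by simpa using h'), ih fun x hx => hf x (by simp [hx])]

/-- An entry is not equal to the head of a parenthesis with several elements. -/
theorem Located.entry_ne {T t : ParSeq} {h : List ℕ} (hT : T.WellFormed) (ht : Located T h t)
    (h2 : 2 ≤ t.active.length) {v : ℕ} {ν : DecimalNumber} (hv : (v, ν) ∈ numberBlocks 1 T) :
    ν.digits ≠ h := by
  intro e
  have hvt := (ht.mem_flatten_iff hT hv).2 (e ▸ List.prefix_rfl)
  obtain ⟨x, s, hs, hvs⟩ := ht.exists_active hvt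
  have e1 := hT.numbering_unique hv ((mem_numbering hT).2 ⟨_, s, hs, hvs, rfl⟩)
  rw [e1] at e
  rcases hT.family s hs.mem_parens with ⟨w, rfl⟩ | h3
  · rw [entryOf_singlet] at e
    have hx : x = [] := by simpa using e
    rw [hx, List.append_nil] at hs
    rw [ht.eq hT hs] at h2
    simp [active] at h2
  · rw [entryOf_of_two_le h3.2] at e
    have := congrArg List.length e
    simp at this

/-- The primitive permutation at the node of the parenthesis `t` with head `h`: its active family
`A`, its buds `B` and its pairing pattern `P`, compared with the entries `N`. The position of a
value of the node in `P` is its rank in the node; the absolute value of the element of `P` there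
is the digit of the value in the node cut of `h`. This digit is unpaired for the members of the
active family (`member`) and paired for the elements of the buds (`bud`), the second of a pair
being the negative one. The values outside the node are not in the node cut (`outside`). -/
structure PrimitiveNode (N : List (ℕ × DecimalNumber)) (h : List ℕ) (t : ParSeq) (A : List ℕ)
    (B : List (ℕ × ℕ)) (P : List ℤ) : Prop where
  prim : IsPrimitive (pattern t.node) A B P
  active_eq : A = t.active.map (rank t.node)
  count : B.length + A.length = t.founders.length
  length : P.length = t.node.length
  bound : ∀ x ∈ P, x.natAbs ≤ t.founders.length
  member : ∀ v ∈ t.active, P[rank t.node v - 1]? = some (rank t.founders v : ℤ) ∧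
    -(rank t.founders v : ℤ) ∉ P
  bud : ∀ v ν, (v, ν) ∈ N → v ∈ t.node → v ∉ t.active → ∃ x, P[rank t.node v - 1]? = some x ∧
    cutEntry h ν = some (x.natAbs, if x < 0 then .two else .one) ∧ (x < 0 ∨ -x ∈ P)
  outside : ∀ v ν, (v, ν) ∈ N → v ∉ t.node → cutEntry h ν = none

/-- The primitive permutation at a node is kept as long as the node and the node cut do not
change. -/
theorem PrimitiveNode.congr {N N' : List (ℕ × DecimalNumber)} {h : List ℕ} {t t' : ParSeq}
    {A : List ℕ} {B : List (ℕ × ℕ)} {P : List ℤ} (hp : PrimitiveNode N h t A B P)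
    (hnode : t'.node = t.node) (hact : t'.active = t.active) (hf : t'.founders = t.founders)
    (hN : ∀ v ν', (v, ν') ∈ N' → (v ∉ t.node ∧ cutEntry h ν' = none) ∨
      ∃ ν, (v, ν) ∈ N ∧ cutEntry h ν' = cutEntry h ν) : PrimitiveNode N' h t' A B P where
  prim := hnode ▸ hp.prim
  active_eq := by rw [hnode, hact]; exact hp.active_eq
  count := hf ▸ hp.count
  length := hnode ▸ hp.length
  bound := hf ▸ hp.bound
  member := by rw [hnode, hact, hf]; exact hp.member
  bud := by
    intro v ν' h1 h2 h3
    rw [hnode] at h2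
    rw [hact] at h3
    rw [hnode]
    rcases hN v ν' h1 with h4 | ⟨ν, h4, h5⟩
    · exact absurd h2 h4.1
    · rw [h5]; exact hp.bud v ν h4 h2 h3
  outside := by
    intro v ν' h1 h2
    rw [hnode] at h2
    rcases hN v ν' h1 with h4 | ⟨ν, h4, h5⟩
    · exact h4.2
    · rw [h5]; exact hp.outside v ν h4 h2

theorem cutEntry_eq_none_of_not_prefix {h : List ℕ} {ν : DecimalNumber} (hp : ¬ h <+: ν.digits) :
    cutEntry h ν = none := cutEntry_of_not_isHead fun hh => hp hh.2

/-- The node cuts do not see the entry of a new singlet. -/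
theorem primitiveNode_appendSinglet {T t : ParSeq} {h : List ℕ} (hT : T.WellFormed) {n : ℕ}
    (hn : ∀ x ∈ T.flatten, x < n) (h0 : 0 < n) (ht : Located T h t) {A : List ℕ}
    {B : List (ℕ × ℕ)} {P : List ℤ} (hp : PrimitiveNode (numberBlocks 1 T) h t A B P) :
    PrimitiveNode (numberBlocks 1 (T.appendSinglet n)) h t A B P := by
  refine hp.congr rfl rfl rfl ?_
  intro v ν' hv
  rcases (numbering_appendSinglet hT hn h0).1 hv with h1 | ⟨rfl, rfl⟩
  · exact Or.inr ⟨ν', h1, rfl⟩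
  · refine Or.inl ⟨fun hv => ?_, ?_⟩
    · exact (hn v (ht.flatten_sublist.subset ((node_sublist_flatten t).subset hv))).false
    · cases e : cutEntry h ⟨[T.children.length + 1], .black⟩ with
      | none => rfl
      | some x =>
        have h1 := (prefix_of_cutEntry e).length_le
        have h2 := List.length_pos_iff.2 ht.ne_nil
        simp only [List.length_append, List.length_singleton] at h1
        omega

/-- The new parenthesis `(n m)` has the primitive permutation `2, 1`. -/
theorem primitiveNode_pair {T : ParSeq} {h : List ℕ} (hT : T.WellFormed) {n m : ℕ}
    (hmn : m < n) (ht : Located T h (elem n (elem m nil))) :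
    PrimitiveNode (numberBlocks 1 T) h (elem n (elem m nil)) [2, 1] [] [1, 2] := by
  have h1 : ¬ n ≤ m := by omega
  have hm : rank [n, m] m = 1 := by simp [rank, h1]
  have hn : rank [n, m] n = 2 := by simp [rank, hmn.le]
  have hnode : (elem n (elem m nil)).node = [n, m] := rfl
  have hact : (elem n (elem m nil)).active = [n, m] := rfl
  have hfou : (elem n (elem m nil)).founders = [n, m] := rfl
  have hflat : (elem n (elem m nil)).flatten = [n, m] := rfl
  refine ⟨?_, ?_, ?_, ?_, ?_, ?_, ?_, ?_⟩
  · rw [hnode]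
    simp only [pattern, List.map_cons, List.map_nil, hm, hn]
    exact .base
  · simp [hact, hnode, hm, hn]
  · simp [hfou]
  · simp [hnode]
  · simp [hfou]
  · rw [hact, hnode, hfou]
    intro v hv
    simp only [List.mem_cons, List.not_mem_nil, or_false] at hv
    rcases hv with rfl | rfl
    · rw [hn]; simp
    · rw [hm]; simp
  · intro v ν _ hv hv'
    exact absurd hv hv'
  · intro v ν hν hv
    apply cutEntry_eq_none_of_not_prefix
    rw [← ht.mem_flatten_iff hT hν]
    exact hv

/-- A parenthesis with the friend in one of its inner parentheses, or outside, keeps its primitive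
permutation. -/
theorem primitiveNode_of_not_mem {T t : ParSeq} {h : List ℕ} (hT : T.WellFormed) {n m : ℕ}
    (hn : ∀ x ∈ T.flatten, x < n) (hm : m ∈ T.flatten) (ht : Located T h t)
    (h2 : 2 ≤ t.active.length) (hmt : m ∉ t.active) {A : List ℕ}
    {B : List (ℕ × ℕ)} {P : List ℤ} (hp : PrimitiveNode (numberBlocks 1 T) h t A B P) :
    PrimitiveNode (numberBlocks 1 (T.insertFriend n m [])) h (t.insertFriend n m t.active)
      A B P := by
  have hmn := hn m hm
  have hT' := hT.insertFriend hn hm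
  have hnd := hT.nodup_of_mem ht.mem_parens
  have hsub := ht.flatten_sublist.subset
  have hnn : n ∉ t.node := fun h => (hn n (hsub ((node_sublist_flatten t).subset h))).false
  obtain ⟨μ, hμ⟩ := hT.exists_numbering hm
  -- the friend is not a member, so that its digits are not `h.k`
  have hne : ∀ k, μ.digits ≠ h ++ [k] := by
    intro k e
    refine hmt (ht.mem_active_of_entry hT (p := k) (c := μ.color) (?_)).1
    rwa [← e]
  have hne' := ht.entry_ne hT h2 hμ
  refine hp.congr (node_insertFriend_of_not_mem t _ hnd (fun x hx => hn x (hsub hx)) ?_ hmt)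
    (active_insertFriend_of_not_mem t _ hmt)
    (founders_insertFriend_of_not_mem t _ hnd hmn hmt) ?_
  · intro s hs
    exact (hT.inner t ht.mem_parens s hs).2.trans (active_sublist_flatten s).length_le
  · intro v ν' hν'
    have hcases := numbering_insertFriend_cases hT hn hm hν'
    rcases numbering_step hT hn hμ with hstep | ⟨g, s, hstep⟩
    · rcases hcases with rfl | rfl | ⟨_, h3⟩
      · refine Or.inl ⟨hnn, ?_⟩
        rw [hT'.numbering_unique hν' hstep.new]
        exact cutEntry_append_two hne'.symm hne _
      · refine Or.inr ⟨μ, hμ, ?_⟩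
        rw [hT'.numbering_unique hν' hstep.friend]
        exact cutEntry_append_one hne'.symm hne _ _
      · exact Or.inr ⟨ν', h3, rfl⟩
    · -- the new value joins the family of another parenthesis
      have hg : h ≠ g := by
        rintro rfl
        exact hmt (ht.eq hT hstep.located ▸ hstep.mem)
      rcases hcases with rfl | rfl | ⟨_, h3⟩
      · refine Or.inl ⟨hnn, ?_⟩
        rw [hT'.numbering_unique hν' hstep.new]
        refine cutEntry_append_large hg ?_ _
        have := hstep.two_le
        rw [length_founders]
        omega
      · refine Or.inr ⟨μ, hμ, ?_⟩
        have e := hT.numbering_unique hμ ((mem_numbering hT).2 ⟨g, s, hstep.located, hstep.mem, rfl⟩)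
        rw [entryOf_of_two_le hstep.two_le] at e
        rw [hT'.numbering_unique hν' hstep.friend, e]
        refine cutEntry_color (fun k e' => ?_) _ _
        exact hg (List.append_inj' e' rfl).1.symm
      · exact Or.inr ⟨ν', h3, rfl⟩

theorem mem_node_of_mem_active {t : ParSeq} {v : ℕ} (h : v ∈ t.active) : v ∈ t.node :=
  (active_sublist_node t).subset h

/-- The insertion into the active family of a node commutes with replacing the values by their
ranks. -/
theorem isFamily_insertBefore_rank {node act : List ℕ} {n m : ℕ} (hsub : act ⊆ node)
    (hm : m ∈ act) (hn : ∀ x ∈ node, x < n) :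
    (insertBefore n m act).map (rank (insertBefore n m node)) =
        insertBefore (node.length + 1) (rank node m) (act.map (rank node)) ∧
      (IsFamily (insertBefore (node.length + 1) (rank node m) (act.map (rank node))) ↔
        IsFamily (insertBefore n m act)) := by
  have hmn := hsub hm
  have hmem : ∀ x ∈ insertBefore n m act, x ∈ insertBefore n m node := by
    intro x hx
    rw [mem_insertBefore hm] at hx
    rw [mem_insertBefore hmn]
    exact hx.imp id fun h => hsub h
  have e : (insertBefore n m act).map (rank (insertBefore n m node)) =
        insertBefore (node.length + 1) (rank node m) (act.map (rank node)) := by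
    rw [map_insertBefore, rank_insertBefore_self hmn hn, rank_insertBefore (hn m hmn)]
    · congr 1
      apply List.map_congr_left
      intro x hx
      exact rank_insertBefore (hn x (hsub hx))
    · intro x hx e
      exact rank_injective ((mem_insertBefore hmn).2 (Or.inr (hsub hx)))
        ((mem_insertBefore hmn).2 (Or.inr hmn)) e
  refine ⟨e, ?_⟩
  rw [← e]
  exact isFamily_map fun x _ y hy => rank_lt_rank_iff (hmem y hy)

/-- If the new value joins the active family, the primitive permutation at the node grows: its
pairing pattern is extended by the number of the buds and members, which is the digit of the new
value. -/
theorem primitiveNode_of_fit {T t : ParSeq} {h : List ℕ} (hT : T.WellFormed) {n m : ℕ}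
    (hn : ∀ x ∈ T.flatten, x < n) (ht : Located T h t)
    (hmt : m ∈ t.active) (hfit : IsFamily (insertBefore n m t.active)) {A : List ℕ}
    {B : List (ℕ × ℕ)} {P : List ℤ} (hp : PrimitiveNode (numberBlocks 1 T) h t A B P) :
    ∃ A B P, PrimitiveNode (numberBlocks 1 (T.insertFriend n m [])) h
      (t.insertFriend n m t.active) A B P := by
  have hsub := ht.flatten_sublist.subset
  have hm := hsub (mem_flatten_of_mem_active hmt)
  have hmn := hn m hm
  have hnd := hT.nodup_of_mem ht.mem_parens
  have hnode : ∀ x ∈ t.node, x < n := fun x hx => hn x (hsub ((node_sublist_flatten t).subset hx))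
  have hmnode := mem_node_of_mem_active hmt
  have hfou := founders_insertFriend_of_fit t t.active hnd hmt hfit
  have hfoun : ∀ x ∈ t.founders, x < n := by
    intro x hx
    rcases mem_founders_iff.1 hx with hx | ⟨s, hs, rfl⟩
    · exact hnode x (mem_node_of_mem_active hx)
    · have hs' := hT.child_mem ht.mem_parens hs
      exact hn _ ((flatten_sublist_of_mem_parens hs').subset (hT.least_mem hs'))
  have hrank : rank (t.insertFriend n m t.active).founders n = t.founders.length + 1 := by
    rw [rank_perm hfou, rank_eq_length, List.length_cons]
    intro y hy
    rcases List.mem_cons.1 hy with rfl | hy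
    · exact le_rfl
    · exact (hfoun y hy).le
  obtain ⟨e1, e2⟩ := isFamily_insertBefore_rank (fun _ => mem_node_of_mem_active) hmt hnode
  have hσ : (pattern t.node).length = t.node.length := by simp [pattern]
  rw [← hp.active_eq] at e1 e2
  have hmA : rank t.node m ∈ A := by
    rw [hp.active_eq]; exact List.mem_map.2 ⟨m, hmt, rfl⟩
  have hgrow := IsPrimitive.grow (t.node.length + 1) (rank t.node m) hp.prim (by rw [hσ]) hmA
    (e2.2 hfit)
  -- the element appended to the pairing pattern is the number of the new value
  have hlast : (B.length : ℤ) +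
      ((insertBefore (t.node.length + 1) (rank t.node m) A).length : ℤ) =
        ((t.founders.length + 1 : ℕ) : ℤ) := by
    rw [length_insertBefore hmA, ← hp.count]; push_cast; ring
  rw [hlast, ← pattern_insertBefore hmnode hnode] at hgrow
  -- the new element of the pairing pattern is unpaired
  have hnotin : -((t.founders.length + 1 : ℕ) : ℤ) ∉ P := by
    intro hx
    have := hp.bound _ hx
    simp at this
    omega
  refine ⟨insertBefore (t.node.length + 1) (rank t.node m) A, B,
    P ++ [((t.founders.length + 1 : ℕ) : ℤ)], ?_⟩
  have hN' := node_insertFriend_of_mem t t.active hnd hmn hmt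
  have hA' := active_insertFriend_of_fit t t.active hfit
  have hrn : ∀ x ∈ t.node, rank (t.insertFriend n m t.active).node x = rank t.node x := by
    intro x hx
    rw [hN', rank_insertBefore (hnode x hx)]
  refine ⟨by rw [hN']; exact hgrow, ?_, ?_, ?_, ?_, ?_, ?_, ?_⟩
  · rw [hN', hA', e1]
  · rw [hfou.length_eq, List.length_cons, length_insertBefore hmA, ← hp.count]; ring
  · rw [hN', length_insertBefore hmnode, List.length_append, hp.length]; rfl
  · intro x hx
    rw [hfou.length_eq, List.length_cons]
    rcases List.mem_append.1 hx with hx | hx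
    · exact (hp.bound x hx).trans (Nat.le_succ _)
    · rw [List.mem_singleton.1 hx]; exact le_of_eq (Int.natAbs_natCast _)
  · intro v hv
    rw [hA', mem_insertBefore hmt] at hv
    rcases hv with rfl | hv
    · rw [hrank, hN', rank_insertBefore_self hmnode hnode]
      refine ⟨?_, ?_⟩
      · rw [Nat.add_sub_cancel, ← hp.length]
        simp
      · intro hx
        rcases List.mem_append.1 hx with hx | hx
        · exact hnotin hx
        · have := List.mem_singleton.1 hx
          omega
    · have hvn := mem_node_of_mem_active hv
      obtain ⟨h1, h2⟩ := hp.member v hv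
      rw [rank_perm hfou, rank_cons_of_lt _ (hnode v hvn), hrn v hvn]
      refine ⟨?_, ?_⟩
      · rw [List.getElem?_append_left (List.getElem?_eq_some_iff.1 h1).1, h1]
      · intro hx
        rcases List.mem_append.1 hx with hx | hx
        · exact h2 hx
        · have := List.mem_singleton.1 hx
          omega
  · intro v ν hν hv hv'
    rw [hN', mem_insertBefore hmnode] at hv
    rw [hA', mem_insertBefore hmt, not_or] at hv'
    have hv := hv.resolve_left hv'.1
    have hvm : v ≠ m := fun e => hv'.2 (e ▸ hmt)
    have hν := ((numbering_insertFriend_cases hT hn hm hν).resolve_left hv'.1).resolve_left hvm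
    obtain ⟨x, h1, h2, h3⟩ := hp.bud v ν hν.2 hv hv'.2
    refine ⟨x, ?_, h2, h3.imp id fun h => List.mem_append_left _ h⟩
    rw [hrn v hv, List.getElem?_append_left (List.getElem?_eq_some_iff.1 h1).1, h1]
  · intro v ν hν hv
    rw [hN', mem_insertBefore hmnode, not_or] at hv
    have hvm : v ≠ m := fun e => hv.2 (e ▸ hmnode)
    have hν := ((numbering_insertFriend_cases hT hn hm hν).resolve_left hv.1).resolve_left hvm
    exact hp.outside v ν hν.2 hv.2

/-- If the new value forms a parenthesis with its friend, the primitive permutation at the node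
gets a bud: its pairing pattern is extended by the opposite of the element for the friend, whose
digit the two values now share. -/
theorem primitiveNode_of_not_fit {T t : ParSeq} {h : List ℕ} (hT : T.WellFormed) {n m : ℕ}
    (hn : ∀ x ∈ T.flatten, x < n) (ht : Located T h t) (h2 : 2 ≤ t.active.length)
    (hmt : m ∈ t.active) (hfit : ¬ IsFamily (insertBefore n m t.active)) {A : List ℕ}
    {B : List (ℕ × ℕ)} {P : List ℤ} (hp : PrimitiveNode (numberBlocks 1 T) h t A B P) :
    ∃ A B P, PrimitiveNode (numberBlocks 1 (T.insertFriend n m [])) h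
      (t.insertFriend n m t.active) A B P := by
  have hsub := ht.flatten_sublist.subset
  have hm := hsub (mem_flatten_of_mem_active hmt)
  have hmn := hn m hm
  have hT' := hT.insertFriend hn hm
  have hnd := hT.nodup_of_mem ht.mem_parens
  have hand := hnd.sublist (active_sublist_flatten t)
  have hnode : ∀ x ∈ t.node, x < n := fun x hx => hn x (hsub ((node_sublist_flatten t).subset hx))
  have hnn : n ∉ t.node := fun h => (hnode n h).false
  have hmnode := mem_node_of_mem_active hmt
  have hfou := founders_insertFriend_of_not_fit t t.active hnd hmn hmt hfit
  obtain ⟨-, e2⟩ := isFamily_insertBefore_rank (fun _ => mem_node_of_mem_active) hmt hnode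
  have hσ : (pattern t.node).length = t.node.length := by simp [pattern]
  rw [← hp.active_eq] at e2
  have hmA : rank t.node m ∈ A := by
    rw [hp.active_eq]; exact List.mem_map.2 ⟨m, hmt, rfl⟩
  have hbud := IsPrimitive.bud (t.node.length + 1) (rank t.node m) hp.prim (by rw [hσ]) hmA
    (fun h => hfit (e2.1 h))
  obtain ⟨hm1, hm2⟩ := hp.member m hmt
  have hpos := rank_pos (mem_founders_of_mem_active hmt)
  rw [List.getD_eq_getElem?_getD, hm1, Option.getD_some, ← pattern_insertBefore hmnode hnode]
    at hbud
  have hN' := node_insertFriend_of_mem t t.active hnd hmn hmt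
  have hA' := active_insertFriend_of_not_fit t t.active hfit
  have hrn : ∀ x ∈ t.node, rank (t.insertFriend n m t.active).node x = rank t.node x := by
    intro x hx
    rw [hN', rank_insertBefore (hnode x hx)]
  -- the friend and the new value get the numbers `h.p.1` and `h.p.2`, where `p` is the former
  -- digit of the friend
  have hstep : PairStep T n m ⟨h ++ [rank t.founders m], ascentColor t.active m⟩ := by
    have hμ := (mem_numbering hT).2 ⟨h, t, ht, hmt, rfl⟩
    rw [entryOf_of_two_le h2] at hμ
    rcases numbering_step hT hn hμ with hstep | ⟨g, s, hstep⟩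
    · exact hstep
    · have e := hT.numbering_unique hμ
        ((mem_numbering hT).2 ⟨g, s, hstep.located, hstep.mem, rfl⟩)
      rw [entryOf_of_two_le hstep.two_le] at e
      injection e with e _
      obtain ⟨rfl, _⟩ := List.append_inj' e rfl
      exact absurd hstep.fit (ht.eq hT hstep.located ▸ hfit)
  have hleft : ∀ {i : ℕ} {x : ℤ}, P[i]? = some x →
      (P ++ [-(rank t.founders m : ℤ)])[i]? = some x := fun h1 => by
    rw [List.getElem?_append_left (List.getElem?_eq_some_iff.1 h1).1, h1]
  refine ⟨_, _, _, by rw [hN']; exact hbud, ?_, ?_, ?_, ?_, ?_, ?_, ?_⟩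
  · rw [hA', hp.active_eq, ← map_erase_of_inj]
    · apply List.map_congr_left
      intro x hx
      exact (hrn x (mem_node_of_mem_active (List.mem_of_mem_erase hx))).symm
    · exact fun x hx e => rank_injective (mem_node_of_mem_active hx) hmnode e
  · rw [hfou, ← hp.count, List.length_cons, List.length_erase_of_mem hmA]
    have := List.length_pos_of_mem hmA
    omega
  · rw [hN', length_insertBefore hmnode, List.length_append, hp.length]; rfl
  · intro x hx
    rw [hfou]
    rcases List.mem_append.1 hx with hx | hx
    · exact hp.bound x hx
    · rw [List.mem_singleton.1 hx, Int.natAbs_neg, Int.natAbs_natCast]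
      exact rank_le_length _ _
  · intro v hv
    rw [hA', hand.mem_erase_iff] at hv
    have hvn := mem_node_of_mem_active hv.2
    obtain ⟨h1, h3⟩ := hp.member v hv.2
    rw [hfou, hrn v hvn]
    refine ⟨hleft h1, ?_⟩
    intro hx
    rcases List.mem_append.1 hx with hx | hx
    · exact h3 hx
    · have hx := List.mem_singleton.1 hx
      refine hv.1 (rank_injective (mem_founders_of_mem_active hv.2)
        (mem_founders_of_mem_active hmt) ?_)
      omega
  · intro v ν hν hv hv'
    rw [hN', mem_insertBefore hmnode] at hv
    rw [hA', hand.mem_erase_iff] at hv'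
    rcases numbering_insertFriend_cases hT hn hm hν with rfl | rfl | ⟨hvm, h3⟩
    · refine ⟨-(rank t.founders m : ℤ), ?_, ?_, ?_⟩
      · rw [hN', rank_insertBefore_self hmnode hnode, Nat.add_sub_cancel, ← hp.length]
        simp
      · rw [hT'.numbering_unique hν hstep.new, cutEntry_append_pair_two ht.ne_nil,
          if_pos (by omega), Int.natAbs_neg, Int.natAbs_natCast]
      · left; omega
    · refine ⟨rank t.founders v, ?_, ?_, ?_⟩
      · rw [hrn v hmnode]; exact hleft hm1
      · rw [hT'.numbering_unique hν hstep.friend, cutEntry_append_pair_one ht.ne_nil,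
          if_neg (by omega), Int.natAbs_natCast]
      · right; simp
    · have hvn : v ≠ n := fun e => by
        have := hn v (hT.mem_flatten_of_numbering h3)
        omega
      have hv := hv.resolve_left hvn
      obtain ⟨x, h4, h5, h6⟩ := hp.bud v ν h3 hv fun h => hv' ⟨hvm, h⟩
      exact ⟨x, by rw [hrn v hv]; exact hleft h4, h5,
        h6.imp id fun h => List.mem_append_left _ h⟩
  · intro v ν hν hv
    rw [hN', mem_insertBefore hmnode, not_or] at hv
    have hvm : v ≠ m := fun e => hv.2 (e ▸ hmnode)
    have hν := ((numbering_insertFriend_cases hT hn hm hν).resolve_left hv.1).resolve_left hvm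
    exact hp.outside v ν hν.2 hv.2

/-- Every node with at least two elements is a primitive permutation, described by the entries. -/
def NodesPrimitive (T : ParSeq) : Prop :=
  ∀ h t, Located T h t → 2 ≤ t.active.length →
    ∃ A B P, PrimitiveNode (numberBlocks 1 T) h t A B P

theorem nodesPrimitive_nil : NodesPrimitive nil := by
  intro h t ht
  have := ht.mem_parens
  simp [parens] at this

theorem NodesPrimitive.appendSinglet {T : ParSeq} (hp : NodesPrimitive T) (hT : T.WellFormed)
    {n : ℕ} (hn : ∀ x ∈ T.flatten, x < n) (h0 : 0 < n) : NodesPrimitive (T.appendSinglet n) := by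
  intro h t ht h2
  rcases located_appendSinglet (hT.appendSinglet hn h0) ht with ht | rfl
  · obtain ⟨A, B, P, h1⟩ := hp h t ht h2
    exact ⟨A, B, P, primitiveNode_appendSinglet hT hn h0 ht h1⟩
  · simp [active] at h2

theorem NodesPrimitive.insertFriend {T : ParSeq} (hp : NodesPrimitive T) (hT : T.WellFormed)
    {n m : ℕ} (hn : ∀ x ∈ T.flatten, x < n) (hm : m ∈ T.flatten) :
    NodesPrimitive (T.insertFriend n m []) := by
  intro h t ht h2
  have hmn := hn m hm
  have hT' := hT.insertFriend hn hm
  rcases located_insertFriend hT hn hm ht with rfl | ⟨s, hs, rfl⟩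
  · exact ⟨_, _, _, primitiveNode_pair hT' hmn ht⟩
  · rcases hT.family s hs.mem_parens with ⟨v, rfl⟩ | hfam
    · have e := insertFriend_singlet (v := v) hmn
      change 2 ≤ ((elem v nil).insertFriend n m [v]).active.length at h2
      change Located _ h ((elem v nil).insertFriend n m [v]) at ht
      change ∃ A B P, PrimitiveNode _ h ((elem v nil).insertFriend n m [v]) A B P
      rw [e] at h2 ht ⊢
      split_ifs at h2 ht ⊢
      · exact ⟨_, _, _, primitiveNode_pair hT' hmn ht⟩
      · simp [active] at h2
    · obtain ⟨A, B, P, h1⟩ := hp h s hs hfam.2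
      by_cases hms : m ∈ s.active
      · by_cases hfit : IsFamily (insertBefore n m s.active)
        · exact primitiveNode_of_fit hT hn hs hms hfit h1
        · exact primitiveNode_of_not_fit hT hn hs hfam.2 hms hfit h1
      · exact ⟨A, B, P, primitiveNode_of_not_mem hT hn hm hs hfam.2 hms h1⟩

end ParSeq

/-! ### The steps of codes and of permutations -/

/-- The result of a step is determined by the code and by the digits of the friend. -/
theorem CodeStep.unique {δ δ₁ δ₂ : List DecimalNumber} {D : Option (List ℕ)} (hδ : ValidCode δ)
    (h₁ : CodeStep δ D δ₁) (h₂ : CodeStep δ D δ₂) : δ₁ = δ₂ := by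
  cases h₁ with
  | append M hM =>
    cases h₂ with
    | append M' hM' =>
      have key : ∀ {a b : ℕ}, (∀ i, IsBlockLabel δ i ↔ 1 ≤ i ∧ i ≤ a) →
          (∀ i, IsBlockLabel δ i ↔ 1 ≤ i ∧ i ≤ b) → a ≤ b := by
        intro a b ha hb
        by_contra hlt
        have := (hb a).1 ((ha a).2 ⟨by omega, le_rfl⟩)
        omega
      rw [le_antisymm (key hM hM') (key hM' hM)]
  | pair D c hD hfit =>
    generalize hD' : some D = D' at h₂
    cases h₂ with
    | append => cases hD'
    | pair D' c' hD₂ hfit' => cases hD'; rfl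
    -- the `pair` and `join` steps have opposite conditions
    | join h p c' K hh hD₂ hfit' hK =>
      cases hD'
      have e := hδ.eq_of_digits hD hD₂ rfl
      injection e with _ e
      subst e
      exact absurd hfit' (hfit h p hh rfl)
  | join h p c K hh hD hfit hK =>
    generalize hD' : some (h ++ [p]) = D' at h₂
    cases h₂ with
    | append => cases hD'
    | pair D' c' hD₂ hfit' =>
      cases hD'
      have e := hδ.eq_of_digits hD hD₂ rfl
      injection e with _ e
      subst e
      exact absurd hfit (hfit' h p hh rfl)
    | join h' p' c' K' hh' hD₂ hfit' hK' =>
      obtain ⟨rfl, e⟩ := List.append_inj' (Option.some.inj hD') rfl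
      simp only [List.cons.injEq, and_true] at e
      subst e
      have key : ∀ {a b : ℕ}, (∀ q, (∃ ν ∈ δ, h ++ [q] <+: ν.digits) ↔ 1 ≤ q ∧ q ≤ a) →
          (∀ q, (∃ ν ∈ δ, h ++ [q] <+: ν.digits) ↔ 1 ≤ q ∧ q ≤ b) → a ≤ b := by
        intro a b ha hb
        by_contra hlt
        have := (hb a).1 ((ha a).2 ⟨by omega, le_rfl⟩)
        omega
      rw [le_antisymm (key hK hK') (key hK' hK)]

theorem CodeStep.exists_mem {δ δ' : List DecimalNumber} {D : List ℕ}
    (h : CodeStep δ (some D) δ') : ∃ c, ⟨D, c⟩ ∈ δ := by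
  cases h with
  | pair D c hD => exact ⟨c, hD⟩
  | join h p c K hh hD => exact ⟨c, hD⟩

/-- The recursive definition of the parenthesized form, when the largest value is last. -/
theorem parForm_append {n : ℕ} {l : List ℕ} (hl : n + 1 ∉ l) :
    parForm (n + 1) (l ++ [n + 1]) = (parForm n l).appendSinglet (n + 1) := by
  have h1 : (l ++ [n + 1]).idxOf (n + 1) = l.length := by
    rw [List.idxOf_append_of_notMem hl]; simp
  have h2 : (l ++ [n + 1])[(l ++ [n + 1]).idxOf (n + 1) + 1]? = none := by
    rw [h1]; simp
  have h3 : (l ++ [n + 1]).erase (n + 1) = l := by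
    rw [List.erase_append_right _ hl]; simp
  rw [parForm, h2, h3]

/-- The recursive definition of the parenthesized form, when the largest value is not last. No
family is given for the outermost level, since all the values are in parentheses. -/
theorem parForm_insertBefore {n m : ℕ} {l : List ℕ} (hl : n + 1 ∉ l) (hm : m ∈ l) :
    parForm (n + 1) (insertBefore (n + 1) m l) = (parForm n l).insertFriend (n + 1) m [] := by
  have h3 := erase_insertBefore (m := m) hl
  have h2 : (insertBefore (n + 1) m l)[(insertBefore (n + 1) m l).idxOf (n + 1) + 1]? = some m := by
    obtain ⟨l₁, l₂, rfl, h1⟩ := exists_split hm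
    rw [insertBefore_append h1, List.idxOf_append_of_notMem fun h => hl (by simp [h])]
    simp
  rw [parForm, h2, h3]

/-- A permutation of `1, …, n + 1` arises from one of `1, …, n` when `n + 1` is appended or
inserted before its friend. -/
theorem exists_remove_last {n : ℕ} {l : List ℕ} (hl : l.Perm (List.range' 1 (n + 1))) :
    ∃ l', l'.Perm (List.range' 1 n) ∧
      (l = l' ++ [n + 1] ∨ ∃ m ∈ l', l = insertBefore (n + 1) m l') := by
  have hr : (List.range' 1 (n + 1)) = List.range' 1 n ++ [n + 1] := by
    rw [List.range'_1_concat, add_comm 1 n]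
  have hnd : l.Nodup := hl.nodup_iff.2 List.nodup_range'
  have hmem : n + 1 ∈ l := hl.mem_iff.2 (by rw [hr]; simp)
  obtain ⟨l₁, l₂, rfl, h1, h2⟩ := exists_split_nodup hnd hmem
  refine ⟨l₁ ++ l₂, ?_, ?_⟩
  · rw [hr] at hl
    exact ((List.perm_middle.symm.trans hl).trans (List.perm_append_singleton _ _)).cons_inv
  · cases l₂ with
    | nil => left; simp
    | cons m l₂ =>
      right
      refine ⟨m, by simp, ?_⟩
      rw [insertBefore_append]
      intro hm
      have := (List.nodup_append.1 hnd).2.2 m hm m (by simp)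
      exact this rfl

namespace ParSeq

theorem lookup_eq_some {l : List (ℕ × DecimalNumber)} (hl : (l.map Prod.fst).Nodup) {v : ℕ}
    {ν : DecimalNumber} (h : (v, ν) ∈ l) : l.lookup v = some ν := by
  induction l with
  | nil => simp at h
  | cons e l ih =>
    obtain ⟨w, μ⟩ := e
    simp only [List.map_cons, List.nodup_cons] at hl
    rcases List.mem_cons.1 h with h' | h'
    · injection h' with h1 h2
      subst h1 h2
      simp
    · have hvw : v ≠ w := by
        rintro rfl
        exact hl.1 (List.mem_map.2 ⟨(v, ν), h', rfl⟩)
      rw [List.lookup_cons, beq_false_of_ne hvw]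
      exact ih hl.2 h'

/-- The numbered values of a parenthesis are distinct. -/
theorem nodup_founders {T t : ParSeq} (hT : T.WellFormed) (ht : t ∈ T.parens) :
    t.founders.Nodup := by
  have key : ∀ r : ParSeq, r.flatten.Nodup → (∀ s ∈ r.children, s ∈ T.parens) →
      r.founders.Nodup ∧ ∀ x ∈ r.founders, x ∈ r.flatten := by
    intro r
    induction r with
    | nil => intro _ _; simp [founders]
    | elem v r ih =>
      intro h h2
      simp only [flatten, List.nodup_cons] at h
      obtain ⟨h3, h4⟩ := ih h.2 h2
      simp only [founders, flatten, List.nodup_cons, List.mem_cons]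
      exact ⟨⟨fun hv => h.1 (h4 v hv), h3⟩, fun x hx => hx.imp id (h4 x)⟩
    | paren s r _ ih =>
      intro h h2
      have hd := List.nodup_append.1 h
      obtain ⟨h3, h4⟩ := ih hd.2.1 fun u hu => h2 u (by simp [children, hu])
      have hs := hT.least_mem (h2 s (by simp [children]))
      simp only [founders, flatten, List.nodup_cons, List.mem_cons, List.mem_append]
      refine ⟨⟨fun hv => hd.2.2 _ hs _ (h4 _ hv) rfl, h3⟩, ?_⟩
      rintro x (rfl | hx)
      · exact Or.inl hs
      · exact Or.inr (h4 x hx)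
  exact (key t (hT.nodup_of_mem ht) fun s hs => hT.child_mem ht hs).1

/-- `T` is the parenthesized form of the permutation `l` of `1, …, n`, and `δ` its code, together
with everything that is preserved from `n` to `n + 1`. By `entry`, the values with their decimal
numbers are the positions `1, …, n` with the entries of `δ`. -/
structure Coded (n : ℕ) (l : List ℕ) (T : ParSeq) (δ : List DecimalNumber) : Prop where
  perm : l.Perm (List.range' 1 n)
  wf : T.WellFormed
  flat : T.flatten = l
  blocks_eq : T.children.map flatten = blocks l
  nodes : NodesPrimitive T
  length : δ.length = n
  entry : ∀ v ν, (v, ν) ∈ numberBlocks 1 T ↔ 1 ≤ v ∧ δ[v - 1]? = some ν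
  valid : ValidCode δ
  color : ∀ v ν, (v, ν) ∈ numberBlocks 1 T → ν.color = valueColor l v

theorem Coded.nodup {n : ℕ} {l : List ℕ} {T : ParSeq} {δ : List DecimalNumber}
    (h : Coded n l T δ) : l.Nodup := h.perm.nodup_iff.2 List.nodup_range'

theorem Coded.mem_iff {n : ℕ} {l : List ℕ} {T : ParSeq} {δ : List DecimalNumber}
    (h : Coded n l T δ) {v : ℕ} : v ∈ l ↔ 1 ≤ v ∧ v ≤ n := by
  rw [h.perm.mem_iff, List.mem_range'_1]
  omega

theorem Coded.lt {n : ℕ} {l : List ℕ} {T : ParSeq} {δ : List DecimalNumber}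
    (h : Coded n l T δ) : ∀ x ∈ T.flatten, x < n + 1 := by
  intro x hx
  rw [h.flat, h.mem_iff] at hx
  omega

/-- The entries of the code are the decimal numbers of the values. -/
theorem Coded.mem_code_iff {n : ℕ} {l : List ℕ} {T : ParSeq} {δ : List DecimalNumber}
    (h : Coded n l T δ) {ν : DecimalNumber} : ν ∈ δ ↔ ∃ v, (v, ν) ∈ numberBlocks 1 T := by
  constructor
  · intro hν
    obtain ⟨i, hi⟩ := List.mem_iff_getElem?.1 hν
    exact ⟨i + 1, (h.entry _ _).2 ⟨by omega, hi⟩⟩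
  · rintro ⟨v, hv⟩
    exact List.mem_of_getElem? ((h.entry _ _).1 hv).2

/-- Different values have different decimal numbers. -/
theorem Coded.eq_of_numbering {n : ℕ} {l : List ℕ} {T : ParSeq} {δ : List DecimalNumber}
    (h : Coded n l T δ) {v w : ℕ} {ν : DecimalNumber} (hv : (v, ν) ∈ numberBlocks 1 T)
    (hw : (w, ν) ∈ numberBlocks 1 T) : v = w := by
  obtain ⟨h1, h2⟩ := (h.entry _ _).1 hv
  obtain ⟨h3, h4⟩ := (h.entry _ _).1 hw
  have := (List.getElem?_inj (List.getElem?_eq_some_iff.1 h2).1 h.valid.nodup).1 (h2.trans h4.symm)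
  omega

/-- The code is determined by the parenthesized form. -/
theorem Coded.eq_filterMap {n : ℕ} {l : List ℕ} {T : ParSeq} {δ : List DecimalNumber}
    (h : Coded n l T δ) :
    (List.range' 1 n).filterMap (fun v => (numberBlocks 1 T).lookup v) = δ := by
  have hnd : ((numberBlocks 1 T).map Prod.fst).Nodup := by rw [h.wf.map_fst]; exact h.wf.nodup
  have hf : ∀ v ∈ List.range' 1 n, (numberBlocks 1 T).lookup v =
      some (δ.getD (v - 1) ⟨[], .black⟩) := by
    intro v hv
    rw [List.mem_range'_1] at hv
    have hlt : v - 1 < δ.length := by rw [h.length]; omega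
    rw [List.getD_eq_getElem _ _ hlt]
    exact lookup_eq_some hnd ((h.entry v _).2 ⟨hv.1, List.getElem?_eq_getElem hlt⟩)
  rw [List.filterMap_congr hf, List.filterMap_eq_map']
  apply List.ext_getElem
  · simp [h.length]
  · intro i h1 h2
    simp [List.getD_eq_getElem?_getD, h2]

/-- To compare the numbering with a sequence `δ`, it is enough to find the entry of each value at
its position, since the values are `1, …, n`. -/
theorem entry_iff {T : ParSeq} (hT : T.WellFormed) {n : ℕ} {δ : List DecimalNumber}
    (hflat : T.flatten.Perm (List.range' 1 n)) (hlen : δ.length = n)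
    (h : ∀ v ∈ T.flatten, ∃ ν, (v, ν) ∈ numberBlocks 1 T ∧ δ[v - 1]? = some ν) (v : ℕ)
    (ν : DecimalNumber) : (v, ν) ∈ numberBlocks 1 T ↔ 1 ≤ v ∧ δ[v - 1]? = some ν := by
  constructor
  · intro hv
    have hvT := hT.mem_flatten_of_numbering hv
    obtain ⟨μ, h1, h2⟩ := h v hvT
    rw [hT.numbering_unique hv h1]
    exact ⟨hT.pos v hvT, h2⟩
  · rintro ⟨h1, h2⟩
    have hlt := (List.getElem?_eq_some_iff.1 h2).1
    have hvT : v ∈ T.flatten := by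
      rw [hflat.mem_iff, List.mem_range'_1]; omega
    obtain ⟨μ, h3, h4⟩ := h v hvT
    rw [h2] at h4
    rw [Option.some.inj h4]
    exact h3

theorem coded_nil : Coded 0 [] nil [] where
  perm := by simp
  wf := wellFormed_nil
  flat := rfl
  blocks_eq := by rw [blocks_nil]; rfl
  nodes := nodesPrimitive_nil
  length := rfl
  entry := by intro v ν; rw [numberBlocks]; simp
  valid := by
    refine ⟨by simp, by simp, by simp, ?_, ⟨0, ?_⟩, by simp, by simp⟩
    · rintro h ⟨ν, hν, _⟩
      simp at hν
    · intro i
      constructor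
      · rintro ⟨ν, hν, _⟩
        simp at hν
      · intro h; omega
  color := by intro v ν; rw [numberBlocks]; simp

theorem Located.head? {T t : ParSeq} {h : List ℕ} (ht : Located T h t) :
    ∃ i < T.children.length, h.head? = some (i + 1) := by
  induction ht with
  | @root i t hi => exact ⟨i, (List.getElem?_eq_some_iff.1 hi).1, rfl⟩
  | child ht _ ih => rwa [head?_append_of_ne_nil ht.ne_nil]

/-- The block labels number the outermost parentheses. -/
theorem Coded.isBlockLabel_iff {n : ℕ} {l : List ℕ} {T : ParSeq} {δ : List DecimalNumber}
    (hc : Coded n l T δ) (i : ℕ) : IsBlockLabel δ i ↔ 1 ≤ i ∧ i ≤ T.children.length := by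
  have hhead : ∀ {h : List ℕ} {t : ParSeq} {v : ℕ}, Located T h t →
      (entryOf h t v).digits.head? = h.head? := by
    intro h t v ht
    obtain ⟨x, hx⟩ := prefix_entryOf h t v
    rw [← hx, head?_append_of_ne_nil ht.ne_nil]
  constructor
  · rintro ⟨ν, hν, hi⟩
    obtain ⟨v, hv⟩ := hc.mem_code_iff.1 hν
    obtain ⟨h, t, ht, hvt, rfl⟩ := (mem_numbering hc.wf).1 hv
    obtain ⟨j, hj, e⟩ := ht.head?
    rw [hhead ht, e] at hi
    have := Option.some.inj hi
    omega
  · rintro ⟨h1, h2⟩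
    have hlt : i - 1 < T.children.length := by omega
    have ht : Located T [i - 1 + 1] T.children[i - 1] := .root (List.getElem?_eq_getElem hlt)
    rw [Nat.sub_add_cancel h1] at ht
    obtain ⟨v, hv⟩ := List.exists_mem_of_ne_nil _ (hc.wf.active_ne_nil ht.mem_parens)
    refine ⟨entryOf [i] _ v, hc.mem_code_iff.2 ⟨v, (mem_numbering hc.wf).2 ⟨_, _, ht, hv, rfl⟩⟩, ?_⟩
    rw [hhead ht]; rfl

theorem Coded.range'_succ_perm {n : ℕ} {l l' : List ℕ} {T : ParSeq} {δ : List DecimalNumber}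
    (hc : Coded n l T δ) (h : l'.Perm ((n + 1) :: l)) : l'.Perm (List.range' 1 (n + 1)) := by
  rw [List.range'_1_concat, add_comm 1 n]
  exact (h.trans (hc.perm.cons _)).trans (List.perm_append_singleton _ _).symm

/-- A new largest value at the end makes the `append` step, and all the invariants are kept. -/
theorem Coded.appendSinglet {n : ℕ} {l : List ℕ} {T : ParSeq} {δ : List DecimalNumber}
    (hc : Coded n l T δ) : ∃ δ', CodeStep δ none δ' ∧
      Coded (n + 1) (l ++ [n + 1]) (T.appendSinglet (n + 1)) δ' := by
  have hstep := CodeStep.append (δ := δ) T.children.length hc.isBlockLabel_iff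
  have hn := hc.lt
  have hnl : ∀ x ∈ l, x < n + 1 := hc.flat ▸ hn
  have hwf := hc.wf.appendSinglet hn (by omega)
  have hnum := fun {v : ℕ} {ν : DecimalNumber} =>
    numbering_appendSinglet (v := v) (ν := ν) hc.wf hn (by omega)
  have hperm := hc.range'_succ_perm (List.perm_append_singleton (n + 1) l)
  have hflat : (T.appendSinglet (n + 1)).flatten = l ++ [n + 1] := by
    rw [flatten_appendSinglet, hc.flat]
  refine ⟨_, hstep, hperm, hwf, hflat, ?_, ?_, ?_, ?_, hc.valid.step hstep, ?_⟩
  · rw [children_appendSinglet, List.map_append, hc.blocks_eq,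
      blocks_append_singleton hc.nodup hnl]
    rfl
  · exact hc.nodes.appendSinglet hc.wf hn (by omega)
  · rw [hstep.length_eq, hc.length]
  · refine entry_iff hwf (hflat ▸ hperm) (by rw [hstep.length_eq, hc.length]) ?_
    intro v hv
    rw [hflat, List.mem_append, List.mem_singleton] at hv
    rcases hv with hv | rfl
    · obtain ⟨ν, hν⟩ := hc.wf.exists_numbering (hc.flat.symm ▸ hv)
      refine ⟨ν, hnum.2 (Or.inl hν), ?_⟩
      have := ((hc.entry _ _).1 hν).2
      rw [List.getElem?_append_left (List.getElem?_eq_some_iff.1 this).1, this]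
    · refine ⟨_, hnum.2 (Or.inr ⟨rfl, rfl⟩), ?_⟩
      rw [Nat.add_sub_cancel]
      simp [← hc.length]
  · intro v ν hν
    rcases hnum.1 hν with hν | ⟨rfl, rfl⟩
    · have hv := hc.wf.mem_flatten_of_numbering hν
      rw [hc.flat] at hv
      rw [valueColor_append_of_mem hc.nodup hnl hv]
      exact hc.color v ν hν
    · rw [valueColor_append_self hc.nodup hnl]

/-- The entries `h.q.c`, where `h` is the head of a parenthesis with at least two members, are
those of its members. -/
theorem Coded.mem_code_concat_iff {n : ℕ} {l : List ℕ} {T t : ParSeq} {δ : List DecimalNumber}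
    (hc : Coded n l T δ) {h : List ℕ} (ht : Located T h t) (h2 : 2 ≤ t.active.length) {q : ℕ}
    {c : Color} : ⟨h ++ [q], c⟩ ∈ δ ↔
      ∃ x ∈ t.active, q = rank t.founders x ∧ c = ascentColor t.active x := by
  rw [hc.mem_code_iff]
  constructor
  · rintro ⟨v, hv⟩
    obtain ⟨h3, h4, h5⟩ := ht.mem_active_of_entry hc.wf hv
    exact ⟨v, h3, h4, h5⟩
  · rintro ⟨v, hv, rfl, rfl⟩
    refine ⟨v, (mem_numbering hc.wf).2 ⟨h, t, ht, hv, ?_⟩⟩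
    rw [entryOf_of_two_le h2]

/-- The conditions for joining a family in the code and in the parenthesized form agree: the
digits which follow a head are ordered like the values. -/
theorem Coded.fit_iff {n : ℕ} {l : List ℕ} {T t : ParSeq} {δ : List DecimalNumber}
    (hc : Coded n l T δ) {h : List ℕ} (ht : Located T h t) (h2 : 2 ≤ t.active.length) {m : ℕ}
    (hm : m ∈ t.active) : Fit δ h (rank t.founders m) (ascentColor t.active m) ↔
      IsFamily (insertBefore (n + 1) m t.active) := by
  have hsub : ∀ x ∈ t.active, x ∈ T.flatten := fun x hx =>
    ht.flatten_sublist.subset (mem_flatten_of_mem_active hx)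
  have hfam : IsFamily t.active := by
    rcases hc.wf.family t ht.mem_parens with ⟨w, rfl⟩ | h3
    · simp [active] at h2
    · exact h3.1
  rw [isFamily_insertBefore_iff_color hfam h2 (fun x hx => hc.wf.pos x (hsub x hx)) hm
    (fun x hx => hc.lt x (hsub x hx))]
  unfold Fit
  apply or_congr
  · apply and_congr_right
    intro _
    constructor
    · intro h3 x hx hxc
      have := h3 _ ((hc.mem_code_concat_iff ht h2).2 ⟨x, hx, rfl, hxc.symm⟩)
      by_contra hlt
      exact absurd (rank_lt_rank (mem_founders_of_mem_active hx) (not_le.1 hlt)) (by omega)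
    · intro h3 q hq
      obtain ⟨x, hx, rfl, hxc⟩ := (hc.mem_code_concat_iff ht h2).1 hq
      exact rank_mono (h3 x hx hxc.symm)
  · apply and_congr_right
    intro _
    constructor
    · intro h3 x hx hxc
      exact rank_injective (mem_founders_of_mem_active hx) (mem_founders_of_mem_active hm)
        (h3 _ ((hc.mem_code_concat_iff ht h2).2 ⟨x, hx, rfl, hxc.symm⟩))
    · intro h3 q hq
      obtain ⟨x, hx, rfl, hxc⟩ := (hc.mem_code_concat_iff ht h2).1 hq
      rw [h3 x hx hxc.symm]

/-- The digits which follow the head of a parenthesis number its members and founders. -/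
theorem Coded.exists_prefix_iff {n : ℕ} {l : List ℕ} {T t : ParSeq} {δ : List DecimalNumber}
    (hc : Coded n l T δ) {h : List ℕ} (ht : Located T h t) (h2 : 2 ≤ t.active.length) (q : ℕ) :
    (∃ ν ∈ δ, h ++ [q] <+: ν.digits) ↔ 1 ≤ q ∧ q ≤ t.founders.length := by
  constructor
  · rintro ⟨ν, hν, hp⟩
    obtain ⟨v, hv⟩ := hc.mem_code_iff.1 hν
    have key : ∀ {x}, x ∈ t.founders → h ++ [rank t.founders x] <+: ν.digits →
        1 ≤ q ∧ q ≤ t.founders.length := by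
      intro x hx hp'
      have e := List.prefix_of_prefix_length_le hp hp' (by simp)
      have e := e.eq_of_length (by simp)
      have e := (List.append_inj' e rfl).2
      simp only [List.cons.injEq, and_true] at e
      subst e
      exact ⟨rank_pos hx, rank_le_length _ _⟩
    have hvt := (ht.mem_flatten_iff hc.wf hv).2 ((List.prefix_append _ _).trans hp)
    rcases mem_flatten_iff.1 hvt with hva | ⟨s, hs, hvs⟩
    · have e := hc.wf.numbering_unique hv ((mem_numbering hc.wf).2 ⟨h, t, ht, hva, rfl⟩)
      rw [entryOf_of_two_le h2] at e
      exact key (mem_founders_of_mem_active hva) (by rw [e])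
    · exact key (least_mem_founders hs) (((ht.child hs).mem_flatten_iff hc.wf hv).1 hvs)
  · rintro ⟨h3, h4⟩
    obtain ⟨x, hx, rfl⟩ := exists_rank_eq (nodup_founders hc.wf ht.mem_parens) h3 h4
    rcases mem_founders_iff.1 hx with hx | ⟨s, hs, rfl⟩
    · exact ⟨_, (hc.mem_code_concat_iff ht h2).2 ⟨x, hx, rfl, rfl⟩, List.prefix_rfl⟩
    · have hs' := hc.wf.child_mem ht.mem_parens hs
      have hls := hc.wf.least_mem hs'
      obtain ⟨ν, hν⟩ := hc.wf.exists_numbering ((flatten_sublist_of_mem_parens hs').subset hls)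
      exact ⟨ν, hc.mem_code_iff.2 ⟨_, hν⟩, ((ht.child hs).mem_flatten_iff hc.wf hν).1 hls⟩

theorem getElem?_recode {D : List ℕ} {μ : DecimalNumber} {δ : List DecimalNumber} (i : ℕ) :
    (recode D μ δ)[i]? = δ[i]?.map fun ν => if ν.digits = D then μ else ν := by
  rw [recode, List.getElem?_map]

/-- A new largest value inserted before `m` makes the `pair` or the `join` step at the digits of
`m`, and all the invariants are kept. -/
theorem Coded.insertFriend {n : ℕ} {l : List ℕ} {T : ParSeq} {δ : List DecimalNumber}
    (hc : Coded n l T δ) {m : ℕ} {μ : DecimalNumber} (hμ : (m, μ) ∈ numberBlocks 1 T) :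
    ∃ δ', CodeStep δ (some μ.digits) δ' ∧
      Coded (n + 1) (insertBefore (n + 1) m l) (T.insertFriend (n + 1) m []) δ' := by
  have hn := hc.lt
  have hmT := hc.wf.mem_flatten_of_numbering hμ
  have hml : m ∈ l := hc.flat ▸ hmT
  have hnl : ∀ x ∈ l, x < n + 1 := hc.flat ▸ hn
  have hwf := hc.wf.insertFriend hn hmT
  have hperm := hc.range'_succ_perm (insertBefore_perm (n := n + 1) hml)
  have hflat : (T.insertFriend (n + 1) m []).flatten = insertBefore (n + 1) m l := by
    rw [flatten_insertFriend T _ hc.wf.nodup, hc.flat]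
  have hμδ : μ ∈ δ := hc.mem_code_iff.2 ⟨m, hμ⟩
  -- the new code, from the new entries of the friend and of the new value
  have key : ∀ μ' ν' : DecimalNumber, μ'.color = .blue → ν'.color = .red →
      (m, μ') ∈ numberBlocks 1 (T.insertFriend (n + 1) m []) →
      (n + 1, ν') ∈ numberBlocks 1 (T.insertFriend (n + 1) m []) →
      CodeStep δ (some μ.digits) (recode μ.digits μ' δ ++ [ν']) →
      ∃ δ', CodeStep δ (some μ.digits) δ' ∧
        Coded (n + 1) (insertBefore (n + 1) m l) (T.insertFriend (n + 1) m []) δ' := by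
    intro μ' ν' hblue hred hm' hn' hstep
    obtain ⟨hc1, hc2, hc3⟩ := valueColor_insertBefore hc.nodup hnl hml
    refine ⟨_, hstep, hperm, hwf, hflat, ?_, ?_, ?_, ?_, hc.valid.step hstep, ?_⟩
    · rw [children_insertFriend_of_not_mem T _ (by simp [hc.wf.active_nil]),
        blocks_insertBefore hc.nodup m hnl, ← hc.blocks_eq, List.map_map, List.map_map]
      apply List.map_congr_left
      intro s hs
      exact flatten_insertFriend s _ (hc.wf.nodup_of_mem (mem_parens_of_mem_children hs))
    · exact hc.nodes.insertFriend hc.wf hn hmT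
    · rw [hstep.length_eq, hc.length]
    · refine entry_iff hwf (hflat ▸ hperm) (by rw [hstep.length_eq, hc.length]) ?_
      intro v hv
      rw [hflat, mem_insertBefore hml] at hv
      rcases hv with rfl | hv
      · refine ⟨ν', hn', ?_⟩
        rw [Nat.add_sub_cancel, List.getElem?_append_right (by rw [length_recode, hc.length]),
          length_recode, hc.length, Nat.sub_self]
        rfl
      · obtain ⟨ν, hν⟩ := hc.wf.exists_numbering (hc.flat.symm ▸ hv)
        have hi := ((hc.entry _ _).1 hν).2
        have hlt : v - 1 < (recode μ.digits μ' δ).length := by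
          rw [length_recode]; exact (List.getElem?_eq_some_iff.1 hi).1
        rw [List.getElem?_append_left hlt, getElem?_recode, hi]
        by_cases hvm : v = m
        · subst hvm
          rw [hc.wf.numbering_unique hν hμ]
          exact ⟨μ', hm', by simp⟩
        · refine ⟨ν, numbering_insertFriend_of_ne hc.wf hn hmT hvm hν, ?_⟩
          have : ν.digits ≠ μ.digits := by
            intro e
            have e := hc.valid.eq_of_digits (hc.mem_code_iff.2 ⟨v, hν⟩) hμδ e
            exact hvm (hc.eq_of_numbering hν (e ▸ hμ))
          simp [this]
    · intro v ν hν
      rcases numbering_insertFriend_cases hc.wf hn hmT hν with rfl | rfl | ⟨hvm, h3⟩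
      · rw [hwf.numbering_unique hν hn', hc1, hred]
      · rw [hwf.numbering_unique hν hm', hc2, hblue]
      · have hv := hc.wf.mem_flatten_of_numbering h3
        rw [hc.flat] at hv
        rw [hc3 v hv hvm]
        exact hc.color v ν h3
  rcases numbering_step hc.wf hn hμ with hs | ⟨h, t, hs⟩
  · refine key _ _ rfl rfl hs.friend hs.new (CodeStep.pair μ.digits μ.color hμδ ?_)
    intro h p hh e hfit
    have hμe : μ = ⟨h ++ [p], μ.color⟩ := by rw [← e]
    -- the parenthesis with head `h` is the one around `m`
    obtain ⟨g, t, ht, hmt, e'⟩ := (mem_numbering hc.wf).1 hμ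
    rcases hc.wf.family t ht.mem_parens with ⟨w, rfl⟩ | hfam
    · rw [entryOf_singlet] at e'
      cases ht with
      | root hi =>
        rw [e'] at e
        have := (List.append_inj' (s₁ := []) e rfl).1
        exact hh this.symm
      | child hu hs' =>
        have := (hc.wf.inner _ hu.mem_parens _ hs').2
        simp [active] at this
    · rw [entryOf_of_two_le hfam.2] at e'
      rw [e'] at e hfit
      obtain ⟨rfl, e3⟩ := List.append_inj' e rfl
      simp only [List.cons.injEq, and_true] at e3
      rw [← e3] at hfit
      exact hs.not_fit g t _ _ ht e' ((hc.fit_iff ht hfam.2 hmt).1 hfit)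
  · have e := hc.wf.numbering_unique hμ
      ((mem_numbering hc.wf).2 ⟨h, t, hs.located, hs.mem, rfl⟩)
    rw [entryOf_of_two_le hs.two_le] at e
    have hstep := CodeStep.join (δ := δ) h (rank t.founders m) (ascentColor t.active m)
      t.founders.length hs.located.ne_nil (e ▸ hμδ)
      ((hc.fit_iff hs.located hs.two_le hs.mem).2 hs.fit)
      (hc.exists_prefix_iff hs.located hs.two_le)
    refine key _ _ rfl rfl hs.friend hs.new ?_
    rw [e]
    exact hstep

end ParSeq

/-- The code of a permutation `l` of `1, …, n` in line form. -/
def listCode (n : ℕ) (l : List ℕ) : List DecimalNumber :=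
  (List.range' 1 n).filterMap fun v => (numberBlocks 1 (parForm n l)).lookup v

open ParSeq in
theorem Coded.listCode_eq {n : ℕ} {l : List ℕ} {δ : List DecimalNumber}
    (h : Coded n l (parForm n l) δ) : listCode n l = δ := h.eq_filterMap

open ParSeq in
/-- All the invariants hold for every permutation, by induction on `n`. -/
theorem coded_listCode {n : ℕ} {l : List ℕ} (hl : l.Perm (List.range' 1 n)) :
    Coded n l (parForm n l) (listCode n l) := by
  have key : ∃ δ, Coded n l (parForm n l) δ := by
    induction n generalizing l with
    | zero =>
      have : l = [] := by simpa using hl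
      subst this
      exact ⟨[], by rw [parForm]; exact coded_nil⟩
    | succ n ih =>
      obtain ⟨l', hl', h⟩ := exists_remove_last hl
      obtain ⟨δ, hc⟩ := ih hl'
      have hnot : n + 1 ∉ l' := by
        intro h
        have := hc.mem_iff.1 h
        omega
      rcases h with rfl | ⟨m, hm, rfl⟩
      · rw [parForm_append hnot]
        obtain ⟨δ', -, h⟩ := hc.appendSinglet
        exact ⟨δ', h⟩
      · rw [parForm_insertBefore hnot hm]
        obtain ⟨μ, hμ⟩ := hc.wf.exists_numbering (hc.flat.symm ▸ hm)
        obtain ⟨δ', -, h⟩ := hc.insertFriend hμ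
        exact ⟨δ', h⟩
  obtain ⟨δ, h⟩ := key
  rwa [Coded.listCode_eq h]

theorem succ_not_mem_of_perm {n : ℕ} {l : List ℕ} (hl : l.Perm (List.range' 1 n)) :
    n + 1 ∉ l := by
  rw [hl.mem_iff, List.mem_range'_1]
  omega

/-- A new largest value at the end of a permutation makes the `append` step on its code. -/
theorem codeStep_listCode_append {n : ℕ} {l : List ℕ} (hl : l.Perm (List.range' 1 n)) :
    (l ++ [n + 1]).Perm (List.range' 1 (n + 1)) ∧
      CodeStep (listCode n l) none (listCode (n + 1) (l ++ [n + 1])) := by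
  obtain ⟨δ', h1, h2⟩ := (coded_listCode hl).appendSinglet
  rw [← parForm_append (succ_not_mem_of_perm hl)] at h2
  rw [Coded.listCode_eq h2]
  exact ⟨h2.perm, h1⟩

/-- A new largest value inserted before `m` makes a step on the code at the digits of the entry at
position `m`. -/
theorem codeStep_listCode_insertBefore {n m : ℕ} {l : List ℕ} (hl : l.Perm (List.range' 1 n))
    (h1 : 1 ≤ m) {μ : DecimalNumber} (hμ : (listCode n l)[m - 1]? = some μ) :
    (insertBefore (n + 1) m l).Perm (List.range' 1 (n + 1)) ∧
      CodeStep (listCode n l) (some μ.digits) (listCode (n + 1) (insertBefore (n + 1) m l)) := by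
  have hc := coded_listCode hl
  have hm := (hc.entry m μ).2 ⟨h1, hμ⟩
  obtain ⟨δ', h1, h2⟩ := hc.insertFriend hm
  have hml : m ∈ l := hc.flat ▸ hc.wf.mem_flatten_of_numbering hm
  rw [← parForm_insertBefore (succ_not_mem_of_perm hl) hml] at h2
  rw [Coded.listCode_eq h2]
  exact ⟨h2.perm, h1⟩

/-- A permutation is determined by its code: by `codeStep_injective` the code determines the code
without the largest value, and the digits of the friend of this value, hence its position. -/
theorem listCode_injective {n : ℕ} {l l' : List ℕ} (hl : l.Perm (List.range' 1 n))
    (hl' : l'.Perm (List.range' 1 n)) (h : listCode n l = listCode n l') : l = l' := by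
  induction n generalizing l l' with
  | zero =>
    have h1 : l = [] := by simpa using hl
    have h2 : l' = [] := by simpa using hl'
    rw [h1, h2]
  | succ n ih =>
    have hex : ∀ {k : List ℕ} {m : ℕ}, k.Perm (List.range' 1 n) → m ∈ k →
        1 ≤ m ∧ ∃ μ, (listCode n k)[m - 1]? = some μ := by
      intro k m hk hm
      have hc := coded_listCode hk
      obtain ⟨μ, hμ⟩ := hc.wf.exists_numbering (hc.flat.symm ▸ hm)
      exact ⟨((hc.entry _ _).1 hμ).1, μ, ((hc.entry _ _).1 hμ).2⟩
    obtain ⟨k, hk, h1⟩ := exists_remove_last hl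
    obtain ⟨k', hk', h2⟩ := exists_remove_last hl'
    have hv := (coded_listCode hk).valid
    have hv' := (coded_listCode hk').valid
    -- the kinds of the last steps agree, and then so do the friends
    rcases h1 with rfl | ⟨m, hm, rfl⟩ <;> rcases h2 with rfl | ⟨m', hm', rfl⟩
    · have s1 := (codeStep_listCode_append hk).2
      have s2 := (codeStep_listCode_append hk').2
      rw [ih hk hk' (codeStep_injective hv hv' s1 (h ▸ s2)).1]
    · obtain ⟨h1', μ', hμ'⟩ := hex hk' hm'
      have s1 := (codeStep_listCode_append hk).2
      have s2 := (codeStep_listCode_insertBefore hk' h1' hμ').2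
      cases (codeStep_injective hv hv' s1 (h ▸ s2)).2
    · obtain ⟨h1, μ, hμ⟩ := hex hk hm
      have s1 := (codeStep_listCode_insertBefore hk h1 hμ).2
      have s2 := (codeStep_listCode_append hk').2
      cases (codeStep_injective hv hv' s1 (h ▸ s2)).2
    · obtain ⟨h1, μ, hμ⟩ := hex hk hm
      obtain ⟨h1', μ', hμ'⟩ := hex hk' hm'
      have s1 := (codeStep_listCode_insertBefore hk h1 hμ).2
      have s2 := (codeStep_listCode_insertBefore hk' h1' hμ').2
      obtain ⟨e1, e2⟩ := codeStep_injective hv hv' s1 (h ▸ s2)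
      obtain rfl := ih hk hk' e1
      have e3 := hv.eq_of_digits (List.mem_of_getElem? hμ) (List.mem_of_getElem? hμ')
        (Option.some.inj e2)
      have := (List.getElem?_inj (List.getElem?_eq_some_iff.1 hμ).1 hv.nodup).1
        (hμ.trans (e3 ▸ hμ'.symm))
      have : m = m' := by omega
      rw [this]

/-- Every code is the code of a permutation: the last entry of the code is removed by
`exists_codeStep`, and the step so undone is made again by the insertion of a largest value at the
right place. -/
theorem exists_listCode_eq {δ : List DecimalNumber} (h : ValidCode δ) :
    ∃ l, l.Perm (List.range' 1 δ.length) ∧ listCode δ.length l = δ := by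
  induction hn : δ.length generalizing δ with
  | zero => exact ⟨[], by simp, by simp [listCode, List.eq_nil_of_length_eq_zero hn]⟩
  | succ n ih =>
    obtain ⟨X, ν, rfl⟩ := (List.eq_nil_or_concat' δ).resolve_left (by rintro rfl; simp at hn)
    obtain ⟨δ, D, hδ, hs⟩ := exists_codeStep h
    obtain ⟨l, hl, rfl⟩ := ih hδ (by have := hs.length_eq; omega)
    -- the step on the code of `l` is determined by the digits of the friend
    cases D with
    | none =>
      obtain ⟨h1, h2⟩ := codeStep_listCode_append hl
      exact ⟨_, h1, h2.unique hδ hs⟩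
    | some D =>
      obtain ⟨c, hD⟩ := hs.exists_mem
      obtain ⟨i, hi⟩ := List.mem_iff_getElem?.1 hD
      obtain ⟨h1, h2⟩ := codeStep_listCode_insertBefore hl (m := i + 1) (by omega) hi
      exact ⟨_, h1, h2.unique hδ hs⟩

/-! ### The line form -/

theorem line_perm {n : ℕ} (π : Equiv.Perm (Fin n)) : (line π).Perm (List.range' 1 n) := by
  have hnd : (line π).Nodup := by
    unfold line
    rw [List.nodup_ofFn]
    intro i j h
    exact π.injective (Fin.ext (Nat.succ.inj h))
  rw [List.perm_ext_iff_of_nodup hnd List.nodup_range']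
  intro v
  unfold line
  rw [List.mem_ofFn, List.mem_range'_1]
  constructor
  · rintro ⟨i, rfl⟩
    have := (π i).2
    omega
  · rintro ⟨h1, h2⟩
    exact ⟨π.symm ⟨v - 1, by omega⟩, by simp; omega⟩

theorem line_injective {n : ℕ} : Function.Injective (line (n := n)) := by
  intro π ρ h
  have h' := List.ofFn_injective h
  ext i
  have := congrFun h' i
  exact Nat.succ.inj this

/-- Every list of the numbers `1, …, n` is the line form of a permutation. -/
theorem exists_line_eq {n : ℕ} {l : List ℕ} (hl : l.Perm (List.range' 1 n)) :
    ∃ π : Equiv.Perm (Fin n), line π = l := by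
  have hlen : l.length = n := by rw [hl.length_eq, List.length_range']
  have hnd : l.Nodup := hl.nodup_iff.2 List.nodup_range'
  have hmem : ∀ i : Fin n, 1 ≤ l[i] ∧ l[i] < 1 + n := fun i => by
    have : l[i] ∈ List.range' 1 n := hl.mem_iff.1 (List.getElem_mem _)
    rwa [List.mem_range'_1] at this
  -- the values of the line form are shifted by one
  let f : Fin n → Fin n := fun i => ⟨l[i] - 1, by have := hmem i; omega⟩
  have hf : Function.Injective f := by
    intro i j h
    have h1 : l[i] - 1 = l[j] - 1 := congrArg Fin.val h
    have h2 := hmem i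
    have h3 := hmem j
    have h4 : l[(i : ℕ)] = l[(j : ℕ)] := by
      change l[i] = l[j]; omega
    exact Fin.ext ((hnd.getElem_inj_iff).1 h4)
  refine ⟨Equiv.ofBijective f (Finite.injective_iff_bijective.1 hf), ?_⟩
  apply List.ext_getElem
  · simp [line, hlen]
  · intro i h1 h2
    have := hmem ⟨i, by omega⟩
    simp only [line, List.getElem_ofFn, Equiv.ofBijective_apply, f]
    exact Nat.sub_add_cancel this.1

/-! ### The positions of entries, the branch heads and the node cuts -/

theorem mem_positions {δ : List DecimalNumber} {h : List ℕ} {v : ℕ} :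
    v ∈ positions δ h ↔ 1 ≤ v ∧ ∃ ν, δ[v - 1]? = some ν ∧ IsHead h ν := by
  unfold positions
  rw [List.mem_filterMap]
  constructor
  · rintro ⟨⟨ν, i⟩, h1, h2⟩
    rw [List.mem_zipIdx_iff_le_and_getElem?_sub] at h1
    split_ifs at h2 with h3
    cases h2
    exact ⟨h1.1, ν, h1.2, h3⟩
  · rintro ⟨h1, ν, h2, h3⟩
    exact ⟨(ν, v), List.mem_zipIdx_iff_le_and_getElem?_sub.2 ⟨h1, h2⟩, if_pos h3⟩

theorem nodup_positions (δ : List DecimalNumber) (h : List ℕ) : (positions δ h).Nodup := by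
  have e : positions δ h = ((δ.zipIdx 1).filter fun x => IsHead h x.1).map Prod.snd := by
    unfold positions
    rw [← List.filterMap_eq_map, ← List.filterMap_eq_filter, List.filterMap_filterMap]
    apply List.filterMap_congr
    intro x _
    by_cases hx : IsHead h x.1 <;> simp [hx, Option.guard]
  rw [e]
  refine List.Nodup.sublist (List.filter_sublist.map _) ?_
  rw [List.zipIdx_map_snd]
  exact List.nodup_range'

namespace ParSeq

/-- Each value is the position of its decimal number in the code. -/
theorem Coded.map_idxOf {n : ℕ} {l : List ℕ} {T : ParSeq} {δ : List DecimalNumber}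
    (hc : Coded n l T δ) : (numberBlocks 1 T).map (fun e => δ.idxOf e.2 + 1) = l := by
  rw [← hc.flat, ← hc.wf.map_fst]
  apply List.map_congr_left
  rintro ⟨v, ν⟩ he
  obtain ⟨h1, h2⟩ := (hc.entry v ν).1 he
  obtain ⟨hlt, rfl⟩ := List.getElem?_eq_some_iff.1 h2
  change δ.idxOf δ[v - 1] + 1 = v
  rw [hc.valid.nodup.idxOf_getElem]
  omega

theorem Coded.map_color {n : ℕ} {l : List ℕ} {T : ParSeq} {δ : List DecimalNumber}
    (hc : Coded n l T δ) :
    δ.map DecimalNumber.color = (List.range' 1 n).map (valueColor l) := by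
  apply List.ext_getElem
  · simp [hc.length]
  · intro i h1 h2
    rw [List.length_map] at h1
    rw [List.getElem_map, List.getElem_map, List.getElem_range', one_mul, add_comm]
    refine hc.color _ _ ((hc.entry _ _).2 ⟨by omega, ?_⟩)
    rw [Nat.add_sub_cancel, List.getElem?_eq_getElem h1]

/-- The positions of the entries with the head of a parenthesis are the values in it. -/
theorem Coded.positions_perm {n : ℕ} {l : List ℕ} {T t : ParSeq} {δ : List DecimalNumber}
    (hc : Coded n l T δ) {h : List ℕ} (ht : Located T h t) :
    (positions δ h).Perm t.flatten := by
  rw [List.perm_ext_iff_of_nodup (nodup_positions δ h) (hc.wf.nodup_of_mem ht.mem_parens)]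
  intro v
  rw [mem_positions]
  constructor
  · rintro ⟨h1, ν, h2, h3⟩
    exact (ht.mem_flatten_iff hc.wf ((hc.entry _ _).2 ⟨h1, h2⟩)).2 h3.2
  · intro hv
    obtain ⟨ν, hν⟩ := hc.wf.exists_numbering (ht.flatten_sublist.subset hv)
    obtain ⟨h1, h2⟩ := (hc.entry _ _).1 hν
    exact ⟨h1, ν, h2, ht.ne_nil, (ht.mem_flatten_iff hc.wf hν).1 hv⟩

/-- The positions of the entries with head `i` are the values in block `i`. The blocks are indexed
from `0`, and the heads from `1`. -/
theorem Coded.positions_block {n : ℕ} {l : List ℕ} {T : ParSeq} {δ : List DecimalNumber}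
    (hc : Coded n l T δ) (i : ℕ) : (positions δ [i + 1]).Perm ((blocks l).getD i []) := by
  rw [← hc.blocks_eq, List.getD_eq_getElem?_getD, List.getElem?_map]
  cases e : T.children[i]? with
  | some t => exact hc.positions_perm (.root e)
  | none =>
    have : positions δ [i + 1] = [] := by
      apply List.eq_nil_iff_forall_not_mem.2
      intro v hv
      obtain ⟨_, ν, h2, _, h3⟩ := mem_positions.1 hv
      have hlabel : IsBlockLabel δ (i + 1) := by
        obtain ⟨x, hx⟩ := h3
        exact ⟨ν, List.mem_of_getElem? h2, by rw [← hx]; rfl⟩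
      have := (hc.isBlockLabel_iff _).1 hlabel
      have := List.getElem?_eq_none_iff.1 e
      omega
    rw [this]
    exact List.Perm.refl _

theorem WellFormed.two_le_active_iff {T t : ParSeq} (hT : T.WellFormed) (ht : t ∈ T.parens) :
    2 ≤ t.active.length ↔ 2 ≤ t.flatten.length := by
  refine ⟨fun h => h.trans (active_sublist_flatten t).length_le, fun h => ?_⟩
  rcases hT.family t ht with ⟨v, rfl⟩ | h2
  · simp [flatten] at h
  · exact h2.2

/-- The branch heads are the heads of the parentheses with at least two elements. -/
theorem Coded.isBranchHead_iff {n : ℕ} {l : List ℕ} {T : ParSeq} {δ : List DecimalNumber}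
    (hc : Coded n l T δ) (h : List ℕ) :
    IsBranchHead δ h ↔ ∃ t, Located T h t ∧ 2 ≤ t.active.length := by
  constructor
  · rintro ⟨ν, hν, ⟨hne, hp⟩, hd⟩
    obtain ⟨v, hv⟩ := hc.mem_code_iff.1 hν
    obtain ⟨g, s, hs, hvs, rfl⟩ := (mem_numbering hc.wf).1 hv
    rcases hc.wf.family s hs.mem_parens with ⟨w, rfl⟩ | h2
    · rw [entryOf_singlet] at hp hd
      cases hs with
      | root hi =>
        have h1 := hp.length_le
        have h2 := List.length_pos_iff.2 hne
        exact absurd (hp.eq_of_length (by simp at h1 ⊢; omega)).symm hd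
      | child hu hs' =>
        have := (hc.wf.inner _ hu.mem_parens _ hs').2
        simp [active] at this
    · rw [entryOf_of_two_le h2.2] at hp hd
      have hp := (List.prefix_concat_iff.1 hp).resolve_left fun e => hd e.symm
      obtain ⟨u, hu, hsub⟩ := hs.of_prefix hne hp
      refine ⟨u, hu, (hc.wf.two_le_active_iff hu.mem_parens).2 ?_⟩
      exact ((hc.wf.two_le_active_iff hs.mem_parens).1 h2.2).trans hsub.length_le
  · rintro ⟨t, ht, h2⟩
    obtain ⟨v, hv⟩ := List.exists_mem_of_ne_nil _ (hc.wf.active_ne_nil ht.mem_parens)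
    exact isBranchHead_of_prefix ht.ne_nil
      ((hc.mem_code_concat_iff ht h2).2 ⟨v, hv, rfl, rfl⟩) List.prefix_rfl

/-- The node cut of a branch head is the colored pairing sequence of the primitive permutation at
the node. -/
theorem Coded.nodeCut_eq {n : ℕ} {l : List ℕ} {T t : ParSeq} {δ : List DecimalNumber}
    (hc : Coded n l T δ) {h : List ℕ} (ht : Located T h t) (h2 : 2 ≤ t.active.length)
    {A : List ℕ} {B : List (ℕ × ℕ)} {P : List ℤ}
    (hp : PrimitiveNode (numberBlocks 1 T) h t A B P) : nodeCut δ h = coloredPairing A P := by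
  have hT := hc.wf
  have hnode : ∀ v ∈ t.node, v ∈ T.flatten := fun v hv =>
    ht.flatten_sublist.subset ((node_sublist_flatten t).subset hv)
  -- the values of the node, in increasing order
  set S := (List.range' 1 n).filter (· ∈ t.node) with hS
  have hSmem : ∀ v, v ∈ S ↔ v ∈ t.node := by
    intro v
    rw [hS, List.mem_filter, decide_eq_true_eq, ← hc.perm.mem_iff, ← hc.flat]
    exact ⟨fun h => h.2, fun h => ⟨hnode v h, h⟩⟩
  have hsorted : S.Pairwise (· < ·) := sorted_range'_filter n _
  have hSperm : S.Perm t.node := by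
    rw [List.perm_ext_iff_of_nodup (hsorted.imp fun h => ne_of_lt h)
      ((hT.nodup_of_mem ht.mem_parens).sublist (node_sublist_flatten t))]
    exact hSmem
  -- the entry of a value
  let f : ℕ → DecimalNumber := fun v => δ.getD (v - 1) ⟨[], .black⟩
  have hf : ∀ v ∈ T.flatten, (v, f v) ∈ numberBlocks 1 T := by
    intro v hv
    obtain ⟨ν, hν⟩ := hT.exists_numbering hv
    have e := ((hc.entry _ _).1 hν).2
    have : f v = ν := by simp only [f, List.getD_eq_getElem?_getD, e, Option.getD_some]
    rw [this]
    exact hν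
  have hδ : δ = (List.range' 1 n).map f := by
    apply List.ext_getElem
    · simp [hc.length]
    · intro i h1 h2
      simp [f, List.getD_eq_getElem?_getD, h1]
  -- the values outside the node do not contribute to the node cut
  have hcut : nodeCut δ h = S.filterMap fun v => cutEntry h (f v) := by
    conv_lhs => rw [hδ]
    rw [nodeCut, List.filterMap_map, hS, ← List.filterMap_eq_filter, List.filterMap_filterMap]
    apply List.filterMap_congr
    intro v hv
    rw [← hc.perm.mem_iff, ← hc.flat] at hv
    by_cases hvn : v ∈ t.node
    · simp [Option.guard, hvn]
    · simp [Option.guard, hvn, hp.outside v _ (hf v hv) hvn]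
  -- the element of the colored pairing sequence at the position of a value
  let g : ℕ → ℕ × Mark := fun v =>
    ((P.getD (rank t.node v - 1) 0).natAbs,
      if P.getD (rank t.node v - 1) 0 < 0 then .two
      else if -(P.getD (rank t.node v - 1) 0) ∈ P then .one
      else .leaf (ascentColor A (rank t.node v)))
  have hg : ∀ v ∈ S, cutEntry h (f v) = some (g v) := by
    intro v hv
    have hv := (hSmem v).1 hv
    simp only [g, List.getD_eq_getElem?_getD]
    by_cases hva : v ∈ t.active
    · obtain ⟨h3, h4⟩ := hp.member v hva
      have e := hT.numbering_unique (hf v (hnode v hv))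
        ((mem_numbering hT).2 ⟨h, t, ht, hva, rfl⟩)
      have hcol : ascentColor A (rank t.node v) = ascentColor t.active v := by
        rw [hp.active_eq]
        refine ascentColor_map hva (fun x hx y hy => rank_lt_rank_iff (mem_node_of_mem_active hy))
          (fun x hx => ?_) (fun x hx => rank_pos (mem_node_of_mem_active hx))
        exact hT.pos x (hnode x (mem_node_of_mem_active hx))
      rw [e, entryOf_of_two_le h2, cutEntry_append_singleton ht.ne_nil, h3, Option.getD_some,
        if_neg (by omega), if_neg h4, Int.natAbs_natCast, hcol]
    · obtain ⟨x, h3, h4, h5⟩ := hp.bud v _ (hf v (hnode v hv)) hv hva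
      rw [h4, h3, Option.getD_some]
      by_cases hx : x < 0
      · rw [if_pos hx, if_pos hx]
      · rw [if_neg hx, if_neg hx, if_pos (h5.resolve_left hx)]
  rw [hcut, List.filterMap_congr hg, List.filterMap_eq_map', coloredPairing]
  have hlen : S.length = P.length := by rw [hSperm.length_eq, hp.length]
  apply List.ext_getElem
  · simp [hlen]
  · intro i h3 h4
    rw [List.length_map] at h3
    -- the ranks of the values of the node in increasing order are `1, 2, 3, …`
    have hr : rank t.node S[i] = i + 1 := by
      rw [← rank_perm hSperm, rank_getElem_of_sorted hsorted]
    rw [List.getElem_map, List.getElem_map, List.getElem_zipIdx]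
    simp only [g, hr, Nat.add_sub_cancel]
    rw [List.getD_eq_getElem _ _ (hlen ▸ h3), add_comm 1 i]

open Classical in
/-- The parenthesis with a given head, and the empty sequence if there is none. -/
noncomputable def atHead (T : ParSeq) (h : List ℕ) : ParSeq :=
  if e : ∃ t, Located T h t then e.choose else nil

theorem Located.atHead_eq {T t : ParSeq} {h : List ℕ} (hT : T.WellFormed) (ht : Located T h t) :
    T.atHead h = t := by
  have e : ∃ t, Located T h t := ⟨t, ht⟩
  rw [atHead, dif_pos e]
  exact e.choose_spec.eq hT ht

theorem Coded.located_atHead {n : ℕ} {l : List ℕ} {T : ParSeq} {δ : List DecimalNumber}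
    (hc : Coded n l T δ) {h : List ℕ} (hh : IsBranchHead δ h) :
    Located T h (T.atHead h) ∧ 2 ≤ (T.atHead h).active.length := by
  obtain ⟨t, ht, h2⟩ := (hc.isBranchHead_iff h).1 hh
  rw [ht.atHead_eq hc.wf]
  exact ⟨ht, h2⟩

/-- The branch heads are in bijection with the parentheses with at least two elements. -/
theorem Coded.bijOn_atHead {n : ℕ} {l : List ℕ} {T : ParSeq} {δ : List DecimalNumber}
    (hc : Coded n l T δ) : Set.BijOn T.atHead {h | IsBranchHead δ h}
      {t | t ∈ T.parens ∧ 2 ≤ t.flatten.length} := by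
  refine ⟨?_, ?_, ?_⟩
  · intro h hh
    obtain ⟨ht, h2⟩ := hc.located_atHead hh
    exact ⟨ht.mem_parens, (hc.wf.two_le_active_iff ht.mem_parens).1 h2⟩
  · intro h hh g hg e
    have h1 := (hc.located_atHead hh).1
    have h2 := (hc.located_atHead hg).1
    rw [← e] at h2
    exact h1.head_eq hc.wf h2
  · rintro t ⟨ht, h2⟩
    obtain ⟨h, hh⟩ := exists_located ht
    exact ⟨h, (hc.isBranchHead_iff h).2 ⟨t, hh, (hc.wf.two_le_active_iff ht).2 h2⟩,
      hh.atHead_eq hc.wf⟩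

/-- A head of length at least two is located in the parenthesis one digit shorter. -/
theorem Located.mem_children {T t : ParSeq} {h : List ℕ} {p : ℕ} (hh : h ≠ [])
    (ht : Located T (h ++ [p]) t) : ∃ u, Located T h u ∧ t ∈ u.children := by
  generalize e : h ++ [p] = g at ht
  cases ht with
  | root hi => exact absurd (List.append_inj' (s₂ := []) e rfl).1 hh
  | @child g' u _ hu hs =>
    obtain ⟨rfl, -⟩ := List.append_inj' e rfl
    exact ⟨u, hu, hs⟩

theorem Located.getElem?_children {T t : ParSeq} {i : ℕ} (ht : Located T [i + 1] t) :
    T.children[i]? = some t := by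
  generalize e : [i + 1] = g at ht
  cases ht with
  | root hi =>
    have := (List.cons.inj e).1
    rwa [Nat.succ.inj this]
  | child hu hs => exact absurd (List.append_inj' (s₁ := []) e rfl).1.symm hu.ne_nil

end ParSeq

theorem bijOn_decimalCode (n : ℕ) :
    Set.BijOn (decimalCode (n := n)) Set.univ {δ | IsDecimalCode δ ∧ δ.length = n} := by
  refine ⟨?_, ?_, ?_⟩
  · intro π _
    have hc := coded_listCode (line_perm π)
    exact ⟨(isDecimalCode_iff_validCode _).2 hc.valid, hc.length⟩
  · intro π _ ρ _ h
    exact line_injective (listCode_injective (line_perm π) (line_perm ρ) h)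
  · rintro δ ⟨h, rfl⟩
    obtain ⟨l, hl, e⟩ := exists_listCode_eq ((isDecimalCode_iff_validCode δ).1 h)
    obtain ⟨π, rfl⟩ := exists_line_eq hl
    exact ⟨π, Set.mem_univ _, e⟩

end PermTree

theorem mainTheorem7 (n : ℕ) :
    Set.BijOn (decimalCode (n := n)) Set.univ {δ | IsDecimalCode δ ∧ δ.length = n} ∧
    ∀ π : Equiv.Perm (Fin n),
      -- removing the parentheses gives back the line form
      (parenthesized π).flatten = line π ∧
      -- the values of the permutation are the positions of their decimal numbers in the code
      (numbered π).map (fun e => (decimalCode π).idxOf e.2 + 1) = line π ∧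
      -- the colors are the ascent, descent, singlet status of the values
      (decimalCode π).map DecimalNumber.color = (List.range' 1 n).map (valueColor (line π)) ∧
      -- the outermost parentheses are the blocks, and heads of length 1 index the blocks
      (parenthesized π).children.map ParSeq.flatten = blocks (line π) ∧
      (∀ i : ℕ, (positions (decimalCode π) [i + 1]).Perm ((blocks (line π)).getD i [])) ∧
      -- branch heads correspond to the parentheses (other than singlets)
      ∃ par : List ℕ → ParSeq,
        Set.BijOn par {h | IsBranchHead (decimalCode π) h}
          {t | t ∈ (parenthesized π).parens ∧ 2 ≤ t.flatten.length} ∧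
        (∀ i : ℕ, IsBranchHead (decimalCode π) [i + 1] →
          (parenthesized π).children[i]? = some (par [i + 1])) ∧
        (∀ h p, h ≠ [] → IsBranchHead (decimalCode π) (h ++ [p]) →
          par (h ++ [p]) ∈ (par h).children) ∧
        ∀ h, IsBranchHead (decimalCode π) h →
          (positions (decimalCode π) h).Perm (par h).flatten ∧
          (∀ v p c, 1 ≤ v → (decimalCode π)[v - 1]? = some ⟨h ++ [p], c⟩ → v ∈ (par h).active) ∧
          -- the node cut is the pairing sequence of the primitive permutation at the node
          ∃ A B P, IsPrimitive (pattern (par h).node) A B P ∧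
            A = (par h).active.map (rank (par h).node) ∧
            nodeCut (decimalCode π) h = coloredPairing A P := by
  refine ⟨bijOn_decimalCode n, fun π => ?_⟩
  have hc : ParSeq.Coded n (line π) (parenthesized π) (decimalCode π) :=
    coded_listCode (line_perm π)
  refine ⟨hc.flat, hc.map_idxOf, hc.map_color, hc.blocks_eq, hc.positions_block,
    (parenthesized π).atHead, hc.bijOn_atHead, ?_, ?_, ?_⟩
  · intro i hi
    exact (hc.located_atHead hi).1.getElem?_children
  · intro h p hh hp
    obtain ⟨u, hu, hs⟩ := (hc.located_atHead hp).1.mem_children hh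
    rwa [hu.atHead_eq hc.wf]
  · intro h hh
    obtain ⟨ht, h2⟩ := hc.located_atHead hh
    obtain ⟨A, B, P, hp⟩ := hc.nodes h _ ht h2
    refine ⟨hc.positions_perm ht, ?_, A, B, P, hp.prim, hp.active_eq, hc.nodeCut_eq ht h2 hp⟩
    intro v p c hv e
    exact (ht.mem_active_of_entry hc.wf ((hc.entry _ _).2 ⟨hv, e⟩)).1
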